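/- Conventions. Write $\mathbb R^3=\mathbb R^2\times\mathbb R$. A (tame, oriented) knot $K$ is the ambient isotopy class of an oriented simple closed polygon in $\mathbb R^3$. A diagram of $K$ is an oriented simple closed polygon $D\subset\mathbb R^3$ representing $K$ whose vertical projection to $\mathbb R^2$ is regular: it has only finitely many multiple points, each of them is a double point, and no vertex of $D$ projects to a double point. The double points are the crossings of $D$; the upper and the lower of the two points of $D$ over a crossing are called an overcrossing and an undercrossing. Let $c(D)$ be the number of crossings of $D$, and $c(K)=\min\{c(D): D \text{ is a diagram of } K\}$. If $c(D)\ge 1$, there are points $s_1,f_1,s_2,f_2,\dots,s_k,f_k$ of $D$, $k\ge 1$, in this cyclic order along $D$, none of them an overcrossing or an undercrossing, such that each closed arc $[s_i,f_i]$ contains at least one overcrossing and no undercrossing (an overpass), and each closed arc $[f_i,s_{i+1}]$, with $s_{k+1}=s_1$, contains at least one undercrossing and no overcrossing (an underpass). The number $k$ of overpasses depends only on $D$ and is denoted $b(D)$; if $c(D)=0$, put $b(D)=0$. Theorem 2.9. If $D$ is a diagram of a knot $K$ with $c(D)=c(K)$, then $$b(D)\le c(D)\le b(D)\,(b(D)-2).$$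 -/

import Mathlib

/-!  Polygonal knots in three-space, their knot types (ambient isotopy classes), regular projections,
crossings, overpasses and underpasses. -/

/-- The projection plane. -/
abbrev Plane : Type := ℝ × ℝ

/-- Three-space `ℝ³ = ℝ² × ℝ`. For a point `P`, `P.1` is its projection to the plane and
`P.2` is its height above the plane. -/
abbrev Space : Type := Plane × ℝ

/-- The piecewise linear path `ℝ → ℝ³` through the points `v i`, `i ∈ ℤ`: on `[i, i + 1]` it runs
affinely from `v i` to `v (i + 1)`. -/
noncomputable def polygonalPath (v : ℤ → Space) (t : ℝ) : Space :=
  (1 - Int.fract t) • v ⌊t⌋ + Int.fract t • v (⌊t⌋ + 1)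

/-- An oriented polygonal knot: a simple closed polygon in `ℝ³` with `size` vertices, listed
cyclically (as a `size`-periodic sequence) in the direction of the orientation. -/
structure PolygonalKnot where
  size : ℕ
  size_pos : 0 < size
  vertex : ℤ → Space
  closed : ∀ i : ℤ, vertex (i + size) = vertex i
  simple : ∀ s t : ℝ, polygonalPath vertex s = polygonalPath vertex t →
    ∃ m : ℤ, t = s + m * size

namespace PolygonalKnot

/-- The standard parametrization of the knot by `ℝ`, periodic with period `K.size`. -/
noncomputable def param (K : PolygonalKnot) (t : ℝ) : Space := polygonalPath K.vertex t

/-- The set of points of the knot. -/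
def points (K : PolygonalKnot) : Set Space := Set.range K.param

/-- Oriented knots `K` and `L` are isotopic: some ambient isotopy `H` of `ℝ³`, starting at the
identity, ends at a homeomorphism that carries `K` onto `L` and respects the orientations (in the
parametrizations it is given by an increasing bijection of `ℝ`). -/
def Isotopic (K L : PolygonalKnot) : Prop :=
  ∃ H : unitInterval → (Space ≃ₜ Space),
    Continuous (fun x : unitInterval × Space => H x.1 x.2) ∧
    (∀ P, H 0 P = P) ∧
    ∃ φ : ℝ ≃o ℝ, ∀ t, H 1 (K.param t) = L.param (φ t)

theorem Isotopic.refl (K : PolygonalKnot) : K.Isotopic K :=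
  ⟨fun _ => Homeomorph.refl _, continuous_snd, fun _ => rfl, OrderIso.refl ℝ, fun _ => rfl⟩

theorem Isotopic.symm {K L : PolygonalKnot} (h : K.Isotopic L) : L.Isotopic K := by
  obtain ⟨H, hc, h0, φ, hφ⟩ := h
  refine ⟨fun t => (H 1).symm.trans (H (unitInterval.symm t)), ?_, ?_, φ.symm, ?_⟩
  · have hg : Continuous (fun x : unitInterval × Space =>
        (unitInterval.symm x.1, (H 1).symm x.2)) :=
      (unitInterval.continuous_symm.comp continuous_fst).prodMk
        ((H 1).symm.continuous.comp continuous_snd)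
    exact hc.comp hg
  · intro P
    simp
  · intro t
    have := hφ (φ.symm t)
    simp only [OrderIso.apply_symm_apply] at this
    simp [← this, h0]

theorem Isotopic.trans {K L M : PolygonalKnot} (h : K.Isotopic L) (h' : L.Isotopic M) :
    K.Isotopic M := by
  obtain ⟨H, hc, h0, φ, hφ⟩ := h
  obtain ⟨G, gc, g0, ψ, hψ⟩ := h'
  refine ⟨fun t => (H t).trans (G t), ?_, ?_, φ.trans ψ, ?_⟩
  · exact gc.comp (continuous_fst.prodMk hc)
  · intro P
    simp [h0, g0]
  · intro t
    simp [hφ, hψ]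

instance isotopySetoid : Setoid PolygonalKnot where
  r := Isotopic
  iseqv := ⟨Isotopic.refl, Isotopic.symm, Isotopic.trans⟩

/-- The multiple points of the projection of the knot to the plane. -/
def multiplePoints (K : PolygonalKnot) : Set Plane :=
  {x | ∃ P ∈ K.points, ∃ Q ∈ K.points, P ≠ Q ∧ P.1 = x ∧ Q.1 = x}

end PolygonalKnot

/-- A knot is an isotopy class of (oriented) polygonal knots, so it is tame. -/
def Knot : Type := Quotient PolygonalKnot.isotopySetoid

/-- A knot diagram: a polygonal knot whose projection to the plane is regular, that is, it has only
finitely many multiple points, these are double points, and no vertex projects to one of them (so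
the two branches at a double point cross transversely). The heights record which branch is the
upper one at each double point. -/
structure KnotDiagram extends PolygonalKnot where
  finite_multiplePoints : toPolygonalKnot.multiplePoints.Finite
  double : ∀ P ∈ toPolygonalKnot.points, ∀ Q ∈ toPolygonalKnot.points,
    ∀ R ∈ toPolygonalKnot.points, P.1 = Q.1 → Q.1 = R.1 → P = Q ∨ Q = R ∨ P = R
  vertex_notMem : ∀ i : ℤ, (vertex i).1 ∉ toPolygonalKnot.multiplePoints

namespace KnotDiagram

/-- The knot (type) that the diagram `D` represents; `D` is a diagram of `K` iff
`D.knot = K`. -/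
def knot (D : KnotDiagram) : Knot := Quotient.mk _ D.toPolygonalKnot

/-- `c(D)`, the number of crossings, i.e. of double points of the projection. -/
noncomputable def c (D : KnotDiagram) : ℕ := D.multiplePoints.ncard

/-- The point of `D` with parameter `t` is an overcrossing. -/
def IsOver (D : KnotDiagram) (t : ℝ) : Prop :=
  ∃ Q ∈ D.points, Q.1 = (D.param t).1 ∧ Q.2 < (D.param t).2

/-- The point of `D` with parameter `t` is an undercrossing. -/
def IsUnder (D : KnotDiagram) (t : ℝ) : Prop :=
  ∃ Q ∈ D.points, Q.1 = (D.param t).1 ∧ (D.param t).2 < Q.2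

/-- The parameters `s 0 < f 0 < s 1 < f 1 < ⋯ < s (k-1) < f (k-1) < s k = s 0 + D.size` describe an
over-underpass sequence of `2k` points of `D` (the point with parameter `s k` is again the one with
parameter `s 0`): none of the points is an over- or undercrossing, each closed arc `[s i, f i]` is an
overpass (it contains an overcrossing and no undercrossing), and each closed arc `[f i, s (i+1)]` is
an underpass (it contains an undercrossing and no overcrossing). -/
structure IsOverUnderpassSequence (D : KnotDiagram) (k : ℕ) (s f : ℕ → ℝ) : Prop where
  pos : 0 < k
  lt_left : ∀ i < k, s i < f i
  lt_right : ∀ i < k, f i < s (i + 1)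
  around : s k = s 0 + D.size
  start_regular : ∀ i < k, ¬ D.IsOver (s i) ∧ ¬ D.IsUnder (s i)
  finish_regular : ∀ i < k, ¬ D.IsOver (f i) ∧ ¬ D.IsUnder (f i)
  overpass : ∀ i < k, (∃ t ∈ Set.Icc (s i) (f i), D.IsOver t) ∧
    ∀ t ∈ Set.Icc (s i) (f i), ¬ D.IsUnder t
  underpass : ∀ i < k, (∃ t ∈ Set.Icc (f i) (s (i + 1)), D.IsUnder t) ∧
    ∀ t ∈ Set.Icc (f i) (s (i + 1)), ¬ D.IsOver t

/-- `b(D)`, the number of overpasses of `D`: zero if `D` has no crossing, and otherwise the number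
`k` of overpasses with respect to an over-underpass sequence. (That `k` is the same for all
over-underpass sequences of `D`; the infimum selects it.) -/
noncomputable def b (D : KnotDiagram) : ℕ :=
  if D.c = 0 then 0 else sInf {k : ℕ | ∃ s f : ℕ → ℝ, D.IsOverUnderpassSequence k s f}

end KnotDiagram

/-- `c(K)`, the least number of crossings of a diagram of the knot `K`. -/
noncomputable def Knot.crossingNumber (K : Knot) : ℕ :=
  sInf {m : ℕ | ∃ D : KnotDiagram, D.knot = K ∧ D.c = m}

/-! Every crossing lies on exactly one overpass and exactly one underpass, so crossings can be
counted by such pairs. The bound `b(D) ≤ c(D)` is the easy half: each overpass contains an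
overcrossing, and different overpasses yield different crossings (`le_c`). For the upper bound let
`D` be minimal with `k` overpasses. Then an overpass and an underpass cross at most once, and an
overpass crosses neither of the two underpasses adjacent to it. Each overpass thus meets at most `k
- 2` underpasses, once each (`c_le`).

Both facts come from one move. An arc above all the rest of the knot can be moved, with its ends
fixed, to run above any other plane path with these ends; the same holds for an arc below all the
rest. If an overpass and an underpass cross twice, the two pieces between these crossings exchange
their positions in the plane, the upper one remaining upper. The new projection follows the old one,
so no double point is created, while at the two crossings the corners can be cut and the double
points disappear (`exists_c_lt_of_bigon`). If an overpass crosses an adjacent underpass, the loop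
from the crossing back to itself is traversed backwards instead, and that crossing disappears
(`exists_c_lt_of_loop`, `exists_c_lt_of_loop'`). The short paths that join the exchanged pieces to
the rest are called gates; `exists_c_lt_of_gates` carries out the exchange once they are given.

The isotopy is written down explicitly in `exists_replace_over`. A vertical homeomorphism lifts the
arc above everything else so that its height increases along it until a last strand leads down
again. A horizontal plane at such a height meets the curve in only two points, one on the rising arc
and one on the descending strand. Multiplication by a complex number about the second point moves
the first one to its new place, provided that the new path avoids the second point. The result is
again piecewise affine, hence a polygonal knot up to parametrization (`exists_polygonalKnot`). -/

section

open Set Filter Topology Pointwise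

/-! ### Ambient isotopies -/

/-- The homeomorphism `F` of space is the end of an ambient isotopy starting at the identity. -/
def IsotopicToId (F : Space ≃ₜ Space) : Prop :=
  ∃ H : unitInterval → (Space ≃ₜ Space),
    Continuous (fun x : unitInterval × Space => H x.1 x.2) ∧ (∀ P, H 0 P = P) ∧ H 1 = F

theorem IsotopicToId.trans {F G : Space ≃ₜ Space} (hF : IsotopicToId F) (hG : IsotopicToId G) :
    IsotopicToId (F.trans G) := by
  obtain ⟨H, hc, h0, rfl⟩ := hF
  obtain ⟨H', hc', h0', rfl⟩ := hG
  refine ⟨fun t => (H t).trans (H' t), ?_, ?_, rfl⟩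
  · exact hc'.comp (continuous_fst.prodMk hc)
  · intro P
    simp [h0, h0']

/-- With `M = reflectZ` this turns isotopies that move an arc above all the rest into isotopies that
move an arc below it, and it makes isotopy compatible with mirror images. -/
theorem IsotopicToId.conj {F : Space ≃ₜ Space} (hF : IsotopicToId F) (M : Space ≃ₜ Space) :
    IsotopicToId ((M.trans F).trans M.symm) := by
  obtain ⟨H, hc, h0, rfl⟩ := hF
  refine ⟨fun t => (M.trans (H t)).trans M.symm, ?_, ?_, rfl⟩
  · exact M.symm.continuous.comp
      (hc.comp (continuous_fst.prodMk (M.continuous.comp continuous_snd)))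
  · intro P
    simp [h0]

/-- Reflection of space in the projection plane. -/
def reflectZ : Space ≃ₜ Space := (Homeomorph.refl Plane).prodCongr (Homeomorph.neg ℝ)

@[simp] theorem reflectZ_apply (x : Plane) (z : ℝ) : reflectZ (x, z) = (x, -z) := rfl

@[simp] theorem reflectZ_symm_apply (x : Plane) (z : ℝ) : reflectZ.symm (x, z) = (x, -z) := rfl

/-- A fibrewise strictly increasing surjective continuous map over the plane is a homeomorphism. -/
theorem exists_fibrewise_homeomorph (f : Space → ℝ) (hf : Continuous f)
    (hmono : ∀ x, StrictMono fun z => f (x, z)) (hsurj : ∀ x, Function.Surjective fun z => f (x, z)) :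
    ∃ F : Space ≃ₜ Space, ∀ P, F P = (P.1, f P) := by
  choose g hg using hsurj
  change ∀ x b, f (x, g x b) = b at hg
  have hg' : ∀ x z, g x (f (x, z)) = z := fun x z => (hmono x).injective (hg x _)
  have hgc : Continuous fun P : Space => g P.1 P.2 := by
    -- Continuity of the inverse is tested on open rays: since the fibre maps increase, the preimage
    -- of a ray with end `c` is one side of the graph of `x ↦ f (x, c)`.
    rw [OrderTopology.continuous_iff]
    intro c
    have hfc : Continuous fun P : Space => f (P.1, c) :=
      hf.comp (continuous_fst.prodMk continuous_const)
    constructor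
    · have : (fun P : Space => g P.1 P.2) ⁻¹' Ioi c = {P : Space | f (P.1, c) < P.2} := by
        ext P
        simp only [mem_preimage, mem_Ioi, mem_ofPred_eq]
        rw [← (hmono P.1).lt_iff_lt, hg]
      rw [this]
      exact isOpen_lt hfc continuous_snd
    · have : (fun P : Space => g P.1 P.2) ⁻¹' Iio c = {P : Space | P.2 < f (P.1, c)} := by
        ext P
        simp only [mem_preimage, mem_Iio, mem_ofPred_eq]
        rw [← (hmono P.1).lt_iff_lt, hg]
      rw [this]
      exact isOpen_lt continuous_snd hfc
  refine ⟨⟨⟨fun P => (P.1, f P), fun P => (P.1, g P.1 P.2), ?_, ?_⟩, ?_, ?_⟩, fun P => rfl⟩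
  · intro P
    simp [hg']
  · intro P
    have := hg P.1 P.2
    exact Prod.ext rfl this
  · exact continuous_fst.prodMk hf
  · exact continuous_fst.prodMk hgc

/-- Raising every point by a bounded amount that increases with the height is isotopic to the
identity. -/
theorem exists_raise (l : Space → ℝ) (hl : Continuous l) (hmono : ∀ x, Monotone fun z => l (x, z))
    (u : Plane → ℝ) (h0 : ∀ P, 0 ≤ l P) (hu : ∀ P, l P ≤ u P.1) :
    ∃ F, IsotopicToId F ∧ ∀ P, F P = (P.1, P.2 + l P) := by
  have key : ∀ s : unitInterval, ∃ F : Space ≃ₜ Space, ∀ P, F P = (P.1, P.2 + s * l P) := by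
    intro s
    have hc : Continuous fun P : Space => P.2 + (s : ℝ) * l P :=
      continuous_snd.add (continuous_const.mul hl)
    refine exists_fibrewise_homeomorph _ hc ?_ ?_
    · intro x z z' hz
      have := hmono x hz.le
      have := mul_le_mul_of_nonneg_left this s.2.1
      simp only at *
      linarith
    · intro x w
      have hc' : Continuous fun z : ℝ => z + (s : ℝ) * l (x, z) :=
        hc.comp (continuous_const.prodMk continuous_id)
      -- The bound `u` depends on the plane point alone, so the heights `w - u x` and `w` are sent
      -- below and above `w`.
      have h1 : w ∈ Icc ((w - u x) + (s : ℝ) * l (x, w - u x)) (w + (s : ℝ) * l (x, w)) := by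
        have a1 := hu (x, w - u x)
        have a2 := mul_le_of_le_one_left (h0 (x, w - u x)) s.2.2
        have a3 := mul_nonneg s.2.1 (h0 (x, w))
        constructor <;> simp only at * <;> linarith
      have hle : w - u x ≤ w := by
        have := (h0 (x, w)).trans (hu (x, w))
        simp only at *
        linarith
      obtain ⟨z, -, hz⟩ := intermediate_value_Icc hle hc'.continuousOn h1
      exact ⟨z, hz⟩
  choose H hH using key
  refine ⟨H 1, ⟨H, ?_, ?_, rfl⟩, ?_⟩
  · simp only [hH]
    fun_prop
  · intro P
    simp [hH]
  · intro P
    simp [hH]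

/-- An arc `[a, b]` of a curve, lying above the remaining arc `[b, e]` over `[a₀, b₀]`, can be
raised over `[a₀, b₀]`. -/
theorem exists_lift_arc {d : ℝ → Plane} {h : ℝ → ℝ} (hd : Continuous d) (hh : Continuous h)
    {a a₀ b₀ b e : ℝ} (hbe : b ≤ e)
    (hinj : InjOn d (Icc a b))
    (habove : ∀ t ∈ Icc a₀ b₀, ∀ s ∈ Icc b e, d s = d t → h s < h t)
    {l : ℝ → ℝ} (hl : Continuous l) (hl0 : ∀ t, 0 ≤ l t) (hsupp : ∀ t, t ∉ Icc a₀ b₀ → l t = 0) :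
    ∃ F, IsotopicToId F ∧ (∀ t ∈ Icc a b, F (d t, h t) = (d t, h t + l t)) ∧
      ∀ t ∈ Icc b e, F (d t, h t) = (d t, h t) := by
  set γ : ℝ → Space := fun t => (d t, h t) with hγ
  have hγc : Continuous γ := hd.prodMk hh
  -- `R` consists of the remaining arc and everything vertically below it. It is closed, and stable
  -- under going down; so the distance to `R` vanishes on that arc and does not decrease with the
  -- height.
  set R : Set Space := γ '' Icc b e + {P : Space | P.1 = 0 ∧ P.2 ≤ 0} with hR
  have hRc : IsClosed R := by
    refine IsClosed.add_left_of_isCompact ?_ (isCompact_Icc.image hγc)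
    exact (isClosed_eq continuous_fst continuous_const).inter
      (isClosed_le continuous_snd continuous_const)
  have hRmem : ∀ P : Space, P ∈ R ↔ ∃ t ∈ Icc b e, d t = P.1 ∧ P.2 ≤ h t := by
    intro P
    constructor
    · rintro ⟨_, ⟨t, ht, rfl⟩, Q, ⟨h1, h2⟩, rfl⟩
      refine ⟨t, ht, ?_, ?_⟩
      · simp [hγ, h1]
      · simpa [hγ] using h2
    · rintro ⟨t, ht, h1, h2⟩
      refine ⟨γ t, ⟨t, ht, rfl⟩, (0, P.2 - h t), ⟨rfl, by simpa using h2⟩, ?_⟩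
      exact Prod.ext (by simp [hγ, h1]) (by simp [hγ])
  have hRne : R.Nonempty := ⟨γ b, (hRmem _).2 ⟨b, ⟨le_rfl, hbe⟩, rfl, le_rfl⟩⟩
  set u : Space → ℝ := fun P => Metric.infDist P R with hu
  have huc : Continuous u := Metric.continuous_infDist_pt R
  have humono : ∀ x, Monotone fun z => u (x, z) := by
    intro x z z' hz
    refine (Metric.le_infDist hRne).2 fun y hy => ?_
    obtain ⟨t, ht, h1, h2⟩ := (hRmem y).1 hy
    have hy' : ((y.1, y.2 - (z' - z)) : Space) ∈ R :=
      (hRmem _).2 ⟨t, ht, h1, by simp only; linarith⟩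
    refine (Metric.infDist_le_dist_of_mem hy').trans (le_of_eq ?_)
    simp only [Prod.dist_eq, Real.dist_eq]
    congr 2
    ring
  have hupos : ∀ t ∈ Icc a₀ b₀, 0 < u (γ t) := by
    intro t ht
    rw [hu, ← hRc.notMem_iff_infDist_pos hRne, hRmem]
    rintro ⟨s, hs, h1, h2⟩
    exact absurd (habove t ht s hs h1) (not_lt.2 h2)
  obtain ⟨L, hL⟩ : ∃ L : ℝ, ∀ t ∈ Icc a₀ b₀, l t ≤ L * u (γ t) := by
    have hcont : ContinuousOn (fun t => l t / u (γ t)) (Icc a₀ b₀) :=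
      hl.continuousOn.div (huc.comp hγc).continuousOn fun t ht => (hupos t ht).ne'
    obtain ⟨L, hL⟩ := (isCompact_Icc.bddAbove_image hcont)
    refine ⟨L, fun t ht => ?_⟩
    have := hL ⟨t, ht, rfl⟩
    rwa [div_le_iff₀ (hupos t ht)] at this
  have hL0 : ∀ t ∈ Icc a₀ b₀, l t ≤ max L 0 * u (γ t) := fun t ht =>
    (hL t ht).trans (mul_le_mul_of_nonneg_right (le_max_left _ _) (hupos t ht).le)
  -- The arc projects injectively, so its projection is a closed embedded arc and Tietze's theorem
  -- extends `l`, carried over to it, to the whole plane.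
  obtain ⟨m, hm⟩ : ∃ m : C(Plane, ℝ), ∀ t ∈ Icc a b, m (d t) = l t := by
    have hemb : IsClosedEmbedding (fun t : Icc a b => d t) :=
      (hd.comp continuous_subtype_val).isClosedEmbedding fun s t hst =>
        Subtype.ext (hinj s.2 t.2 hst)
    obtain ⟨m, hm⟩ := ContinuousMap.exists_extension' hemb ⟨fun t : Icc a b => l t, by fun_prop⟩
    exact ⟨m, fun t ht => congrFun hm ⟨t, ht⟩⟩
  have hu0 : ∀ P, 0 ≤ max L 0 * u P := fun P => mul_nonneg (le_max_right _ _) Metric.infDist_nonneg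
  -- In the minimum, the multiple of the distance makes the lift vanish on the remaining arc and
  -- increase with the height. The extension `m` gives the right value on `[a, b]`, where by the
  -- choice of `L` it is the smaller of the two, and it bounds the lift over each plane point.
  obtain ⟨F, hF, hFP⟩ := exists_raise (fun P => min (max L 0 * u P) (max (m P.1) 0))
    (by have := m.continuous; fun_prop)
    (fun x z z' hz => min_le_min_right _
      (mul_le_mul_of_nonneg_left (humono x hz) (le_max_right _ _)))
    (fun x => max (m x) 0)
    (fun P => le_min (hu0 P) (le_max_right _ _)) (fun P => min_le_right _ _)
  refine ⟨F, hF, fun t ht => ?_, fun t ht => ?_⟩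
  · rw [hFP]
    simp only [hm t ht, max_eq_left (hl0 t)]
    by_cases h' : t ∈ Icc a₀ b₀
    · rw [min_eq_right (hL0 t h')]
    · rw [hsupp t h', min_eq_right (hu0 _)]
  · rw [hFP]
    have : u (d t, h t) = 0 :=
      Metric.infDist_zero_of_mem ((hRmem _).2 ⟨t, ht, rfl, le_rfl⟩)
    simp only [this, mul_zero, min_eq_left (le_max_right (m (d t)) 0), add_zero]

/-- The identification of the complex numbers with the plane. -/
noncomputable def complexToPlane : ℂ ≃L[ℝ] Plane := Complex.equivRealProdCLM

/-- Multiplying each horizontal plane, at height `z`, by a complex number `r z ≠ 0` about a centre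
`c z` is isotopic to the identity if `r z = 1` for low `z` and `r` is eventually constant. -/
theorem exists_twist {c r : ℝ → ℂ} (hc : Continuous c) (hr : Continuous r) (hr0 : ∀ z, r z ≠ 0)
    {z₀ z₁ : ℝ} (h₀ : ∀ z ≤ z₀, r z = 1) (h₁ : ∀ z, z₁ ≤ z → r z = r z₁) :
    ∃ F, IsotopicToId F ∧ ∀ y z, F (y, z) = (complexToPlane (c z + (complexToPlane.symm y - c z) * r z), z) := by
  -- At time `s` the factor is frozen above the height `z₀ + s * (z₁ - z₀)`. The twist thus enters
  -- from below, and a winding of `r` around `0` need not be undone: it is left to the planes above.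
  have key : ∀ s : unitInterval, ∃ F : Space ≃ₜ Space, ∀ P,
      F P = (complexToPlane (c P.2 + (complexToPlane.symm P.1 - c P.2) * r (min P.2 (z₀ + s * (z₁ - z₀)))), P.2) := by
    intro s
    have hE := complexToPlane.continuous
    have hE' := complexToPlane.symm.continuous
    refine ⟨⟨⟨fun P => (complexToPlane (c P.2 + (complexToPlane.symm P.1 - c P.2) * r (min P.2 (z₀ + s * (z₁ - z₀)))), P.2),
      fun P => (complexToPlane (c P.2 + (complexToPlane.symm P.1 - c P.2) / r (min P.2 (z₀ + s * (z₁ - z₀)))), P.2),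
      ?_, ?_⟩, ?_, ?_⟩, fun P => rfl⟩
    · intro P
      have := hr0 (min P.2 (z₀ + s * (z₁ - z₀)))
      simp [this]
    · intro P
      have := hr0 (min P.2 (z₀ + s * (z₁ - z₀)))
      simp [this]
    · fun_prop
    · fun_prop (disch := exact fun _ => hr0 _)
  choose H hH using key
  have hE := complexToPlane.continuous
  have hE' := complexToPlane.symm.continuous
  refine ⟨H 1, ⟨H, ?_, ?_, rfl⟩, ?_⟩
  · simp only [hH]
    fun_prop
  · intro P
    rw [hH, h₀ _ (by simp)]
    simp
  · intro y z
    rw [hH]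
    have : r (min z z₁) = r z := by
      rcases le_total z z₁ with h | h
      · rw [min_eq_left h]
      · rw [min_eq_right h, h₁ z h]
    simp [this]

/-- In a range of heights, a point can be moved along any path that avoids the centre `x z`, keeping
the centre and the other heights fixed. -/
theorem exists_level_move {p p' x : ℝ → Plane} (hp : Continuous p) (hp' : Continuous p')
    (hx : Continuous x) {z₀ z₁ z₂ : ℝ} (h01 : z₀ ≤ z₁)
    (h₀ : p z₀ = p' z₀) (h₁ : ∀ z ∈ Icc z₁ z₂, p z = p' z)
    (hpx : ∀ z ∈ Icc z₀ z₁, p z ≠ x z) (hpx' : ∀ z ∈ Icc z₀ z₁, p' z ≠ x z)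
    (h12 : z₁ ≤ z₂) :
    ∃ F, IsotopicToId F ∧ (∀ z ∈ Icc z₀ z₂, F (p z, z) = (p' z, z)) ∧
      (∀ z, F (x z, z) = (x z, z)) ∧ (∀ z ≤ z₀, ∀ y, F (y, z) = (y, z)) := by
  -- Clamping the height to `[z₀, z₁]` makes the quotient below meaningful at all heights, as `p` is
  -- known to avoid the centre only there.
  set ι : ℝ → ℝ := fun z => max z₀ (min z₁ z) with hι
  have hιm : ∀ z, ι z ∈ Icc z₀ z₁ := fun z => ⟨le_max_left _ _, max_le h01 (min_le_left _ _)⟩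
  have hιc : Continuous ι := by fun_prop
  have hE' := complexToPlane.symm.continuous
  have hne : ∀ z, complexToPlane.symm (p (ι z)) - complexToPlane.symm (x (ι z)) ≠ 0 := fun z hz =>
    hpx _ (hιm z) (complexToPlane.symm.injective (sub_eq_zero.1 hz))
  have hne' : ∀ z, complexToPlane.symm (p' (ι z)) - complexToPlane.symm (x (ι z)) ≠ 0 := fun z hz =>
    hpx' _ (hιm z) (complexToPlane.symm.injective (sub_eq_zero.1 hz))
  -- The rotation and dilation about `x` that takes `p` to `p'`; it is `1` at both ends because the
  -- two paths agree there.
  set r : ℝ → ℂ := fun z => (complexToPlane.symm (p' (ι z)) - complexToPlane.symm (x (ι z))) /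
    (complexToPlane.symm (p (ι z)) - complexToPlane.symm (x (ι z))) with hr
  have hrc : Continuous r := by
    refine Continuous.div ?_ ?_ hne <;> fun_prop
  have h1 : ∀ z ≤ z₀, r z = 1 := by
    intro z hz
    have : ι z = z₀ := max_eq_left ((min_le_right _ _).trans hz)
    have hn := hne z
    simp only [hr]
    rw [this] at hn ⊢
    rw [← h₀]
    exact div_self hn
  have h2 : ∀ z, z₁ ≤ z → r z = 1 := by
    intro z hz
    have : ι z = z₁ := by
      simp only [hι]
      rw [min_eq_left hz, max_eq_right h01]
    have hn := hne z
    simp only [hr]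
    rw [this] at hn ⊢
    rw [← h₁ z₁ ⟨le_rfl, h12⟩]
    exact div_self hn
  obtain ⟨F, hF, hFP⟩ := exists_twist (c := fun z => complexToPlane.symm (x z)) (by fun_prop) hrc
    (fun z => div_ne_zero (hne' z) (hne z)) h1 (z₁ := z₁)
    (fun z hz => by rw [h2 z hz, h2 z₁ le_rfl])
  refine ⟨F, hF, fun z hz => ?_, fun z => ?_, fun z hz y => ?_⟩
  · rw [hFP]
    rcases le_total z z₁ with h | h
    · have hz' : ι z = z := by
        simp only [hι]
        rw [min_eq_right h, max_eq_right hz.1]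
      have hn := hne z
      simp only [hr]
      rw [hz'] at hn ⊢
      rw [mul_div_cancel₀ _ hn]
      simp
    · rw [h2 z h, h₁ z ⟨h, hz.2⟩]
      simp
  · rw [hFP]
    simp
  · rw [hFP, h1 z hz]
    simp

/-! ### Closed curves, and replacing an arc above or below all the rest -/

/-- `f` agrees on `S` with an affine function. -/
def AffineOnSet {V : Type*} [AddCommGroup V] [Module ℝ V] (f : ℝ → V) (S : Set ℝ) : Prop :=
  ∃ p v : V, ∀ t ∈ S, f t = p + t • v

theorem AffineOnSet.mono {V : Type*} [AddCommGroup V] [Module ℝ V] {f : ℝ → V} {S T : Set ℝ}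
    (h : AffineOnSet f S) (hTS : T ⊆ S) : AffineOnSet f T := by
  obtain ⟨p, v, hpv⟩ := h
  exact ⟨p, v, fun t ht => hpv t (hTS ht)⟩

theorem AffineOnSet.congr {V : Type*} [AddCommGroup V] [Module ℝ V] {f g : ℝ → V} {S : Set ℝ}
    (h : AffineOnSet f S) (hfg : ∀ t ∈ S, g t = f t) : AffineOnSet g S := by
  obtain ⟨p, v, hpv⟩ := h
  exact ⟨p, v, fun t ht => (hfg t ht).trans (hpv t ht)⟩

theorem AffineOnSet.prodMk {V W : Type*} [AddCommGroup V] [Module ℝ V] [AddCommGroup W] [Module ℝ W]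
    {f : ℝ → V} {g : ℝ → W} {S : Set ℝ} (hf : AffineOnSet f S) (hg : AffineOnSet g S) :
    AffineOnSet (fun t => (f t, g t)) S := by
  obtain ⟨p, v, h⟩ := hf
  obtain ⟨q, w, h'⟩ := hg
  exact ⟨(p, q), (v, w), fun t ht => by simp [h t ht, h' t ht]⟩

theorem AffineOnSet.fst {V W : Type*} [AddCommGroup V] [Module ℝ V] [AddCommGroup W] [Module ℝ W]
    {f : ℝ → V × W} {S : Set ℝ} (hf : AffineOnSet f S) : AffineOnSet (fun t => (f t).1) S := by
  obtain ⟨p, v, h⟩ := hf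
  exact ⟨p.1, v.1, fun t ht => by simp [h t ht]⟩

theorem AffineOnSet.snd {V W : Type*} [AddCommGroup V] [Module ℝ V] [AddCommGroup W] [Module ℝ W]
    {f : ℝ → V × W} {S : Set ℝ} (hf : AffineOnSet f S) : AffineOnSet (fun t => (f t).2) S := by
  obtain ⟨p, v, h⟩ := hf
  exact ⟨p.2, v.2, fun t ht => by simp [h t ht]⟩

/-- A closed curve in space, parametrized with period `n`, injective up to the period. -/
structure IsClosedCurve (n : ℝ) (γ : ℝ → Space) : Prop where
  pos : 0 < n
  continuous : Continuous γ
  periodic : ∀ t, γ (t + n) = γ t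
  simple : ∀ s t, γ s = γ t → ∃ m : ℤ, t = s + m * n

namespace IsClosedCurve

variable {n : ℝ} {γ : ℝ → Space}

theorem comp (hγ : IsClosedCurve n γ) (F : Space ≃ₜ Space) : IsClosedCurve n fun t => F (γ t) where
  pos := hγ.pos
  continuous := F.continuous.comp hγ.continuous
  periodic t := by rw [hγ.periodic]
  simple s t h := hγ.simple s t (F.injective h)

theorem eq_of_abs_lt (hγ : IsClosedCurve n γ) {s t : ℝ} (h : γ s = γ t) (hst : s < t + n)
    (hts : t < s + n) : s = t := by
  obtain ⟨m, rfl⟩ := hγ.simple s t h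
  have hn := hγ.pos
  have h1 : (m : ℝ) < 1 := by
    by_contra! h
    nlinarith
  have h2 : (-1 : ℝ) < m := by
    by_contra! h
    nlinarith
  have h1' : m < 1 := by exact_mod_cast h1
  have h2' : -1 < m := by exact_mod_cast h2
  have : m = 0 := by omega
  simp [this]

theorem periodic_int (hγ : IsClosedCurve n γ) (t : ℝ) (m : ℤ) : γ (t + m * n) = γ t := by
  have h : Function.Periodic γ n := hγ.periodic
  exact h.int_mul m t

theorem exists_mem_Ico (hγ : IsClosedCurve n γ) (a t : ℝ) :
    ∃ s ∈ Ico a (a + n), ∃ m : ℤ, t = s + m * n := by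
  refine ⟨toIcoMod hγ.pos a t, toIcoMod_mem_Ico _ _ _, toIcoDiv hγ.pos a t, ?_⟩
  rw [← zsmul_eq_mul, toIcoMod_add_toIcoDiv_zsmul]

theorem bddAbove (hγ : IsClosedCurve n γ) : ∃ Z, ∀ t, |(γ t).2| ≤ Z := by
  have hc : Continuous fun t => |(γ t).2| := by
    have := hγ.continuous
    fun_prop
  obtain ⟨Z, hZ⟩ := (isCompact_Icc (a := (0 : ℝ)) (b := 0 + n)).bddAbove_image hc.continuousOn
  refine ⟨Z, fun t => ?_⟩
  obtain ⟨s, hs, m, rfl⟩ := hγ.exists_mem_Ico 0 t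
  rw [hγ.periodic_int]
  exact hZ ⟨s, Ico_subset_Icc_self hs, rfl⟩

/-- An arc that lies above all the rest of the curve can be moved, over all the rest, to run above
any other path in the plane with the same ends. -/
theorem exists_replace_over (hγ : IsClosedCurve n γ) {a a₀ a₁ b₂ b₁ b₀ b : ℝ}
    (h1 : a < a₀) (h2 : a₀ < a₁) (h3 : a₁ ≤ b₂) (h4 : b₂ < b₁) (h5 : b₁ < b₀) (h6 : b₀ < b)
    (h7 : b < a + n)
    (hover : ∀ t ∈ Icc a b, ∀ s, (γ s).1 = (γ t).1 → (γ s).2 ≤ (γ t).2)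
    (haff₀ : AffineOnSet (fun t => (γ t).2) (Icc a₀ a₁))
    (haff₁ : AffineOnSet (fun t => (γ t).2) (Icc b₁ b₀))
    {p : ℝ → Plane} (hp : ContinuousOn p (Icc a₁ b₁)) (hpa : ∀ t ∈ Icc a₀ a₁, p t = (γ t).1)
    (hpb : ∀ t ∈ Icc b₂ b₀, p t = (γ t).1)
    (hpole : ∀ t ∈ Icc a₁ b₂, ∀ s ∈ Icc b₁ b₀, p t ≠ (γ s).1) (Z : ℝ) :
    ∃ F, IsotopicToId F ∧ ∃ g : ℝ → ℝ,
      (∀ t ∈ Icc a₀ b₀, F (γ t) = (p t, g t)) ∧ (∀ t ∈ Icc b₀ (a₀ + n), F (γ t) = γ t) ∧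
      AffineOnSet g (Icc a₀ a₁) ∧ AffineOnSet g (Icc a₁ b₁) ∧ AffineOnSet g (Icc b₁ b₀) ∧
      (∀ t ∈ Icc a₁ b₁, Z ≤ g t) ∧ (∀ t ∈ Icc a₀ a₁, (γ t).2 ≤ g t) ∧
      (∀ t ∈ Icc b₁ b₀, (γ t).2 ≤ g t) := by
  obtain ⟨Z', hZ'⟩ := hγ.bddAbove
  obtain ⟨z, hz, hzZ⟩ : ∃ z, (∀ t, (γ t).2 < z) ∧ Z ≤ z :=
    ⟨max (Z' + 1) Z, fun t => lt_max_of_lt_left (by have := (abs_le.1 (hZ' t)).2; linarith),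
      le_max_right _ _⟩
  have hc := hγ.continuous
  -- A point of the curve that is not lower than the arc point over the same place is that arc
  -- point. The parameter `a + n` is kept apart, since it gives the point of `a` once more.
  have hsame : ∀ t ∈ Icc a b, ∀ s ∈ Icc a (a + n), (γ s).1 = (γ t).1 → (γ t).2 ≤ (γ s).2 →
      s = t ∨ s = a + n := by
    intro t ht s hs hst hle
    rcases hs.2.lt_or_eq with h | h
    · exact Or.inl (hγ.eq_of_abs_lt (Prod.ext hst (le_antisymm (hover t ht s hst) hle))
        (by linarith [ht.1]) (by linarith [ht.2, hs.1]))
    · exact Or.inr h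
  have hinj : InjOn (fun t => (γ t).1) (Icc a b) := by
    intro s hs t ht hst
    rcases hsame t ht s ⟨hs.1, hs.2.trans h7.le⟩ hst (hover s hs t hst.symm) with h | h
    · exact h
    · linarith [hs.2]
  -- the lift
  set φ : ℝ → ℝ := fun t => max 0 (min 1 ((t - a₀) / (a₁ - a₀))) with hφ
  set ψ : ℝ → ℝ := fun t => max 0 (min 1 ((b₀ - t) / (b₀ - b₁))) with hψ
  set θ : ℝ → ℝ := fun t => max 0 (min 1 ((t - a₁) / (b₁ - a₁))) with hθ
  set κ : ℝ → ℝ := fun t => max a₁ (min b₁ t) with hκ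
  -- Chosen so that the lifted height on `[a₁, b₁]` is `z + θ t`, increasing from `z` to `z + 1`.
  -- The ramps `φ` and `ψ` join this affinely, over `[a₀, a₁]` and `[b₁, b₀]`, to the unchanged
  -- heights at `a₀` and `b₀`; `κ` makes the correction constant on the ramps.
  set l : ℝ → ℝ := fun t => φ t * ψ t * (z + θ t - (γ (κ t)).2) with hl
  have e1 : 0 < a₁ - a₀ := by linarith
  have e2 : 0 < b₀ - b₁ := by linarith
  have e3 : 0 < b₁ - a₁ := by linarith
  have hφ1 : ∀ t, a₁ ≤ t → φ t = 1 := by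
    intro t ht
    have : 1 ≤ (t - a₀) / (a₁ - a₀) := by rw [le_div_iff₀ e1]; linarith
    simp [hφ, min_eq_left this]
  have hφ0 : ∀ t, t ≤ a₀ → φ t = 0 := by
    intro t ht
    have : (t - a₀) / (a₁ - a₀) ≤ 0 := div_nonpos_of_nonpos_of_nonneg (by linarith) e1.le
    simp [hφ, this]
  have hφm : ∀ t ∈ Icc a₀ a₁, φ t = (t - a₀) / (a₁ - a₀) := by
    intro t ht
    have g1 : (t - a₀) / (a₁ - a₀) ≤ 1 := by rw [div_le_one e1]; linarith [ht.2]
    have g2 : 0 ≤ (t - a₀) / (a₁ - a₀) := div_nonneg (by linarith [ht.1]) e1.le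
    simp [hφ, g1, g2]
  have hψ1 : ∀ t, t ≤ b₁ → ψ t = 1 := by
    intro t ht
    have : 1 ≤ (b₀ - t) / (b₀ - b₁) := by rw [le_div_iff₀ e2]; linarith
    simp [hψ, min_eq_left this]
  have hψ0 : ∀ t, b₀ ≤ t → ψ t = 0 := by
    intro t ht
    have : (b₀ - t) / (b₀ - b₁) ≤ 0 := div_nonpos_of_nonpos_of_nonneg (by linarith) e2.le
    simp [hψ, this]
  have hψm : ∀ t ∈ Icc b₁ b₀, ψ t = (b₀ - t) / (b₀ - b₁) := by
    intro t ht
    have g1 : (b₀ - t) / (b₀ - b₁) ≤ 1 := by rw [div_le_one e2]; linarith [ht.1]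
    have g2 : 0 ≤ (b₀ - t) / (b₀ - b₁) := div_nonneg (by linarith [ht.2]) e2.le
    simp [hψ, g1, g2]
  have hθ1 : ∀ t, b₁ ≤ t → θ t = 1 := by
    intro t ht
    have : 1 ≤ (t - a₁) / (b₁ - a₁) := by rw [le_div_iff₀ e3]; linarith
    simp [hθ, min_eq_left this]
  have hθ0 : ∀ t, t ≤ a₁ → θ t = 0 := by
    intro t ht
    have : (t - a₁) / (b₁ - a₁) ≤ 0 := div_nonpos_of_nonpos_of_nonneg (by linarith) e3.le
    simp [hθ, this]
  have hθm : ∀ t ∈ Icc a₁ b₁, θ t = (t - a₁) / (b₁ - a₁) := by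
    intro t ht
    have g1 : (t - a₁) / (b₁ - a₁) ≤ 1 := by rw [div_le_one e3]; linarith [ht.2]
    have g2 : 0 ≤ (t - a₁) / (b₁ - a₁) := div_nonneg (by linarith [ht.1]) e3.le
    simp [hθ, g1, g2]
  have hl0 : ∀ t, 0 ≤ l t := by
    intro t
    have g1 : 0 ≤ φ t := le_max_left _ _
    have g2 : 0 ≤ ψ t := le_max_left _ _
    have g3 : 0 ≤ θ t := le_max_left _ _
    have := hz (κ t)
    exact mul_nonneg (mul_nonneg g1 g2) (by linarith)
  have hla : ∀ t ∈ Icc a₀ a₁, l t = (t - a₀) / (a₁ - a₀) * (z - (γ a₁).2) := by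
    intro t ht
    have : κ t = a₁ := max_eq_left ((min_le_right _ _).trans ht.2)
    simp only [hl]
    rw [hφm t ht, hψ1 t (by linarith [ht.2]), hθ0 t ht.2, this]
    ring
  have hlb : ∀ t ∈ Icc b₁ b₀, l t = (b₀ - t) / (b₀ - b₁) * (z + 1 - (γ b₁).2) := by
    intro t ht
    have : κ t = b₁ := by
      simp only [hκ]
      rw [min_eq_left ht.1, max_eq_right (by linarith)]
    simp only [hl]
    rw [hψm t ht, hφ1 t (by linarith [ht.1]), hθ1 t ht.1, this]
    ring
  have hlm : ∀ t ∈ Icc a₁ b₁, l t = z + (t - a₁) / (b₁ - a₁) - (γ t).2 := by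
    intro t ht
    have : κ t = t := by
      simp only [hκ]
      rw [min_eq_right ht.2, max_eq_right ht.1]
    simp only [hl]
    rw [hφ1 t ht.1, hψ1 t ht.2, hθm t ht, this]
    ring
  obtain ⟨F₁, hF₁, hF₁in, hF₁out⟩ := exists_lift_arc (d := fun t => (γ t).1)
    (h := fun t => (γ t).2) (a := a) (a₀ := a₀) (b₀ := b₀) (b := b) (e := a + n)
    (by fun_prop) (by fun_prop) h7.le hinj
    (by
      intro t ht s hs hst
      by_contra! hle
      have ht' : t ∈ Icc a b := ⟨by linarith [ht.1], by linarith [ht.2]⟩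
      rcases hsame t ht' s ⟨by linarith [hs.1], hs.2⟩ hst hle with h | h
      · linarith [ht.2, hs.1]
      · have : t = a := hinj ht' ⟨le_rfl, by linarith⟩ (by
          simp only at hst ⊢
          rw [← hst, h, hγ.periodic])
        linarith [ht.1])
    (l := l) (by fun_prop) hl0 (by
      intro t ht
      by_cases h : t < a₀
      · simp [hl, hφ0 t h.le]
      · have : b₀ ≤ t := by
          by_contra! h'
          exact ht ⟨not_lt.1 h, h'.le⟩
        simp [hl, hψ0 t this])
  -- the move in the planes of heights between `z` and `z + 1`
  set δ : ℝ → ℝ := fun w => max a₁ (min b₁ (a₁ + (w - z) * (b₁ - a₁))) with hδ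
  have hδm : ∀ w, δ w ∈ Icc a₁ b₁ := fun w =>
    ⟨le_max_left _ _, max_le (by linarith) (min_le_left _ _)⟩
  have hδv : ∀ w ∈ Icc z (z + 1), δ w = a₁ + (w - z) * (b₁ - a₁) := by
    intro w hw
    simp only [hδ]
    rw [min_eq_right (by nlinarith [hw.1, hw.2]), max_eq_right (by nlinarith [hw.1])]
  have ezb : 0 < z + 1 - (γ b₀).2 := by linarith [hz b₀]
  -- At a height `w` between `z` and `z + 1` the lifted curve has only the points with parameters `δ
  -- w`, on the rising part, and `ω w`, on the strand descending over `[b₁, b₀]`. The latter is the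
  -- centre of the twist.
  set ω : ℝ → ℝ := fun w =>
    max b₁ (min b₀ (b₁ + (z + 1 - w) / (z + 1 - (γ b₀).2) * (b₀ - b₁))) with hω
  have hωm : ∀ w, ω w ∈ Icc b₁ b₀ := fun w =>
    ⟨le_max_left _ _, max_le (by linarith) (min_le_left _ _)⟩
  -- The two points meet at height `z + 1`. The move is over before that, at the height belonging to
  -- `b₂`, because `p` is the old path from `b₂` on.
  have ez1 : (b₂ - a₁) / (b₁ - a₁) < 1 := by rw [div_lt_one e3]; linarith
  have ez0 : 0 ≤ (b₂ - a₁) / (b₁ - a₁) := div_nonneg (by linarith) e3.le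
  have hδle : ∀ w ∈ Icc z (z + (b₂ - a₁) / (b₁ - a₁)), δ w ∈ Icc a₁ b₂ := by
    intro w hw
    refine ⟨(hδm w).1, ?_⟩
    rw [hδv w ⟨hw.1, by linarith [hw.2]⟩]
    have : w - z ≤ (b₂ - a₁) / (b₁ - a₁) := by linarith [hw.2]
    rw [le_div_iff₀ e3] at this
    linarith
  obtain ⟨F₂, hF₂, hF₂p, hF₂x, hF₂low⟩ := exists_level_move
    (p := fun w => (γ (δ w)).1) (p' := fun w => p (δ w)) (x := fun w => (γ (ω w)).1)
    (by fun_prop) (hp.comp_continuous (by fun_prop) hδm) (by fun_prop)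
    (z₀ := z) (z₁ := z + (b₂ - a₁) / (b₁ - a₁)) (z₂ := z + 1) (by linarith)
    (by
      have : δ z = a₁ := by rw [hδv z ⟨le_rfl, by linarith⟩]; ring
      simp only [this]
      rw [hpa a₁ ⟨h2.le, le_rfl⟩])
    (by
      intro w hw
      refine (hpb _ ⟨?_, (hδm w).2.trans h5.le⟩).symm
      rw [hδv w ⟨by linarith [hw.1], hw.2⟩]
      have : (b₂ - a₁) / (b₁ - a₁) ≤ w - z := by linarith [hw.1]
      rw [div_le_iff₀ e3] at this
      linarith)
    (by
      intro w hw h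
      have q1 := hδle w hw
      have q2 := hωm w
      have := hinj ⟨by linarith [q1.1], by linarith [q1.2]⟩ ⟨by linarith [q2.1], by linarith [q2.2]⟩ h
      linarith [q1.2, q2.1])
    (by
      intro w hw
      exact hpole _ (hδle w hw) _ (hωm w))
    (by linarith)
  have hout : ∀ t ∈ Icc b (a + n), F₁ (γ t) = γ t := hF₁out
  have hin : ∀ t ∈ Icc a b, F₁ (γ t) = ((γ t).1, (γ t).2 + l t) := hF₁in
  have hlow : ∀ t, F₂ (γ t) = γ t := fun t => hF₂low _ (hz t).le _
  refine ⟨F₁.trans F₂, hF₁.trans hF₂, fun t => (γ t).2 + l t, ?_, ?_, ?_, ?_, ?_, ?_, ?_, ?_⟩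
  · intro t ht
    simp only [Homeomorph.trans_apply]
    rw [hin t ⟨by linarith [ht.1], by linarith [ht.2]⟩]
    rcases le_total t a₁ with h | h
    · have ht' : t ∈ Icc a₀ a₁ := ⟨ht.1, h⟩
      rw [hpa t ht']
      refine hF₂low _ ?_ _
      -- On the first ramp the height interpolates affinely between `(γ a₀).2 < z` and `z`, so it
      -- does not exceed `z`, and up to that height the second homeomorphism is the identity.
      obtain ⟨q, v, hqv⟩ := haff₀
      have r1 := hqv t ht'
      have r2 := hqv a₁ ⟨h2.le, le_rfl⟩
      have r3 := hqv a₀ ⟨le_rfl, h2.le⟩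
      simp only [smul_eq_mul] at r1 r2 r3
      rw [hla t ht']
      have r4 := hz a₀
      have r5 : z - ((γ t).2 + (t - a₀) / (a₁ - a₀) * (z - (γ a₁).2)) =
          (a₁ - t) / (a₁ - a₀) * (z - (γ a₀).2) := by
        rw [r1, r2, r3]
        field_simp
        ring
      have r6 : 0 ≤ (a₁ - t) / (a₁ - a₀) * (z - (γ a₀).2) :=
        mul_nonneg (div_nonneg (by linarith) e1.le) (by linarith)
      linarith
    · rcases le_total t b₁ with h' | h'
      · have ht' : t ∈ Icc a₁ b₁ := ⟨h, h'⟩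
        rw [hlm t ht']
        have r1 : 0 ≤ (t - a₁) / (b₁ - a₁) := div_nonneg (by linarith) e3.le
        have r2 : (t - a₁) / (b₁ - a₁) ≤ 1 := by rw [div_le_one e3]; linarith
        have r3 : (γ t).2 + (z + (t - a₁) / (b₁ - a₁) - (γ t).2) = z + (t - a₁) / (b₁ - a₁) := by
          ring
        rw [r3]
        have hmem : z + (t - a₁) / (b₁ - a₁) ∈ Icc z (z + 1) := ⟨by linarith, by linarith⟩
        have := hF₂p _ hmem
        have r4 : δ (z + (t - a₁) / (b₁ - a₁)) = t := by
          rw [hδv _ hmem]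
          field_simp
          ring
        simp only [r4] at this
        exact this
      · have ht' : t ∈ Icc b₁ b₀ := ⟨h', ht.2⟩
        rw [hpb t ⟨by linarith, ht.2⟩]
        obtain ⟨q, v, hqv⟩ := haff₁
        have r1 := hqv t ht'
        have r2 := hqv b₁ ⟨le_rfl, h5.le⟩
        have r3 := hqv b₀ ⟨h5.le, le_rfl⟩
        simp only [smul_eq_mul] at r1 r2 r3
        have r5 : (γ t).2 + l t = z + 1 - (t - b₁) / (b₀ - b₁) * (z + 1 - (γ b₀).2) := by
          rw [hlb t ht', r1, r2, r3]
          field_simp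
          ring
        have r6 : ω ((γ t).2 + l t) = t := by
          have : b₁ + (z + 1 - ((γ t).2 + l t)) / (z + 1 - (γ b₀).2) * (b₀ - b₁) = t := by
            rw [r5]
            field_simp
            ring
          simp only [hω]
          rw [this, min_eq_right ht.2, max_eq_right h']
        have := hF₂x ((γ t).2 + l t)
        simpa only [r6] using this
  · intro t ht
    simp only [Homeomorph.trans_apply]
    have : F₁ (γ t) = γ t := by
      rcases le_total t b with h | h
      · rw [hin t ⟨by linarith [ht.1], h⟩]
        simp [hl, hψ0 t ht.1]
      · rcases le_total t (a + n) with h' | h'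
        · exact hout t ⟨h, h'⟩
        · have h0 : γ t = γ (t - n) := by rw [← hγ.periodic (t - n), sub_add_cancel]
          rw [h0, hin (t - n) ⟨by linarith, by linarith [ht.2]⟩]
          simp [hl, hφ0 (t - n) (by linarith [ht.2])]
    rw [this, hlow]
  · obtain ⟨q, v, hqv⟩ := haff₀
    refine ⟨q - a₀ / (a₁ - a₀) * (z - (γ a₁).2), v + (z - (γ a₁).2) / (a₁ - a₀), fun t ht => ?_⟩
    have := hqv t ht
    simp only [smul_eq_mul] at this ⊢
    rw [hla t ht, this]
    ring
  · refine ⟨z - a₁ / (b₁ - a₁), 1 / (b₁ - a₁), fun t ht => ?_⟩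
    simp only [smul_eq_mul]
    rw [hlm t ht]
    ring
  · obtain ⟨q, v, hqv⟩ := haff₁
    refine ⟨q + b₀ / (b₀ - b₁) * (z + 1 - (γ b₁).2), v - (z + 1 - (γ b₁).2) / (b₀ - b₁),
      fun t ht => ?_⟩
    have := hqv t ht
    simp only [smul_eq_mul] at this ⊢
    rw [hlb t ht, this]
    ring
  · intro t ht
    have : 0 ≤ (t - a₁) / (b₁ - a₁) := div_nonneg (by linarith [ht.1]) e3.le
    simp only
    rw [hlm t ht]
    linarith
  · intro t _
    linarith [hl0 t]
  · intro t _
    linarith [hl0 t]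

/-- An arc that lies below all the rest of the curve can be moved, under all the rest, to run below
any other path in the plane with the same ends. -/
theorem exists_replace_under (hγ : IsClosedCurve n γ) {a a₀ a₁ b₂ b₁ b₀ b : ℝ}
    (h1 : a < a₀) (h2 : a₀ < a₁) (h3 : a₁ ≤ b₂) (h4 : b₂ < b₁) (h5 : b₁ < b₀) (h6 : b₀ < b)
    (h7 : b < a + n)
    (hunder : ∀ t ∈ Icc a b, ∀ s, (γ s).1 = (γ t).1 → (γ t).2 ≤ (γ s).2)
    (haff₀ : AffineOnSet (fun t => (γ t).2) (Icc a₀ a₁))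
    (haff₁ : AffineOnSet (fun t => (γ t).2) (Icc b₁ b₀))
    {p : ℝ → Plane} (hp : ContinuousOn p (Icc a₁ b₁)) (hpa : ∀ t ∈ Icc a₀ a₁, p t = (γ t).1)
    (hpb : ∀ t ∈ Icc b₂ b₀, p t = (γ t).1)
    (hpole : ∀ t ∈ Icc a₁ b₂, ∀ s ∈ Icc b₁ b₀, p t ≠ (γ s).1) :
    ∃ F, IsotopicToId F ∧ ∃ g : ℝ → ℝ,
      (∀ t ∈ Icc a₀ b₀, F (γ t) = (p t, g t)) ∧ (∀ t ∈ Icc b₀ (a₀ + n), F (γ t) = γ t) ∧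
      AffineOnSet g (Icc a₀ a₁) ∧ AffineOnSet g (Icc a₁ b₁) ∧ AffineOnSet g (Icc b₁ b₀) := by
  have hneg : ∀ {S : Set ℝ} {f : ℝ → ℝ}, AffineOnSet f S → AffineOnSet (fun t => -f t) S := by
    rintro S f ⟨q, v, hqv⟩
    refine ⟨-q, -v, fun t ht => ?_⟩
    simp only [hqv t ht, smul_eq_mul]
    ring
  have e : ∀ t, reflectZ (γ t) = ((γ t).1, -(γ t).2) := fun t => rfl
  obtain ⟨F, hF, g, k1, k2, k3, k4, k5, -, -, -⟩ := (hγ.comp reflectZ).exists_replace_over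
    h1 h2 h3 h4 h5 h6 h7
    (by
      intro t ht s hst
      simp only [e] at hst ⊢
      linarith [hunder t ht s hst])
    (hneg haff₀) (hneg haff₁) (p := p) hp hpa hpb hpole 0
  refine ⟨_, hF.conj reflectZ, fun t => -g t, ?_, ?_, hneg k3, hneg k4, hneg k5⟩
  · intro t ht
    simp only [Homeomorph.trans_apply, k1 t ht, reflectZ_symm_apply]
  · intro t ht
    simp only [Homeomorph.trans_apply, k2 t ht, Homeomorph.symm_apply_apply]

end IsClosedCurve

/-! ### Polygonal paths and piecewise affine closed curves -/

theorem polygonalPath_of_mem_Icc (v : ℤ → Space) (i : ℤ) {t : ℝ} (ht : t ∈ Icc (i : ℝ) (i + 1)) :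
    polygonalPath v t = v i + (t - i) • (v (i + 1) - v i) := by
  rcases ht.2.lt_or_eq with h | h
  · have hf : ⌊t⌋ = i := Int.floor_eq_iff.2 ⟨ht.1, h⟩
    have hfr : Int.fract t = t - i := by rw [Int.fract, hf]
    rw [polygonalPath, hf, hfr]
    module
  · have hf : ⌊t⌋ = i + 1 := by rw [h]; exact_mod_cast Int.floor_intCast (i + 1)
    have hfr : Int.fract t = 0 := by rw [Int.fract, hf, h]; push_cast; ring
    rw [polygonalPath, hf, hfr, h]
    module

theorem affineOnSet_polygonalPath (v : ℤ → Space) (i : ℤ) :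
    AffineOnSet (polygonalPath v) (Icc (i : ℝ) (i + 1)) :=
  ⟨v i - (i : ℝ) • (v (i + 1) - v i), v (i + 1) - v i, fun t ht => by
    rw [polygonalPath_of_mem_Icc v i ht]
    module⟩

theorem continuous_polygonalPath (v : ℤ → Space) : Continuous (polygonalPath v) := by
  have hlf : LocallyFinite fun i : ℤ => Icc (i : ℝ) (i + 1) := by
    intro t
    refine ⟨Ioo (t - 1) (t + 1), Ioo_mem_nhds (by linarith) (by linarith), ?_⟩
    refine (Set.finite_Icc (⌊t⌋ - 3) (⌊t⌋ + 3)).subset ?_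
    rintro i ⟨s, ⟨h1, h2⟩, h3, h4⟩
    have f1 := Int.floor_le t
    have f2 := Int.lt_floor_add_one t
    constructor
    · have : ((⌊t⌋ - 3 : ℤ) : ℝ) ≤ i := by push_cast; linarith
      exact_mod_cast this
    · have : (i : ℝ) ≤ ((⌊t⌋ + 3 : ℤ) : ℝ) := by push_cast; linarith
      exact_mod_cast this
  refine hlf.continuous ?_ (fun i => isClosed_Icc) fun i => ?_
  · refine eq_univ_of_forall fun t => mem_iUnion.2 ⟨⌊t⌋, Int.floor_le t, (Int.lt_floor_add_one t).le⟩
  · obtain ⟨p, w, h⟩ := affineOnSet_polygonalPath v i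
    exact ContinuousOn.congr (by fun_prop) h

namespace PolygonalKnot

theorem isClosedCurve_param (K : PolygonalKnot) : IsClosedCurve K.size K.param where
  pos := by exact_mod_cast K.size_pos
  continuous := continuous_polygonalPath _
  periodic t := by
    have h1 : ⌊t + (K.size : ℝ)⌋ = ⌊t⌋ + K.size := Int.floor_add_natCast t K.size
    have h2 : ⌊t⌋ + (K.size : ℤ) + 1 = (⌊t⌋ + 1) + K.size := by ring
    simp only [param, polygonalPath, Int.fract_add_natCast, h1, h2, K.closed]
  simple := K.simple

theorem affineOnSet_param (K : PolygonalKnot) {s t : ℝ} (h : ∀ i : ℤ, (i : ℝ) ∉ Ioo s t) :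
    AffineOnSet K.param (Icc s t) := by
  rcases le_or_gt t s with hts | hst
  · refine ⟨K.param s, 0, fun u hu => ?_⟩
    have : u = s := le_antisymm (hu.2.trans hts) hu.1
    simp [this]
  · refine (affineOnSet_polygonalPath K.vertex ⌊s⌋).mono fun u hu => ?_
    refine ⟨(Int.floor_le s).trans hu.1, hu.2.trans ?_⟩
    by_contra! hlt
    exact h (⌊s⌋ + 1) ⟨by push_cast; exact Int.lt_floor_add_one s, by push_cast; exact hlt⟩

end PolygonalKnot

/-! ### From closed curves back to polygonal knots and diagrams -/

/-- A closed curve that is affine between consecutive points of a finite set is, up to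
parametrization, a polygonal knot. -/
theorem IsClosedCurve.exists_polygonalKnot {n : ℝ} {γ : ℝ → Space} (hγ : IsClosedCurve n γ) {W : ℝ}
    (V : Finset ℝ) (hW : W ∈ V) (hV : ∀ t ∈ V, t ∈ Ico W (W + n))
    (haff : ∀ s t, W ≤ s → t ≤ W + n → (∀ u ∈ V, u ∉ Ioo s t) → AffineOnSet γ (Icc s t)) :
    ∃ (L : PolygonalKnot) (ψ : ℝ ≃o ℝ), (∀ u, L.param u = γ (ψ u)) ∧
      ∀ i, ∃ t ∈ V, L.vertex i = γ t := by
  set m : ℕ := V.card with hm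
  have hm0 : 0 < m := Finset.card_pos.2 ⟨W, hW⟩
  have hmz : (0 : ℤ) < m := by exact_mod_cast hm0
  set e : Fin m ↪o ℝ := V.orderEmbOfFin rfl with he
  have heV : ∀ j, e j ∈ V := fun j => V.orderEmbOfFin_mem rfl j
  have he_surj : ∀ t ∈ V, ∃ j, e j = t := by
    intro t ht
    have : t ∈ Set.range e := by rw [he, Finset.range_orderEmbOfFin]; exact ht
    exact this
  have he0 : e ⟨0, hm0⟩ = W := by
    obtain ⟨j, hj⟩ := he_surj W hW
    refine le_antisymm ?_ (hV _ (heV _)).1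
    rw [← hj]
    exact e.monotone (Fin.mk_le_of_le_val (Nat.zero_le _))
  have hmod : ∀ i : ℤ, (i % m).toNat < m := fun i => by
    have h1 := Int.emod_nonneg i hmz.ne'
    have h2 := Int.emod_lt_of_pos i hmz
    omega
  -- The breakpoints in increasing order, continued to all integers: `m` steps further on means one
  -- period `n` later.
  set τ : ℤ → ℝ := fun i => e ⟨(i % m).toNat, hmod i⟩ + (i / m : ℤ) * n with hτ
  have hτm : ∀ (q : ℤ) (j : ℕ) (hj : j < m), τ (q * m + j) = e ⟨j, hj⟩ + q * n := by
    intro q j hj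
    have h1 : (q * m + j) % m = (j : ℤ) := by
      rw [add_comm, Int.add_mul_emod_self_right, Int.emod_eq_of_lt (by omega) (by omega)]
    have h2 : (q * m + j) / m = q := by
      rw [add_comm, Int.add_mul_ediv_right _ _ hmz.ne', Int.ediv_eq_zero_of_lt (by omega) (by omega)]
      ring
    simp only [hτ, h1, h2, Int.toNat_natCast]
  have hrep : ∀ i : ℤ, ∃ (q : ℤ) (j : ℕ), j < m ∧ i = q * m + j := by
    intro i
    refine ⟨i / m, (i % m).toNat, hmod i, ?_⟩
    rw [Int.toNat_of_nonneg (Int.emod_nonneg i hmz.ne')]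
    exact (Int.ediv_mul_add_emod i m).symm
  have hτper : ∀ i k : ℤ, τ (i + k * m) = τ i + k * n := by
    intro i k
    obtain ⟨q, j, hj, rfl⟩ := hrep i
    rw [show q * m + j + k * m = (q + k) * m + (j : ℤ) by ring, hτm _ _ hj, hτm _ _ hj]
    push_cast
    ring
  have hstep : ∀ i : ℤ, τ i < τ (i + 1) ∧ AffineOnSet γ (Icc (τ i) (τ (i + 1))) := by
    intro i
    obtain ⟨q, j, hj, rfl⟩ := hrep i
    have hred : ∀ s t, W ≤ s → t ≤ W + n → s < t → (∀ u ∈ V, u ∉ Ioo s t) →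
        AffineOnSet γ (Icc (s + q * n) (t + q * n)) := by
      intro s t hs ht _ hst
      obtain ⟨p, v, hpv⟩ := haff s t hs ht hst
      refine ⟨p - (q * n) • v, v, fun u hu => ?_⟩
      have := hpv (u - q * n) ⟨by linarith [hu.1], by linarith [hu.2]⟩
      rw [← hγ.periodic_int (u - q * n) q, sub_add_cancel] at this
      rw [this]
      module
    have hgap : ∀ u ∈ V, e ⟨j, hj⟩ < u → ∃ h : j + 1 < m, e ⟨j + 1, h⟩ ≤ u := by
      intro u hu hju
      obtain ⟨k, rfl⟩ := he_surj u hu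
      have hjk : j < k := e.lt_iff_lt.1 hju
      have hk := k.2
      refine ⟨by omega, e.monotone ?_⟩
      exact hjk
    by_cases hj1 : j + 1 < m
    · have h1 : τ (q * m + j + 1) = e ⟨j + 1, hj1⟩ + q * n := by
        have := hτm q (j + 1) hj1
        push_cast at this
        rw [← this]
        ring_nf
      rw [h1, hτm q j hj]
      have hlt : e ⟨j, hj⟩ < e ⟨j + 1, hj1⟩ := e.strictMono (Fin.mk_lt_mk.2 (Nat.lt_succ_self j))
      refine ⟨by linarith, hred _ _ (hV _ (heV _)).1 (hV _ (heV _)).2.le hlt ?_⟩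
      rintro u hu ⟨h3, h4⟩
      obtain ⟨_, h5⟩ := hgap u hu h3
      exact absurd h5 (not_le.2 h4)
    · have hj2 : (j : ℤ) + 1 = m := by omega
      have h1 : τ (q * m + j + 1) = W + n + q * n := by
        have := hτm (q + 1) 0 hm0
        rw [show q * m + (j : ℤ) + 1 = (q + 1) * m + (0 : ℕ) by push_cast; linear_combination hj2,
          this, he0]
        push_cast
        ring
      rw [h1, hτm q j hj]
      have hlt := (hV _ (heV ⟨j, hj⟩)).2
      refine ⟨by linarith, hred _ _ (hV _ (heV _)).1 le_rfl hlt ?_⟩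
      rintro u hu ⟨h3, h4⟩
      obtain ⟨h5, _⟩ := hgap u hu h3
      exact hj1 h5
  have hτmono : StrictMono τ := strictMono_int_of_lt_succ fun i => (hstep i).1
  -- `ψ` maps `[i, i + 1]` affinely onto `[τ i, τ (i + 1)]`, so `γ ∘ ψ` is the standard polygonal
  -- path through the points `γ (τ i)`.
  set ψ : ℝ → ℝ := fun u => τ ⌊u⌋ + Int.fract u * (τ (⌊u⌋ + 1) - τ ⌊u⌋) with hψ
  have hψlt : ∀ u, ψ u < τ (⌊u⌋ + 1) := by
    intro u
    have h1 := (hstep ⌊u⌋).1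
    have h2 := Int.fract_lt_one u
    simp only [hψ]
    nlinarith
  have hψle : ∀ u, τ ⌊u⌋ ≤ ψ u := by
    intro u
    have h1 := (hstep ⌊u⌋).1
    have h2 := Int.fract_nonneg u
    simp only [hψ]
    nlinarith
  have hψmono : StrictMono ψ := by
    intro u v huv
    rcases (Int.floor_mono huv.le).lt_or_eq with h | h
    · calc ψ u < τ (⌊u⌋ + 1) := hψlt u
        _ ≤ τ ⌊v⌋ := hτmono.monotone h
        _ ≤ ψ v := hψle v
    · have h1 := (hstep ⌊u⌋).1
      have h2 : Int.fract u < Int.fract v := by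
        rw [Int.fract, Int.fract, ← h]
        linarith
      simp only [hψ]
      rw [← h]
      nlinarith
  have hψsurj : Function.Surjective ψ := by
    intro t
    obtain ⟨i, hi, hmax⟩ : ∃ i : ℤ, τ i ≤ t ∧ ∀ j, τ j ≤ t → j ≤ i := by
      have hq : ∀ q : ℤ, τ (q * m) = W + q * n := by
        intro q
        have := hτm q 0 hm0
        rw [he0] at this
        simpa using this
      refine Int.exists_greatest_of_bdd ⟨(⌊(t - W) / n⌋ + 1) * m, fun j hj => ?_⟩
        ⟨⌊(t - W) / n⌋ * m, ?_⟩
      · by_contra! h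
        have h1 := hτmono h
        rw [hq] at h1
        have h2 := Int.lt_floor_add_one ((t - W) / n)
        rw [div_lt_iff₀ hγ.pos] at h2
        push_cast at h1
        linarith
      · rw [hq]
        have h2 := Int.floor_le ((t - W) / n)
        rw [le_div_iff₀ hγ.pos] at h2
        linarith
    have hlt : t < τ (i + 1) := by
      by_contra! h
      have := hmax _ h
      omega
    have h1 := (hstep i).1
    have h2 : 0 < τ (i + 1) - τ i := by linarith
    have hfr : (t - τ i) / (τ (i + 1) - τ i) ∈ Ico (0 : ℝ) 1 :=
      ⟨div_nonneg (by linarith) h2.le, by rw [div_lt_one h2]; linarith⟩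
    refine ⟨i + (t - τ i) / (τ (i + 1) - τ i), ?_⟩
    have hfl : ⌊(i : ℝ) + (t - τ i) / (τ (i + 1) - τ i)⌋ = i := by
      rw [Int.floor_eq_iff]
      constructor <;> linarith [hfr.1, hfr.2]
    have hfr' : Int.fract ((i : ℝ) + (t - τ i) / (τ (i + 1) - τ i)) =
        (t - τ i) / (τ (i + 1) - τ i) := by
      rw [Int.fract, hfl]
      ring
    simp only [hψ, hfl, hfr']
    field_simp
    ring
  have hψper : ∀ (u : ℝ) (k : ℤ), ψ (u + (k * m : ℤ)) = ψ u + k * n := by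
    intro u k
    simp only [hψ, Int.floor_add_intCast, Int.fract_add_intCast]
    rw [show ⌊u⌋ + k * m + 1 = ⌊u⌋ + 1 + k * m by ring, hτper, hτper]
    ring
  have hpath : ∀ u, polygonalPath (fun i => γ (τ i)) u = γ (ψ u) := by
    intro u
    obtain ⟨p, v, hpv⟩ := (hstep ⌊u⌋).2
    have h1 := (hstep ⌊u⌋).1
    rw [polygonalPath, hpv _ ⟨le_rfl, h1.le⟩, hpv _ ⟨h1.le, le_rfl⟩, hpv _ ⟨hψle u, (hψlt u).le⟩]
    simp only [hψ]
    module
  refine ⟨⟨m, hm0, fun i => γ (τ i), ?_, ?_⟩, hψmono.orderIsoOfSurjective ψ hψsurj, hpath, ?_⟩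
  · intro i
    have h1 := hτper i 1
    simp only [one_mul, Int.cast_one] at h1
    rw [h1, hγ.periodic]
  · intro s t hst
    rw [hpath, hpath] at hst
    obtain ⟨k, hk⟩ := hγ.simple _ _ hst
    rw [← hψper] at hk
    refine ⟨k, ?_⟩
    rw [hψmono.injective hk]
    push_cast
    ring
  · intro i
    refine ⟨_, heV ⟨(i % m).toNat, hmod i⟩, ?_⟩
    simp only [hτ]
    rw [hγ.periodic_int]

/-- If a closed curve isotopic to a diagram `D` projects, outside a set `C` of parameters on which
its projection is injective, into the projection of `D` minus a crossing, then there is a diagram of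
the same knot with fewer crossings. -/
theorem KnotDiagram.exists_c_lt (D : KnotDiagram) {F : Space ≃ₜ Space} (hF : IsotopicToId F) {W : ℝ}
    (V : Finset ℝ) (hW : W ∈ V) (hV : ∀ t ∈ V, t ∈ Ico W (W + D.size))
    (haff : ∀ s t, W ≤ s → t ≤ W + D.size → (∀ u ∈ V, u ∉ Ioo s t) →
      AffineOnSet (fun t => F (D.param t)) (Icc s t))
    (C : Set ℝ) (σ : ℝ → ℝ)
    (hC : ∀ s ∈ Ico W (W + D.size), s ∈ C → ∀ t ∈ Ico W (W + D.size),
      (F (D.param s)).1 = (F (D.param t)).1 → s = t)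
    (hσ : ∀ t ∈ Ico W (W + D.size), t ∉ C → (F (D.param t)).1 = (D.param (σ t)).1)
    (hσm : ∀ t ∈ Ico W (W + D.size), t ∉ C → σ t ∈ Ico W (W + D.size))
    (hσi : ∀ s ∈ Ico W (W + D.size), s ∉ C → ∀ t ∈ Ico W (W + D.size), t ∉ C → σ s = σ t → s = t)
    {x : Plane} (hx : x ∈ D.multiplePoints)
    (hσx : ∀ t ∈ Ico W (W + D.size), t ∉ C → (D.param (σ t)).1 ≠ x)
    (hσV : ∀ t ∈ V, t ∉ C → (D.param (σ t)).1 ∉ D.multiplePoints) :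
    ∃ D' : KnotDiagram, D'.knot = D.knot ∧ D'.c < D.c := by
  have hD := D.isClosedCurve_param
  have hγ := hD.comp F
  obtain ⟨L, ψ, hL, hLv⟩ := hγ.exists_polygonalKnot V hW hV haff
  have hpts : ∀ P ∈ L.points, ∃ t ∈ Ico W (W + D.size), P = F (D.param t) := by
    rintro P ⟨u, rfl⟩
    obtain ⟨s, hs, m, hm⟩ := hγ.exists_mem_Ico W (ψ u)
    refine ⟨s, hs, ?_⟩
    rw [hL, hm]
    exact hγ.periodic_int s m
  have hσinj : ∀ s ∈ Ico W (W + D.size), s ∉ C → ∀ t ∈ Ico W (W + D.size), t ∉ C →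
      D.param (σ s) = D.param (σ t) → s = t := by
    intro s hs hsC t ht htC h
    have h1 := hσm s hs hsC
    have h2 := hσm t ht htC
    exact hσi s hs hsC t ht htC (hD.eq_of_abs_lt h (by linarith [h1.2, h2.1])
      (by linarith [h1.1, h2.2]))
  -- Parameters in `C` never produce a double point. Every new double point therefore comes from two
  -- parameters outside `C`, and `σ` shows it to be an old double point other than `x`.
  have hkey : ∀ s ∈ Ico W (W + D.size), ∀ t ∈ Ico W (W + D.size), s ≠ t →
      (F (D.param s)).1 = (F (D.param t)).1 → s ∉ C ∧ t ∉ C := fun s hs t ht hst h =>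
    ⟨fun hsC => hst (hC s hs hsC t ht h), fun htC => hst (hC t ht htC s hs h.symm).symm⟩
  have hmult : L.multiplePoints ⊆ D.multiplePoints \ {x} := by
    rintro y ⟨P, hP, Q, hQ, hPQ, rfl, hQP⟩
    obtain ⟨s, hs, rfl⟩ := hpts P hP
    obtain ⟨t, ht, rfl⟩ := hpts Q hQ
    obtain ⟨hsC, htC⟩ := hkey s hs t ht (fun h => hPQ (by rw [h])) hQP.symm
    rw [hσ t ht htC, hσ s hs hsC] at hQP
    refine ⟨⟨D.param (σ s), mem_range_self _, D.param (σ t), mem_range_self _, fun h => hPQ ?_,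
      (hσ s hs hsC).symm, ?_⟩, ?_⟩
    · rw [hσinj s hs hsC t ht htC h]
    · rw [hσ s hs hsC, hQP]
    · rw [hσ s hs hsC]
      exact hσx s hs hsC
  refine ⟨⟨L, D.finite_multiplePoints.subset (hmult.trans sdiff_subset), ?_, ?_⟩, ?_, ?_⟩
  · intro P hP Q hQ R hR hPQ hQR
    obtain ⟨s, hs, rfl⟩ := hpts P hP
    obtain ⟨t, ht, rfl⟩ := hpts Q hQ
    obtain ⟨u, hu, rfl⟩ := hpts R hR
    by_contra! hne
    obtain ⟨n1, n2, n3⟩ := hne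
    obtain ⟨hsC, htC⟩ := hkey s hs t ht (fun h => n1 (by rw [h])) hPQ
    obtain ⟨-, huC⟩ := hkey s hs u hu (fun h => n3 (by rw [h])) (hPQ.trans hQR)
    rw [hσ s hs hsC, hσ t ht htC] at hPQ
    rw [hσ t ht htC, hσ u hu huC] at hQR
    rcases D.double _ (mem_range_self (σ s)) _ (mem_range_self (σ t)) _ (mem_range_self (σ u))
      hPQ hQR with h | h | h
    · exact n1 (by rw [hσinj s hs hsC t ht htC h])
    · exact n2 (by rw [hσinj t ht htC u hu huC h])
    · exact n3 (by rw [hσinj s hs hsC u hu huC h])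
  · intro i hi
    obtain ⟨t, ht, hti⟩ := hLv i
    rw [hti] at hi
    obtain ⟨P, hP, Q, hQ, hPQ, h1, h2⟩ := hi
    obtain ⟨s, hs, rfl⟩ := hpts P hP
    obtain ⟨u, hu, rfl⟩ := hpts Q hQ
    have htC : t ∉ C := by
      intro htC
      have e1 := hC t (hV t ht) htC s hs h1.symm
      have e2 := hC t (hV t ht) htC u hu h2.symm
      exact hPQ (by rw [← e1, ← e2])
    have hm : (F (D.param t)).1 ∈ D.multiplePoints :=
      (hmult ⟨_, hP, _, hQ, hPQ, h1, h2⟩).1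
    rw [hσ t (hV t ht) htC] at hm
    exact hσV t ht htC hm
  · refine Quotient.sound (PolygonalKnot.Isotopic.symm ?_)
    obtain ⟨H, hc, h0, rfl⟩ := hF
    refine ⟨H, hc, h0, ψ.symm, fun t => ?_⟩
    rw [hL, OrderIso.apply_symm_apply]
  · refine Set.ncard_lt_ncard ?_ D.finite_multiplePoints
    exact ⟨hmult.trans sdiff_subset, fun h => (hmult (h hx)).2 rfl⟩

/-! ### The local structure of a diagram -/

namespace KnotDiagram

variable (D : KnotDiagram)

theorem param_intCast (i : ℤ) : D.param i = D.vertex i := by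
  simp [PolygonalKnot.param, polygonalPath]

theorem proj_int_notMem (i : ℤ) : (D.param i).1 ∉ D.multiplePoints := by
  rw [param_intCast]
  exact D.vertex_notMem i

theorem continuous_proj : Continuous fun t => (D.param t).1 :=
  continuous_fst.comp D.isClosedCurve_param.continuous

theorem size_pos_real : (0 : ℝ) < D.size := D.isClosedCurve_param.pos

theorem mem_multiplePoints_of_proj_eq {s t : ℝ} (hne : s ≠ t) (h1 : s < t + D.size)
    (h2 : t < s + D.size) (h : (D.param s).1 = (D.param t).1) :
    (D.param s).1 ∈ D.multiplePoints :=
  ⟨D.param s, mem_range_self s, D.param t, mem_range_self t,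
    fun h' => hne (D.isClosedCurve_param.eq_of_abs_lt h' h1 h2), rfl, h.symm⟩

/-- The field `double` speaks of points in space; injectivity on one period turns it into a
statement about parameters. -/
theorem eq_or_eq_of_proj_eq {s t u : ℝ} {W : ℝ} (hs : s ∈ Ico W (W + D.size))
    (ht : t ∈ Ico W (W + D.size)) (hu : u ∈ Ico W (W + D.size)) (hst : s ≠ t)
    (h1 : (D.param s).1 = (D.param t).1) (h2 : (D.param u).1 = (D.param t).1) : u = s ∨ u = t := by
  have key : ∀ {x y : ℝ}, x ∈ Ico W (W + D.size) → y ∈ Ico W (W + D.size) →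
      D.param x = D.param y → x = y := fun hx hy h =>
    D.isClosedCurve_param.eq_of_abs_lt h (by linarith [hx.2, hy.1]) (by linarith [hx.1, hy.2])
  rcases D.double _ (mem_range_self s) _ (mem_range_self t) _ (mem_range_self u) h1 h2.symm
    with h | h | h
  · exact absurd (key hs ht h) hst
  · exact Or.inr (key ht hu h).symm
  · exact Or.inl (key hs hu h).symm

/-- There are finitely many double points, each has at most two parameters in one period, and
finitely many periods cover `[a, b]`. -/
theorem finite_crossing_params (a b : ℝ) :
    {t ∈ Icc a b | (D.param t).1 ∈ D.multiplePoints}.Finite := by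
  have hn := D.size_pos_real
  have hfib : ∀ (W : ℝ) (x : Plane), {t ∈ Ico W (W + D.size) | (D.param t).1 = x}.Finite := by
    intro W x
    by_contra hinf
    have hinf : {t ∈ Ico W (W + D.size) | (D.param t).1 = x}.Infinite := hinf
    obtain ⟨s, hs⟩ := hinf.nonempty
    obtain ⟨t, ht, hts⟩ := (hinf.sdiff (finite_singleton s)).nonempty
    obtain ⟨u, hu, hus⟩ := (hinf.sdiff (Set.toFinite {s, t})).nonempty
    rcases D.eq_or_eq_of_proj_eq hs.1 ht.1 hu.1 (fun h => hts (mem_singleton_iff.2 h.symm)) (hs.2.trans ht.2.symm)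
      (hu.2.trans ht.2.symm) with h | h
    · exact hus (Or.inl h)
    · exact hus (Or.inr h)
  have hper : ∀ k : ℕ, {t ∈ Ico a (a + k * D.size) | (D.param t).1 ∈ D.multiplePoints}.Finite := by
    intro k
    induction k with
    | zero => simp
    | succ k ih =>
      refine (ih.union (D.finite_multiplePoints.biUnion
        fun x _ => hfib (a + k * D.size) x)).subset ?_
      rintro t ⟨⟨h1, h2⟩, h3⟩
      rcases lt_or_ge t (a + k * D.size) with h | h
      · exact Or.inl ⟨⟨h1, h⟩, h3⟩
      · refine Or.inr (mem_biUnion h3 ⟨⟨h, ?_⟩, rfl⟩)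
        push_cast at h2
        linarith
  obtain ⟨k, hk⟩ := exists_nat_gt ((b - a) / D.size)
  rw [div_lt_iff₀ hn] at hk
  refine (hper k).subset ?_
  rintro t ⟨⟨h1, h2⟩, h3⟩
  exact ⟨⟨h1, by linarith⟩, h3⟩

/-- Near any parameter there are no other crossing parameters and no other vertices. -/
theorem exists_isolated (t : ℝ) : ∃ ε > 0, ∀ s, s ≠ t → |s - t| < ε →
    (D.param s).1 ∉ D.multiplePoints ∧ ∀ i : ℤ, s ≠ i := by
  have hfin : ({s ∈ Icc (t - 1) (t + 1) | (D.param s).1 ∈ D.multiplePoints} ∪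
      (fun i : ℤ => (i : ℝ)) '' (Icc ⌊t - 1⌋ ⌈t + 1⌉)).Finite :=
    (D.finite_crossing_params _ _).union ((Set.finite_Icc _ _).image _)
  have hopen := (hfin.sdiff (t := {t})).isClosed.isOpen_compl
  obtain ⟨ε, hε, hball⟩ := Metric.isOpen_iff.1 hopen t (fun h => h.2 rfl)
  refine ⟨min ε 1, by positivity, fun s hst hs => ?_⟩
  have h1 := hball (a := s) (by
    rw [Metric.mem_ball, Real.dist_eq]
    exact hs.trans_le (min_le_left _ _))
  have h2 := abs_lt.1 (hs.trans_le (min_le_right _ _))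
  refine ⟨fun h => h1 ⟨Or.inl ⟨⟨by linarith, by linarith⟩, h⟩, hst⟩, fun i hi => ?_⟩
  refine h1 ⟨Or.inr ⟨i, ⟨?_, ?_⟩, hi.symm⟩, hst⟩
  · have : (⌊t - 1⌋ : ℝ) ≤ i := (Int.floor_le _).trans (by linarith)
    exact_mod_cast this
  · have : (i : ℝ) ≤ ⌈t + 1⌉ := le_trans (by linarith) (Int.le_ceil _)
    exact_mod_cast this

/-- Near a parameter that is not a vertex the projection runs along a straight line. -/
theorem exists_direction {t : ℝ} (ht : ∀ i : ℤ, t ≠ i) : ∃ ε > 0, ∃ v : Plane, v ≠ 0 ∧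
    ∀ s, |s| < ε → (D.param (t + s)).1 = (D.param t).1 + s • v := by
  obtain ⟨ε, hε, h⟩ := D.exists_isolated t
  have hn := D.size_pos_real
  have haff : AffineOnSet D.param (Icc (t - ε / 2) (t + ε / 2)) := by
    refine D.affineOnSet_param fun i hi => ?_
    by_cases hit : (i : ℝ) = t
    · exact ht i hit.symm
    · exact (h i hit (abs_lt.2 ⟨by linarith [hi.1], by linarith [hi.2]⟩)).2 i rfl
  obtain ⟨q, v, hqv⟩ := haff
  have hloc : ∀ s, |s| < ε / 2 → (D.param (t + s)).1 = (D.param t).1 + s • v.1 := by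
    intro s hs
    have := abs_lt.1 hs
    rw [hqv (t + s) ⟨by linarith, by linarith⟩, hqv t ⟨by linarith, by linarith⟩]
    simp only [Prod.fst_add, Prod.smul_fst]
    module
  refine ⟨ε / 2, by linarith, v.1, fun hv => ?_, hloc⟩
  -- With vanishing planar velocity the three parameters `t`, `t + η / 2`, `t + η` of one period
  -- would lie over the same point, contrary to regularity.
  set η := min (ε / 4) (D.size / 4 : ℝ) with hη
  have hη0 : 0 < η := by positivity
  have hη1 : η ≤ ε / 4 := min_le_left _ _
  have hη2 : η ≤ D.size / 4 := min_le_right _ _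
  have e1 := hloc η (by rw [abs_of_pos hη0]; linarith)
  have e2 := hloc (η / 2) (by rw [abs_of_pos (by linarith)]; linarith)
  rw [hv, smul_zero, add_zero] at e1 e2
  rcases D.eq_or_eq_of_proj_eq (W := t) (s := t + η) (t := t) (u := t + η / 2)
    ⟨by linarith, by linarith⟩ ⟨le_rfl, by linarith⟩ ⟨by linarith, by linarith⟩
    (by linarith) e1 e2 with h | h <;> linarith

theorem exists_le_dist {S : Set ℝ} (hS : IsCompact S) {x : Plane} (hx : ∀ s ∈ S, (D.param s).1 ≠ x) :
    ∃ r > 0, ∀ s ∈ S, r ≤ dist (D.param s).1 x := by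
  have hc : IsClosed ((fun t => (D.param t).1) '' S) := (hS.image D.continuous_proj).isClosed
  obtain ⟨r, hr, hball⟩ := Metric.isOpen_iff.1 hc.isOpen_compl x
    (by rintro ⟨s, hs, h⟩; exact hx s hs h)
  refine ⟨r, hr, fun s hs => ?_⟩
  by_contra! h
  exact hball (Metric.mem_ball.2 h) ⟨s, hs, rfl⟩

theorem exists_norm_lt (v w : Plane) {r : ℝ} (hr : 0 < r) :
    ∃ ε > 0, ∀ x y : ℝ, |x| < ε → |y| < ε → ‖x • v + y • w‖ < r := by
  refine ⟨r / (‖v‖ + ‖w‖ + 1), by positivity, fun x y hx hy => ?_⟩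
  set ε := r / (‖v‖ + ‖w‖ + 1) with hε
  have h0 : 0 < ε := by positivity
  have h1 : ε * (‖v‖ + ‖w‖ + 1) = r := div_mul_cancel₀ _ (by positivity)
  calc ‖x • v + y • w‖ ≤ ‖x • v‖ + ‖y • w‖ := norm_add_le _ _
    _ = |x| * ‖v‖ + |y| * ‖w‖ := by rw [norm_smul, norm_smul, Real.norm_eq_abs, Real.norm_eq_abs]
    _ ≤ ε * ‖v‖ + ε * ‖w‖ := by gcongr
    _ < r := by nlinarith

/-- The position of the projection near a double point: two straight strands cross there
transversely, and nothing else comes near. -/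
theorem exists_crossing_chart {t u : ℝ} (htu : t < u) (hut : u < t + D.size)
    (h : (D.param t).1 = (D.param u).1) {ρ : ℝ} (hρ : 0 < ρ) :
    ∃ ε > 0, ∃ v w : Plane, (∀ x y : ℝ, x • v + y • w = 0 → x = 0 ∧ y = 0) ∧
      (∀ s, |s| < ε → (D.param (t + s)).1 = (D.param t).1 + s • v) ∧
      (∀ s, |s| < ε → (D.param (u + s)).1 = (D.param t).1 + s • w) ∧
      (∀ x y : ℝ, |x| < ε → |y| < ε → ‖x • v + y • w‖ < ρ) ∧
      (∀ x y : ℝ, |x| < ε → |y| < ε → x ≠ 0 → y ≠ 0 →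
        ∀ s, (D.param t).1 + x • v + y • w ≠ (D.param s).1) := by
  have hn := D.size_pos_real
  have hm := D.mem_multiplePoints_of_proj_eq htu.ne (by linarith) hut h
  have ht : ∀ i : ℤ, t ≠ i := by
    rintro i rfl
    exact D.proj_int_notMem i hm
  have hu : ∀ i : ℤ, u ≠ i := by
    rintro i rfl
    rw [h] at hm
    exact D.proj_int_notMem i hm
  obtain ⟨ε₁, hε₁, v, hv, hloc₁⟩ := D.exists_direction ht
  obtain ⟨ε₂, hε₂, w, hw, hloc₂⟩ := D.exists_direction hu
  rw [← h] at hloc₂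
  obtain ⟨ε₃, hε₃, hiso⟩ := D.exists_isolated u
  -- If the strands were parallel, with `w = c • v`, they would overlap: `u + s` and `t + c * s`
  -- project to the same point for small `s > 0`, so `u` would not be isolated among the crossing
  -- parameters.
  have hind : ∀ x y : ℝ, x • v + y • w = 0 → x = 0 ∧ y = 0 := by
    intro x y hxy
    by_cases hy : y = 0
    · subst hy
      rw [zero_smul, add_zero, smul_eq_zero] at hxy
      exact ⟨hxy.resolve_right hv, rfl⟩
    · exfalso
      have hwv : w = (-(x / y)) • v := by
        have : y • w = -(x • v) := by rw [eq_neg_iff_add_eq_zero, add_comm, hxy]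
        rw [← inv_smul_smul₀ hy w, this, smul_neg, smul_smul, neg_smul]
        congr 2
        field_simp
      set c := -(x / y) with hc
      -- The five bounds keep both parameters in the straight pieces, `u + s` in the isolating
      -- interval, and `u + s` and `t + c * s` distinct and less than one period apart.
      obtain ⟨s, hs0, hs⟩ : ∃ s > 0, ∀ B ∈ ({ε₁ / (|c| + 1), ε₂, ε₃, (u - t) / (|c| + 1),
          (t + D.size - u) / (|c| + 1)} : Set ℝ), s < B := by
        have hf : Set.Finite ({ε₁ / (|c| + 1), ε₂, ε₃, (u - t) / (|c| + 1),
          (t + D.size - u) / (|c| + 1)} : Set ℝ) := Set.toFinite _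
        have : ∀ᶠ s in 𝓝[>] (0 : ℝ), ∀ B ∈ ({ε₁ / (|c| + 1), ε₂, ε₃, (u - t) / (|c| + 1),
          (t + D.size - u) / (|c| + 1)} : Set ℝ), s < B := by
          refine (Filter.eventually_all_finite hf).2 fun B hB => ?_
          have hB0 : 0 < B := by
            have := abs_nonneg c
            rcases hB with rfl | rfl | rfl | rfl | rfl
            · positivity
            · exact hε₂
            · exact hε₃
            · exact div_pos (by linarith) (by linarith)
            · exact div_pos (by linarith) (by linarith)
          exact nhdsWithin_le_nhds (Iio_mem_nhds hB0)
        obtain ⟨s, h1, h2⟩ := (this.and self_mem_nhdsWithin).exists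
        exact ⟨s, h2, h1⟩
      have hc1 : 0 < |c| + 1 := by positivity
      have b1 := hs _ (Or.inl rfl)
      have b2 := hs _ (Or.inr (Or.inl rfl))
      have b3 := hs _ (Or.inr (Or.inr (Or.inl rfl)))
      have b4 := hs _ (Or.inr (Or.inr (Or.inr (Or.inl rfl))))
      have b5 := hs _ (Or.inr (Or.inr (Or.inr (Or.inr rfl))))
      rw [lt_div_iff₀ hc1] at b1 b4 b5
      have a1 : |c * s| < ε₁ := by rw [abs_mul, abs_of_pos hs0]; nlinarith
      have a2 : |s| < ε₂ := by rwa [abs_of_pos hs0]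
      have a3 := hloc₁ _ a1
      have a4 := hloc₂ _ a2
      have a5 : c * s ≤ |c| * s := mul_le_mul_of_nonneg_right (le_abs_self c) hs0.le
      have a6 : -(|c| * s) ≤ c * s := by
        rw [← neg_mul]
        exact mul_le_mul_of_nonneg_right (neg_abs_le c) hs0.le
      refine (hiso (u + s) (by linarith) (by rw [add_sub_cancel_left, abs_of_pos hs0]; exact b3)).1
        (D.mem_multiplePoints_of_proj_eq (t := t + c * s) ?_ ?_ ?_ ?_)
      · intro h'
        nlinarith
      · nlinarith
      · nlinarith
      · rw [a3, a4, hwv]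
        module
  set η := min (min ε₁ ε₂) (min (u - t) (t + D.size - u)) / 2 with hη
  have hη0 : 0 < η := by
    have : 0 < min (min ε₁ ε₂) (min (u - t) (t + D.size - u)) :=
      lt_min (lt_min hε₁ hε₂) (lt_min (by linarith) (by linarith))
    linarith
  have q1 : 2 * η ≤ ε₁ := by
    have : min (min ε₁ ε₂) (min (u - t) (t + D.size - u)) ≤ ε₁ := (min_le_left _ _).trans (min_le_left _ _)
    linarith
  have q2 : 2 * η ≤ ε₂ := by
    have : min (min ε₁ ε₂) (min (u - t) (t + D.size - u)) ≤ ε₂ := (min_le_left _ _).trans (min_le_right _ _)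
    linarith
  have q3 : 2 * η ≤ u - t := by
    have : min (min ε₁ ε₂) (min (u - t) (t + D.size - u)) ≤ u - t := (min_le_right _ _).trans (min_le_left _ _)
    linarith
  have q4 : 2 * η ≤ t + D.size - u := by
    have : min (min ε₁ ε₂) (min (u - t) (t + D.size - u)) ≤ t + D.size - u := (min_le_right _ _).trans (min_le_right _ _)
    linarith
  -- Away from the two strands the projection over one period is compact and misses the crossing,
  -- hence keeps a distance `r` from it.
  obtain ⟨r, hr, hfar⟩ := D.exists_le_dist (x := (D.param t).1)
    (S := Icc (t - η) (t - η + D.size) \ (Ioo (t - η) (t + η) ∪ Ioo (u - η) (u + η) ∪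
      Ioo (t + D.size - η) (t + D.size + η)))
    (isCompact_Icc.diff ((isOpen_Ioo.union isOpen_Ioo).union isOpen_Ioo)) (by
      rintro s ⟨hs, hs'⟩ hst
      simp only [mem_union, not_or, mem_Ioo, not_and, not_lt] at hs'
      have hs2 : s < t - η + D.size := by
        by_contra! hle
        have e : s = t - η + D.size := le_antisymm hs.2 hle
        have e1 := hloc₁ (-η) (by rw [abs_neg, abs_of_pos hη0]; linarith)
        rw [e, D.isClosedCurve_param.periodic, sub_eq_add_neg, e1] at hst
        have : (-η) • v = 0 := by simpa using hst
        rw [smul_eq_zero] at this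
        rcases this with h | h
        · linarith
        · exact hv h
      rcases D.eq_or_eq_of_proj_eq (W := t - η) (s := t) (t := u) (u := s) ⟨by linarith, by linarith⟩
        ⟨by linarith, by linarith⟩ ⟨hs.1, hs2⟩ htu.ne h (hst.trans h) with h' | h'
      · have := hs'.1.1 (by linarith)
        linarith
      · have := hs'.1.2 (by linarith)
        linarith)
  obtain ⟨ε₄, hε₄, hnorm⟩ := exists_norm_lt v w (lt_min hr hρ)
  refine ⟨min ε₄ η, lt_min hε₄ hη0, v, w, hind, fun s hs => hloc₁ s ?_, fun s hs => hloc₂ s ?_,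
    fun x y hx hy => ?_, fun x y hx hy hx0 hy0 s hs => ?_⟩
  · exact hs.trans_le ((min_le_right _ _).trans (by linarith))
  · exact hs.trans_le ((min_le_right _ _).trans (by linarith))
  · exact (hnorm x y (hx.trans_le (min_le_left _ _)) (hy.trans_le (min_le_left _ _))).trans_le
      (min_le_right _ _)
  · have hlt := (hnorm x y (hx.trans_le (min_le_left _ _))
      (hy.trans_le (min_le_left _ _))).trans_le (min_le_left _ _)
    obtain ⟨s', hs', m, rfl⟩ := D.isClosedCurve_param.exists_mem_Ico (t - η) s
    rw [D.isClosedCurve_param.periodic_int] at hs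
    by_cases hmem : s' ∈ Ioo (t - η) (t + η) ∪ Ioo (u - η) (u + η) ∪
      Ioo (t + D.size - η) (t + D.size + η)
    · rcases hmem with (h' | h') | h'
      · have e1 := hloc₁ (s' - t) (abs_lt.2 ⟨by linarith [h'.1], by linarith [h'.2]⟩)
        rw [add_sub_cancel, ← hs] at e1
        have e2 : (x - (s' - t)) • v + y • w = 0 := by
          rw [add_assoc] at e1
          have := add_left_cancel e1
          rw [sub_smul, ← this]
          abel
        exact hy0 (hind _ _ e2).2
      · have e1 := hloc₂ (s' - u) (abs_lt.2 ⟨by linarith [h'.1], by linarith [h'.2]⟩)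
        rw [add_sub_cancel, ← hs] at e1
        have e2 : x • v + (y - (s' - u)) • w = 0 := by
          rw [add_assoc] at e1
          have := add_left_cancel e1
          rw [sub_smul, ← this]
          abel
        exact hx0 (hind _ _ e2).1
      · linarith [h'.1, hs'.2]
    · have := hfar s' ⟨Ico_subset_Icc_self hs', hmem⟩
      rw [← hs, dist_eq_norm, add_assoc, add_sub_cancel_left] at this
      linarith

/-- The position of the projection near a point that is neither a double point nor a vertex. -/
theorem exists_regular_chart {f : ℝ} (hf : (D.param f).1 ∉ D.multiplePoints)
    (hf' : ∀ i : ℤ, f ≠ i) {ρ : ℝ} (hρ : 0 < ρ) :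
    ∃ ε > 0, ∃ v w : Plane, (∀ x y : ℝ, x • v + y • w = 0 → x = 0 ∧ y = 0) ∧
      (∀ s, |s| < ε → (D.param (f + s)).1 = (D.param f).1 + s • v) ∧
      (∀ x y : ℝ, |x| < ε → |y| < ε → ‖x • v + y • w‖ < ρ) ∧
      (∀ x y : ℝ, |x| < ε → |y| < ε → y ≠ 0 →
        ∀ s, (D.param f).1 + x • v + y • w ≠ (D.param s).1) := by
  have hn := D.size_pos_real
  obtain ⟨ε₁, hε₁, v, hv, hloc₁⟩ := D.exists_direction hf'
  set w : Plane := (-v.2, v.1) with hw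
  have hind : ∀ x y : ℝ, x • v + y • w = 0 → x = 0 ∧ y = 0 := by
    intro x y hxy
    have h1 : x * v.1 + y * (-v.2) = 0 := congrArg Prod.fst hxy
    have h2 : x * v.2 + y * v.1 = 0 := congrArg Prod.snd hxy
    have hpos : 0 < v.1 ^ 2 + v.2 ^ 2 := by
      by_contra! hle
      have a1 : v.1 = 0 := by nlinarith [sq_nonneg v.1, sq_nonneg v.2]
      have a2 : v.2 = 0 := by nlinarith [sq_nonneg v.1, sq_nonneg v.2]
      exact hv (Prod.ext a1 a2)
    have h3 : x * (v.1 ^ 2 + v.2 ^ 2) = 0 := by linear_combination v.1 * h1 + v.2 * h2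
    have h4 : y * (v.1 ^ 2 + v.2 ^ 2) = 0 := by linear_combination -v.2 * h1 + v.1 * h2
    exact ⟨(mul_eq_zero.1 h3).resolve_right hpos.ne', (mul_eq_zero.1 h4).resolve_right hpos.ne'⟩
  set η := min ε₁ D.size / 2 with hη
  have hη0 : 0 < η := half_pos (lt_min hε₁ hn)
  have q1 : 2 * η ≤ ε₁ := by
    have : min ε₁ (D.size : ℝ) ≤ ε₁ := min_le_left _ _
    linarith
  have q2 : 2 * η ≤ D.size := by
    have : min ε₁ (D.size : ℝ) ≤ D.size := min_le_right _ _
    linarith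
  obtain ⟨r, hr, hfar⟩ := D.exists_le_dist (x := (D.param f).1)
    (S := Icc (f + η) (f - η + D.size)) isCompact_Icc (by
      intro s hs hsf
      have := D.mem_multiplePoints_of_proj_eq (s := f) (t := s) (by linarith [hs.1])
        (by linarith [hs.1]) (by linarith [hs.2]) hsf.symm
      exact hf this)
  obtain ⟨ε₄, hε₄, hnorm⟩ := exists_norm_lt v w (lt_min hr hρ)
  refine ⟨min ε₄ η, lt_min hε₄ hη0, v, w, hind, fun s hs => hloc₁ s ?_,
    fun x y hx hy => ?_, fun x y hx hy hy0 s hs => ?_⟩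
  · exact hs.trans_le ((min_le_right _ _).trans (by linarith))
  · exact (hnorm x y (hx.trans_le (min_le_left _ _)) (hy.trans_le (min_le_left _ _))).trans_le
      (min_le_right _ _)
  · have hlt := (hnorm x y (hx.trans_le (min_le_left _ _))
      (hy.trans_le (min_le_left _ _))).trans_le (min_le_left _ _)
    obtain ⟨s', hs', m, rfl⟩ := D.isClosedCurve_param.exists_mem_Ico (f - η) s
    rw [D.isClosedCurve_param.periodic_int] at hs
    rcases lt_or_ge s' (f + η) with h' | h'
    · have e1 := hloc₁ (s' - f) (abs_lt.2 ⟨by linarith [hs'.1], by linarith⟩)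
      rw [add_sub_cancel, ← hs] at e1
      have e2 : (x - (s' - f)) • v + y • w = 0 := by
        rw [add_assoc] at e1
        have := add_left_cancel e1
        rw [sub_smul, ← this]
        abel
      exact hy0 (hind _ _ e2).2
    · have := hfar s' ⟨h', hs'.2.le⟩
      rw [← hs, dist_eq_norm, add_assoc, add_sub_cancel_left] at this
      linarith

end KnotDiagram

/-! ### Swapping an overpass and an underpass -/

/-- `f` is affine on every subinterval of `[u, v]` that has no point of `V` in its interior. -/
def PiecewiseAffine {X : Type*} [AddCommGroup X] [Module ℝ X] (V : Set ℝ) (f : ℝ → X) (u v : ℝ) :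
    Prop :=
  ∀ s t, u ≤ s → t ≤ v → (∀ w ∈ V, w ∉ Ioo s t) → AffineOnSet f (Icc s t)

namespace PiecewiseAffine

variable {X Y : Type*} [AddCommGroup X] [Module ℝ X] [AddCommGroup Y] [Module ℝ Y] {V : Set ℝ}
  {f : ℝ → X} {g : ℝ → Y} {u v w : ℝ}

theorem trans (h : PiecewiseAffine V f u v) (h' : PiecewiseAffine V f v w) (hv : v ∈ V) :
    PiecewiseAffine V f u w := by
  intro s t hs ht hst
  rcases le_or_gt t v with htv | htv
  · exact h s t hs htv hst
  · rcases le_or_gt v s with hvs | hvs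
    · exact h' s t hvs ht hst
    · exact absurd ⟨hvs, htv⟩ (hst v hv)

theorem of_affineOnSet (h : AffineOnSet f (Icc u v)) : PiecewiseAffine V f u v :=
  fun _ _ hs ht _ => h.mono (Icc_subset_Icc hs ht)

theorem congr (h : PiecewiseAffine V f u v) {f' : ℝ → X} (hf : ∀ t ∈ Icc u v, f' t = f t) :
    PiecewiseAffine V f' u v :=
  fun s t hs ht hst => (h s t hs ht hst).congr fun x hx => hf x ⟨hs.trans hx.1, hx.2.trans ht⟩

theorem prodMk (hf : PiecewiseAffine V f u v) (hg : PiecewiseAffine V g u v) :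
    PiecewiseAffine V (fun t => (f t, g t)) u v :=
  fun s t hs ht hst => (hf s t hs ht hst).prodMk (hg s t hs ht hst)

end PiecewiseAffine

/-- The breaks of the reparametrized path are the preimages of the vertices. Negative `k` has to be
allowed since an exchanged arc may be traversed backwards. -/
theorem PolygonalKnot.piecewiseAffine_param_comp (K : PolygonalKnot) {V : Set ℝ} {q k u v : ℝ}
    (hk : k ≠ 0) (hV : ∀ w ∈ Ioo u v, ∀ i : ℤ, q + k * w = i → w ∈ V) :
    PiecewiseAffine V (fun t => K.param (q + k * t)) u v := by
  intro s t hs ht hst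
  rcases le_or_gt t s with hts | hts
  · refine ⟨K.param (q + k * s), 0, fun u hu => ?_⟩
    have : u = s := le_antisymm (hu.2.trans hts) hu.1
    simp [this]
  obtain ⟨p, x, h⟩ := K.affineOnSet_param (s := min (q + k * s) (q + k * t))
    (t := max (q + k * s) (q + k * t)) (by
      intro i hi
      have hw : q + k * ((i - q) / k) = i := by
        field_simp
        ring
      refine hst ((i - q) / k) (hV _ ?_ i hw) ?_ <;> rw [← hw] at hi <;>
        rcases hk.lt_or_gt with hk | hk
      all_goals
        rcases min_lt_iff.1 hi.1 with h1 | h1 <;> rcases lt_max_iff.1 hi.2 with h2 | h2 <;>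
        constructor <;> nlinarith)
  refine ⟨p + q • x, k • x, fun w hw => ?_⟩
  simp only
  rw [h (q + k * w)]
  · module
  · rcases hk.lt_or_gt with hk | hk
    · exact ⟨min_le_iff.2 (Or.inr (by nlinarith [hw.2])), le_max_iff.2 (Or.inl (by nlinarith [hw.1]))⟩
    · exact ⟨min_le_iff.2 (Or.inl (by nlinarith [hw.1])), le_max_iff.2 (Or.inr (by nlinarith [hw.2]))⟩

namespace KnotDiagram

/-- `e` is a path in the plane, made of two segments, from `P` to `Q`, which otherwise runs in `S`
and off the projection of `D`. -/
structure IsGate (D : KnotDiagram) (l r : ℝ) (P Q : Plane) (S : Set Plane) (e : ℝ → Plane) :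
    Prop where
  lt : l < r
  left : e l = P
  right : e r = Q
  affine : ∃ m ∈ Ioo l r, AffineOnSet e (Icc l m) ∧ AffineOnSet e (Icc m r)
  injOn : InjOn e (Ioo l r)
  mapsTo : MapsTo e (Ioo l r) S
  avoid : ∀ t ∈ Ioo l r, ∀ s, e t ≠ (D.param s).1

theorem IsGate.continuousOn {D : KnotDiagram} {l r : ℝ} {P Q : Plane} {S : Set Plane}
    {e : ℝ → Plane} (h : D.IsGate l r P Q S e) : ContinuousOn e (Icc l r) := by
  obtain ⟨m, hm, ⟨p, v, hp⟩, q, w, hq⟩ := h.affine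
  rw [← Icc_union_Icc_eq_Icc hm.1.le hm.2.le]
  refine ContinuousOn.union_of_isClosed ?_ ?_ isClosed_Icc isClosed_Icc
  · exact ContinuousOn.congr (by fun_prop) hp
  · exact ContinuousOn.congr (by fun_prop) hq

theorem le_of_not_isUnder {D : KnotDiagram} {t : ℝ} (h : ¬ D.IsUnder t) (s : ℝ)
    (hs : (D.param s).1 = (D.param t).1) : (D.param s).2 ≤ (D.param t).2 := by
  by_contra! hlt
  exact h ⟨_, mem_range_self s, hs, hlt⟩

theorem le_of_not_isOver {D : KnotDiagram} {t : ℝ} (h : ¬ D.IsOver t) (s : ℝ)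
    (hs : (D.param s).1 = (D.param t).1) : (D.param t).2 ≤ (D.param s).2 := by
  by_contra! hlt
  exact h ⟨_, mem_range_self s, hs, hlt⟩

set_option maxHeartbeats 1000000 in
open Classical in
/-- An overpass and an underpass can exchange their positions in the plane, if four gates connect
their ends; if this frees a crossing, there is a diagram of the same knot with fewer crossings. -/
theorem exists_c_lt_of_gates (D : KnotDiagram) {l₁ r₁ l₂ r₂ l₃ r₃ l₄ r₄ ζ q k : ℝ} (hζ : 0 < ζ)
    (h12 : r₁ ≤ l₂) (h23 : r₂ + 3 * ζ ≤ l₃ - 3 * ζ) (h34 : r₃ ≤ l₄)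
    (h41 : r₄ + 3 * ζ ≤ l₁ - 3 * ζ + D.size)
    (hover : ∀ t ∈ Icc (l₁ - 3 * ζ) (r₂ + 3 * ζ), ¬ D.IsUnder t)
    (hunder : ∀ t ∈ Icc (l₃ - 3 * ζ) (r₄ + 3 * ζ), ¬ D.IsOver t)
    (hcol : ∀ t, t ∈ Icc (l₁ - 3 * ζ) l₁ ∨ t ∈ Icc r₂ (r₂ + 3 * ζ) ∨ t ∈ Icc (l₃ - 3 * ζ) l₃ ∨
      t ∈ Icc r₄ (r₄ + 3 * ζ) → (D.param t).1 ∉ D.multiplePoints ∧ ∀ i : ℤ, t ≠ i)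
    (hk : k ≠ 0) (hθ : ∀ t ∈ Icc r₁ l₂, q + k * t ∈ Icc r₃ l₄)
    (hθ' : ∀ t ∈ Icc r₃ l₄, (t - q) / k ∈ Icc r₁ l₂)
    (hend : ∀ t, t = r₁ ∨ t = l₂ → (D.param (q + k * t)).1 ∉ D.multiplePoints)
    (hend' : ∀ t, t = r₃ ∨ t = l₄ → (D.param ((t - q) / k)).1 ∉ D.multiplePoints)
    {e₁ e₂ e₃ e₄ : ℝ → Plane} {S₁ S₂ S₃ S₄ : Set Plane}
    (g₁ : D.IsGate l₁ r₁ (D.param l₁).1 (D.param (q + k * r₁)).1 S₁ e₁)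
    (g₂ : D.IsGate l₂ r₂ (D.param (q + k * l₂)).1 (D.param r₂).1 S₂ e₂)
    (g₃ : D.IsGate l₃ r₃ (D.param l₃).1 (D.param ((r₃ - q) / k)).1 S₃ e₃)
    (g₄ : D.IsGate l₄ r₄ (D.param ((l₄ - q) / k)).1 (D.param r₄).1 S₄ e₄)
    (s12 : Disjoint S₁ S₂) (s13 : Disjoint S₁ S₃) (s14 : Disjoint S₁ S₄) (s23 : Disjoint S₂ S₃)
    (s24 : Disjoint S₂ S₄) (s34 : Disjoint S₃ S₄)
    {x : Plane} (hx : x ∈ D.multiplePoints)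
    (hxC : ∀ t ∈ Ico (l₁ - 2 * ζ) (l₁ - 2 * ζ + D.size), (D.param t).1 = x →
      t ∈ Ioo l₁ r₁ ∨ t ∈ Ioo l₂ r₂ ∨ t ∈ Ioo l₃ r₃ ∨ t ∈ Ioo l₄ r₄) :
    ∃ D' : KnotDiagram, D'.knot = D.knot ∧ D'.c < D.c := by
  have hD := D.isClosedCurve_param
  have i1 := g₁.lt
  have i2 := g₂.lt
  have i3 := g₃.lt
  have i4 := g₄.lt
  set n : ℝ := (D.size : ℝ) with hn
  set C : Set ℝ := {t | t ∈ Ioo l₁ r₁ ∨ t ∈ Ioo l₂ r₂ ∨ t ∈ Ioo l₃ r₃ ∨ t ∈ Ioo l₄ r₄} with hC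
  -- Outside the gates the new curve at `t` has the plane position of the old one at `σ t`: the arcs
  -- `[r₁, l₂]` and `[r₃, l₄]` exchange places and everything else stays.
  set σ : ℝ → ℝ := fun t =>
    if t ∈ Icc r₁ l₂ then q + k * t else if t ∈ Icc r₃ l₄ then (t - q) / k else t with hσ
  set p : ℝ → Plane := fun t => if t ∈ Ioo l₁ r₁ then e₁ t else if t ∈ Ioo l₂ r₂ then e₂ t else
    if t ∈ Ioo l₃ r₃ then e₃ t else if t ∈ Ioo l₄ r₄ then e₄ t else (D.param (σ t)).1 with hp
  set W := l₁ - 2 * ζ with hW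
  have σA : ∀ t ∈ Icc r₁ l₂, σ t = q + k * t := fun t ht => if_pos ht
  have σB : ∀ t ∈ Icc r₃ l₄, σ t = (t - q) / k := fun t ht => by
    simp only [hσ]
    rw [if_neg (fun h => by linarith [h.2, ht.1]), if_pos ht]
  have σO : ∀ t, t ≤ l₁ ∨ r₂ ≤ t ∧ t ≤ l₃ ∨ r₄ ≤ t → σ t = t := fun t ht => by
    simp only [hσ]
    rw [if_neg, if_neg] <;> rintro ⟨h1, h2⟩ <;> rcases ht with h | ⟨h, h'⟩ | h <;> linarith
  have nA : ∀ t ∈ Icc r₁ l₂, t ∉ C := by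
    rintro t ⟨h1, h2⟩ (h | h | h | h) <;> linarith [h.1, h.2]
  have nB : ∀ t ∈ Icc r₃ l₄, t ∉ C := by
    rintro t ⟨h1, h2⟩ (h | h | h | h) <;> linarith [h.1, h.2]
  have nO : ∀ t, t ≤ l₁ ∨ r₂ ≤ t ∧ t ≤ l₃ ∨ r₄ ≤ t → t ∉ C := by
    rintro t (h' | ⟨h', h''⟩ | h') (h | h | h | h) <;> linarith [h.1, h.2]
  have hcases : ∀ t, t ∉ C → (t ≤ l₁ ∨ r₂ ≤ t ∧ t ≤ l₃ ∨ r₄ ≤ t) ∨ t ∈ Icc r₁ l₂ ∨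
      t ∈ Icc r₃ l₄ := by
    intro t ht
    simp only [hC, mem_ofPred_eq, mem_Ioo, not_or, not_and, not_lt] at ht
    obtain ⟨t1, t2, t3, t4⟩ := ht
    rcases le_or_gt t l₁ with h1 | h1
    · exact Or.inl (Or.inl h1)
    have t1 := t1 h1
    rcases le_or_gt t l₂ with h2 | h2
    · exact Or.inr (Or.inl ⟨t1, h2⟩)
    have t2 := t2 h2
    rcases le_or_gt t l₃ with h3 | h3
    · exact Or.inl (Or.inr (Or.inl ⟨t2, h3⟩))
    have t3 := t3 h3
    rcases le_or_gt t l₄ with h4 | h4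
    · exact Or.inr (Or.inr ⟨t3, h4⟩)
    · exact Or.inl (Or.inr (Or.inr (t4 h4)))
  have pN : ∀ t, t ∉ C → p t = (D.param (σ t)).1 := by
    intro t ht
    simp only [hC, mem_ofPred_eq, not_or] at ht
    simp only [hp]
    rw [if_neg ht.1, if_neg ht.2.1, if_neg ht.2.2.1, if_neg ht.2.2.2]
  have pO : ∀ t, t ≤ l₁ ∨ r₂ ≤ t ∧ t ≤ l₃ ∨ r₄ ≤ t → p t = (D.param t).1 := fun t ht => by
    rw [pN t (nO t ht), σO t ht]
  have pA : ∀ t ∈ Icc r₁ l₂, p t = (D.param (q + k * t)).1 := fun t ht => by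
    rw [pN t (nA t ht), σA t ht]
  have pB : ∀ t ∈ Icc r₃ l₄, p t = (D.param ((t - q) / k)).1 := fun t ht => by
    rw [pN t (nB t ht), σB t ht]
  have p1 : ∀ t ∈ Icc l₁ r₁, p t = e₁ t := by
    intro t ht
    rcases ht.1.eq_or_lt with rfl | h1
    · rw [pO _ (Or.inl le_rfl), g₁.left]
    rcases ht.2.eq_or_lt with rfl | h2
    · rw [pA _ ⟨le_rfl, h12⟩, g₁.right]
    exact if_pos ⟨h1, h2⟩
  have p2 : ∀ t ∈ Icc l₂ r₂, p t = e₂ t := by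
    intro t ht
    rcases ht.1.eq_or_lt with rfl | h1
    · rw [pA _ ⟨h12, le_rfl⟩, g₂.left]
    rcases ht.2.eq_or_lt with rfl | h2
    · rw [pO _ (Or.inr (Or.inl ⟨le_rfl, by linarith⟩)), g₂.right]
    simp only [hp]
    rw [if_neg (fun h => by linarith [h.2]), if_pos ⟨h1, h2⟩]
  have p3 : ∀ t ∈ Icc l₃ r₃, p t = e₃ t := by
    intro t ht
    rcases ht.1.eq_or_lt with rfl | h1
    · rw [pO _ (Or.inr (Or.inl ⟨by linarith, le_rfl⟩)), g₃.left]
    rcases ht.2.eq_or_lt with rfl | h2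
    · rw [pB _ ⟨le_rfl, h34⟩, g₃.right]
    simp only [hp]
    rw [if_neg (fun h => by linarith [h.2]), if_neg (fun h => by linarith [h.2]), if_pos ⟨h1, h2⟩]
  have p4 : ∀ t ∈ Icc l₄ r₄, p t = e₄ t := by
    intro t ht
    rcases ht.1.eq_or_lt with rfl | h1
    · rw [pB _ ⟨h34, le_rfl⟩, g₄.left]
    rcases ht.2.eq_or_lt with rfl | h2
    · rw [pO _ (Or.inr (Or.inr le_rfl)), g₄.right]
    simp only [hp]
    rw [if_neg (fun h => by linarith [h.2]), if_neg (fun h => by linarith [h.2]),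
      if_neg (fun h => by linarith [h.2]), if_pos ⟨h1, h2⟩]
  have pC : ∀ t ∈ C, ∀ s, p t ≠ (D.param s).1 := by
    rintro t (h | h | h | h) s
    · rw [p1 t (Ioo_subset_Icc_self h)]; exact g₁.avoid t h s
    · rw [p2 t (Ioo_subset_Icc_self h)]; exact g₂.avoid t h s
    · rw [p3 t (Ioo_subset_Icc_self h)]; exact g₃.avoid t h s
    · rw [p4 t (Ioo_subset_Icc_self h)]; exact g₄.avoid t h s
  have pinj : ∀ s ∈ C, ∀ t ∈ C, p s = p t → s = t := by
    have m1 : ∀ t ∈ Ioo l₁ r₁, p t ∈ S₁ := fun t h => by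
      rw [p1 t (Ioo_subset_Icc_self h)]; exact g₁.mapsTo h
    have m2 : ∀ t ∈ Ioo l₂ r₂, p t ∈ S₂ := fun t h => by
      rw [p2 t (Ioo_subset_Icc_self h)]; exact g₂.mapsTo h
    have m3 : ∀ t ∈ Ioo l₃ r₃, p t ∈ S₃ := fun t h => by
      rw [p3 t (Ioo_subset_Icc_self h)]; exact g₃.mapsTo h
    have m4 : ∀ t ∈ Ioo l₄ r₄, p t ∈ S₄ := fun t h => by
      rw [p4 t (Ioo_subset_Icc_self h)]; exact g₄.mapsTo h
    have dj : ∀ {S T : Set Plane}, Disjoint S T → ∀ {a b : Plane}, a ∈ S → b ∈ T → a = b → False :=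
      fun h a b ha hb hab => disjoint_left.1 h ha (hab ▸ hb)
    rintro s (hs | hs | hs | hs) t (ht | ht | ht | ht) hst
    · refine g₁.injOn hs ht ?_
      rwa [← p1 s (Ioo_subset_Icc_self hs), ← p1 t (Ioo_subset_Icc_self ht)]
    · exact (dj s12 (m1 s hs) (m2 t ht) hst).elim
    · exact (dj s13 (m1 s hs) (m3 t ht) hst).elim
    · exact (dj s14 (m1 s hs) (m4 t ht) hst).elim
    · exact (dj s12 (m1 t ht) (m2 s hs) hst.symm).elim
    · refine g₂.injOn hs ht ?_
      rwa [← p2 s (Ioo_subset_Icc_self hs), ← p2 t (Ioo_subset_Icc_self ht)]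
    · exact (dj s23 (m2 s hs) (m3 t ht) hst).elim
    · exact (dj s24 (m2 s hs) (m4 t ht) hst).elim
    · exact (dj s13 (m1 t ht) (m3 s hs) hst.symm).elim
    · exact (dj s23 (m2 t ht) (m3 s hs) hst.symm).elim
    · refine g₃.injOn hs ht ?_
      rwa [← p3 s (Ioo_subset_Icc_self hs), ← p3 t (Ioo_subset_Icc_self ht)]
    · exact (dj s34 (m3 s hs) (m4 t ht) hst).elim
    · exact (dj s14 (m1 t ht) (m4 s hs) hst.symm).elim
    · exact (dj s24 (m2 t ht) (m4 s hs) hst.symm).elim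
    · exact (dj s34 (m3 t ht) (m4 s hs) hst.symm).elim
    · refine g₄.injOn hs ht ?_
      rwa [← p4 s (Ioo_subset_Icc_self hs), ← p4 t (Ioo_subset_Icc_self ht)]
  have hdc := D.continuous_proj
  have pcO : ∀ {u v : ℝ}, (∀ t ∈ Icc u v, t ≤ l₁ ∨ r₂ ≤ t ∧ t ≤ l₃ ∨ r₄ ≤ t) →
      ContinuousOn p (Icc u v) := fun h => hdc.continuousOn.congr fun t ht => pO t (h t ht)
  have glue : ∀ {u v w : ℝ}, u ≤ v → v ≤ w → ContinuousOn p (Icc u v) → ContinuousOn p (Icc v w) →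
      ContinuousOn p (Icc u w) := by
    intro u v w huv hvw h h'
    rw [← Icc_union_Icc_eq_Icc huv hvw]
    exact h.union_of_isClosed h' isClosed_Icc isClosed_Icc
  have pcA : ContinuousOn p (Icc (l₁ - ζ) (r₂ + ζ)) := by
    refine glue (v := r₂) (by linarith) (by linarith) ?_ (pcO fun t ht =>
      Or.inr (Or.inl ⟨ht.1, by linarith [ht.2]⟩))
    refine glue (v := l₂) (by linarith) (by linarith) ?_ (g₂.continuousOn.congr p2)
    refine glue (v := r₁) (by linarith) (by linarith) ?_
      (ContinuousOn.congr (hdc.comp (by fun_prop : Continuous fun t => q + k * t)).continuousOn pA)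
    exact glue (v := l₁) (by linarith) (by linarith) (pcO fun t ht => Or.inl ht.2)
      (g₁.continuousOn.congr p1)
  have pcB : ContinuousOn p (Icc (l₃ - ζ) (r₄ + ζ)) := by
    refine glue (v := r₄) (by linarith) (by linarith) ?_ (pcO fun t ht =>
      Or.inr (Or.inr ht.1))
    refine glue (v := l₄) (by linarith) (by linarith) ?_ (g₄.continuousOn.congr p4)
    refine glue (v := r₃) (by linarith) (by linarith) ?_
      (ContinuousOn.congr (hdc.comp (by fun_prop : Continuous fun t => (t - q) / k)).continuousOn pB)
    exact glue (v := l₃) (by linarith) (by linarith) (pcO fun t ht =>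
      Or.inr (Or.inl ⟨by linarith [ht.1], ht.2⟩)) (g₃.continuousOn.congr p3)
  -- In both moves the descending strand stands over a collar without crossings, behind `r₂` or
  -- `r₄`. A gate avoids the whole projection; elsewhere, meeting the collar at `s` with `σ t ≠ s`
  -- would make its projection a double point.
  have hpole : ∀ t s, l₁ - ζ ≤ t → t ≤ r₄ → s ≤ r₄ + 3 * ζ → l₁ ≤ s → σ t ≠ s →
      (D.param s).1 ∉ D.multiplePoints → l₁ - ζ ≤ σ t → σ t ≤ r₄ → p t ≠ (D.param s).1 := by
    intro t s ht0 ht1 hs1 hs0 hne hs hσ0 hσ1 h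
    by_cases htC : t ∈ C
    · exact pC t htC s h
    · rw [pN t htC] at h
      refine hs ?_
      rw [← h]
      exact D.mem_multiplePoints_of_proj_eq hne (by linarith) (by linarith) h
  have hcolaff : ∀ {u v : ℝ}, (∀ t ∈ Icc u v, t ∈ Icc (l₁ - 3 * ζ) l₁ ∨ t ∈ Icc r₂ (r₂ + 3 * ζ) ∨
      t ∈ Icc (l₃ - 3 * ζ) l₃ ∨ t ∈ Icc r₄ (r₄ + 3 * ζ)) → AffineOnSet D.param (Icc u v) :=
    fun h => D.affineOnSet_param fun i hi => (hcol i (h i (Ioo_subset_Icc_self hi))).2 i rfl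
  -- move the overpass
  obtain ⟨Z, hZ⟩ := hD.bddAbove
  obtain ⟨F₁, hF₁, k₁, hA1, hA2, hA3, hA4, hA5, hA6, hA7, hA8⟩ := hD.exists_replace_over
    (a := l₁ - 3 * ζ) (a₀ := l₁ - 2 * ζ) (a₁ := l₁ - ζ) (b₂ := r₂) (b₁ := r₂ + ζ)
    (b₀ := r₂ + 2 * ζ) (b := r₂ + 3 * ζ) (by linarith) (by linarith) (by linarith) (by linarith)
    (by linarith) (by linarith) (by linarith)
    (fun t ht s hs => le_of_not_isUnder (hover t ht) s hs)
    (hcolaff fun t ht => Or.inl ⟨by linarith [ht.1], by linarith [ht.2]⟩).snd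
    (hcolaff fun t ht => Or.inr (Or.inl ⟨by linarith [ht.1], by linarith [ht.2]⟩)).snd
    pcA (fun t ht => pO t (Or.inl (by linarith [ht.2])))
    (fun t ht => pO t (Or.inr (Or.inl ⟨ht.1, by linarith [ht.2]⟩)))
    (by
      intro t ht s hs
      by_cases htC : t ∈ C
      · exact pC t htC s
      have hσt : σ t ∈ Icc (l₁ - ζ) r₂ ∨ σ t ∈ Icc r₃ l₄ := by
        rcases hcases t htC with h | h | h
        · rw [σO t h]; exact Or.inl ht
        · rw [σA t h]; exact Or.inr (hθ t h)
        · linarith [h.1, ht.2]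
      refine hpole t s ht.1 (by linarith [ht.2]) (by linarith [hs.2]) (by linarith [hs.1]) ?_
        (hcol s (Or.inr (Or.inl ⟨by linarith [hs.1], by linarith [hs.2]⟩))).1 ?_ ?_
      · intro h
        rcases hσt with h' | h' <;> linarith [h'.1, h'.2, hs.1, hs.2]
      · rcases hσt with h' | h' <;> linarith [h'.1]
      · rcases hσt with h' | h' <;> linarith [h'.2])
    Z
  set γ₁ : ℝ → Space := fun t => F₁ (D.param t) with hγ₁
  have hD₁ : IsClosedCurve n γ₁ := hD.comp F₁
  have e₁out : ∀ t ∈ Icc (r₂ + 2 * ζ) (l₁ - 2 * ζ + n), γ₁ t = D.param t := hA2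
  have e₁in : ∀ t ∈ Icc (l₁ - 2 * ζ) (r₂ + 2 * ζ), γ₁ t = (p t, k₁ t) := hA1
  -- move the underpass
  obtain ⟨F₂, hF₂, k₂, hB1, hB2, hB3, hB4, hB5⟩ := hD₁.exists_replace_under
    (a := l₃ - 3 * ζ) (a₀ := l₃ - 2 * ζ) (a₁ := l₃ - ζ) (b₂ := r₄) (b₁ := r₄ + ζ)
    (b₀ := r₄ + 2 * ζ) (b := r₄ + 3 * ζ) (by linarith) (by linarith) (by linarith) (by linarith)
    (by linarith) (by linarith) (by linarith)
    (by
      intro t ht s hs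
      have ht' : γ₁ t = D.param t := e₁out t ⟨by linarith [ht.1], by linarith [ht.2]⟩
      obtain ⟨s', hs', m, rfl⟩ := hD₁.exists_mem_Ico (l₁ - 2 * ζ) s
      rw [hD₁.periodic_int] at hs ⊢
      rw [ht'] at hs ⊢
      -- The underpass is still lowest after the first move: the moved overpass has height at least
      -- `Z`, and its ramps over the collars are no lower than before, with unchanged projection.
      have hno := le_of_not_isOver (hunder t ht)
      rcases le_total (r₂ + 2 * ζ) s' with h | h
      · rw [e₁out s' ⟨h, hs'.2.le⟩] at hs ⊢
        exact hno s' hs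
      · rw [e₁in s' ⟨hs'.1, h⟩] at hs ⊢
        simp only at hs ⊢
        rcases le_total s' (l₁ - ζ) with h1 | h1
        · rw [pO s' (Or.inl (by linarith))] at hs
          exact (hno s' hs).trans (hA7 s' ⟨hs'.1, h1⟩)
        · rcases le_total s' (r₂ + ζ) with h2 | h2
          · exact ((le_abs_self _).trans (hZ t)).trans (hA6 s' ⟨h1, h2⟩)
          · rw [pO s' (Or.inr (Or.inl ⟨by linarith, by linarith⟩))] at hs
            exact (hno s' hs).trans (hA8 s' ⟨h2, h⟩))
    (((hcolaff fun t ht => Or.inr (Or.inr (Or.inl ⟨by linarith [ht.1], by linarith [ht.2]⟩))).congr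
      fun t ht => e₁out t ⟨by linarith [ht.1], by linarith [ht.2]⟩).snd)
    (((hcolaff fun t ht => Or.inr (Or.inr (Or.inr ⟨by linarith [ht.1], by linarith [ht.2]⟩))).congr
      fun t ht => e₁out t ⟨by linarith [ht.1], by linarith [ht.2]⟩).snd)
    pcB
    (by
      intro t ht
      rw [e₁out t ⟨by linarith [ht.1], by linarith [ht.2]⟩]
      exact pO t (Or.inr (Or.inl ⟨by linarith [ht.1], by linarith [ht.2]⟩)))
    (by
      intro t ht
      rw [e₁out t ⟨by linarith [ht.1], by linarith [ht.2]⟩]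
      exact pO t (Or.inr (Or.inr ht.1)))
    (by
      intro t ht s hs
      rw [e₁out s ⟨by linarith [hs.1], by linarith [hs.2]⟩]
      by_cases htC : t ∈ C
      · exact pC t htC s
      have hσt : σ t ∈ Icc (l₃ - ζ) r₄ ∨ σ t ∈ Icc r₁ l₂ := by
        rcases hcases t htC with h | h | h
        · rw [σO t h]; exact Or.inl ht
        · linarith [h.2, ht.1]
        · rw [σB t h]; exact Or.inr (hθ' t h)
      refine hpole t s (by linarith [ht.1]) (by linarith [ht.2]) (by linarith [hs.2])
        (by linarith [hs.1]) ?_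
        (hcol s (Or.inr (Or.inr (Or.inr ⟨by linarith [hs.1], by linarith [hs.2]⟩)))).1 ?_ ?_
      · intro h
        rcases hσt with h' | h' <;> linarith [h'.1, h'.2, hs.1, hs.2]
      · rcases hσt with h' | h' <;> linarith [h'.1]
      · rcases hσt with h' | h' <;> linarith [h'.2])
  set γ₂ : ℝ → Space := fun t => (F₁.trans F₂) (D.param t) with hγ₂
  have e₂in : ∀ t ∈ Icc (l₃ - 2 * ζ) (r₄ + 2 * ζ), γ₂ t = (p t, k₂ t) := hB1
  have e₂out : ∀ t ∈ Icc (r₄ + 2 * ζ) (l₃ - 2 * ζ + n), γ₂ t = γ₁ t := hB2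
  have e₂out' : ∀ t ∈ Icc W (l₃ - 2 * ζ), γ₂ t = γ₁ t := by
    intro t ht
    have h1 := e₂out (t + n) ⟨by linarith [ht.1], by linarith [ht.2]⟩
    have h2 : γ₂ (t + n) = γ₂ t := by
      simp only [hγ₂]
      rw [hD.periodic]
    rw [← h2, h1, hD₁.periodic]
  have f1 : ∀ t ∈ Icc W (r₂ + 2 * ζ), γ₂ t = (p t, k₁ t) := fun t ht => by
    rw [e₂out' t ⟨ht.1, by linarith [ht.2]⟩, e₁in t ht]
  have f2 : ∀ t ∈ Icc (r₂ + 2 * ζ) (l₃ - 2 * ζ), γ₂ t = D.param t := fun t ht => by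
    rw [e₂out' t ⟨by linarith [ht.1], ht.2⟩, e₁out t ⟨ht.1, by linarith [ht.2]⟩]
  have f4 : ∀ t ∈ Icc (r₄ + 2 * ζ) (W + n), γ₂ t = D.param t := fun t ht => by
    rw [e₂out t ⟨ht.1, by linarith [ht.2]⟩, e₁out t ⟨by linarith [ht.1], ht.2⟩]
  have fp : ∀ t ∈ Icc W (W + n), (γ₂ t).1 = p t := by
    intro t ht
    rcases le_total t (r₂ + 2 * ζ) with h | h
    · rw [f1 t ⟨ht.1, h⟩]
    rcases le_total t (l₃ - 2 * ζ) with h' | h'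
    · rw [f2 t ⟨h, h'⟩, pO t (Or.inr (Or.inl ⟨by linarith, by linarith⟩))]
    rcases le_total t (r₄ + 2 * ζ) with h'' | h''
    · rw [e₂in t ⟨h', h''⟩]
    · rw [f4 t ⟨h'', ht.2⟩, pO t (Or.inr (Or.inr (by linarith)))]
  have hσm : ∀ t ∈ Ico W (W + n), t ∉ C → σ t ∈ Ico W (W + n) := by
    intro t ht htC
    rcases hcases t htC with h | h | h
    · rwa [σO t h]
    · rw [σA t h]
      have := hθ t h
      exact ⟨by linarith [this.1], by linarith [this.2]⟩
    · rw [σB t h]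
      have := hθ' t h
      exact ⟨by linarith [this.1], by linarith [this.2]⟩
  have hσi : ∀ s ∈ Ico W (W + n), s ∉ C → ∀ t ∈ Ico W (W + n), t ∉ C → σ s = σ t → s = t := by
    intro s _ hsC t _ htC hst
    rcases hcases s hsC with h | h | h <;> rcases hcases t htC with h' | h' | h'
    · rwa [σO s h, σO t h'] at hst
    · rw [σO s h, σA t h'] at hst
      have := hθ t h'
      rw [← hst] at this
      rcases h with h | ⟨h, h''⟩ | h <;> linarith [this.1, this.2]
    · rw [σO s h, σB t h'] at hst
      have := hθ' t h'
      rw [← hst] at this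
      rcases h with h | ⟨h, h''⟩ | h <;> linarith [this.1, this.2]
    · rw [σA s h, σO t h'] at hst
      have := hθ s h
      rw [hst] at this
      rcases h' with h | ⟨h, h''⟩ | h <;> linarith [this.1, this.2]
    · rw [σA s h, σA t h'] at hst
      exact mul_left_cancel₀ hk (add_left_cancel hst)
    · rw [σA s h, σB t h'] at hst
      have := hθ s h
      have := hθ' t h'
      linarith [(hθ s h).1, (hθ' t h').2]
    · rw [σB s h, σO t h'] at hst
      have := hθ' s h
      rw [hst] at this
      rcases h' with h | ⟨h, h''⟩ | h <;> linarith [this.1, this.2]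
    · rw [σB s h, σA t h'] at hst
      linarith [(hθ t h').1, (hθ' s h).2]
    · rw [σB s h, σB t h'] at hst
      have := (div_left_inj' hk).1 hst
      linarith
  obtain ⟨m₁, hm1, am1, am1'⟩ := g₁.affine
  obtain ⟨m₂, hm2, am2, am2'⟩ := g₂.affine
  obtain ⟨m₃, hm3, am3, am3'⟩ := g₃.affine
  obtain ⟨m₄, hm4, am4, am4'⟩ := g₄.affine
  -- The possible breaks: collar parameters where the heights change their slope, ends and break
  -- points of the gates, and parameters that `σ` sends to vertices.
  have hfin : ({W, l₁ - ζ, l₁, r₂, r₂ + ζ, r₂ + 2 * ζ, l₃ - 2 * ζ, l₃ - ζ, l₃, r₄, r₄ + ζ,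
      r₄ + 2 * ζ} ∪ {r₁, l₂, r₃, l₄} ∪ {m₁, m₂, m₃, m₄} ∪
      {t | t ∈ Ico W (W + n) ∧ t ∉ C ∧ ∃ i : ℤ, σ t = i} : Set ℝ).Finite := by
    refine (Set.toFinite _).union (Set.Finite.of_injOn (f := σ)
      (t := (fun i : ℤ => (i : ℝ)) '' Icc ⌊W⌋ ⌈W + n⌉) ?_ ?_ ((Set.finite_Icc _ _).image _))
    · rintro t ⟨ht, htC, i, hi⟩
      refine ⟨i, ⟨?_, ?_⟩, hi.symm⟩ <;> have := hσm t ht htC <;> rw [hi] at this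
      · have : (⌊W⌋ : ℝ) ≤ i := (Int.floor_le _).trans this.1
        exact_mod_cast this
      · have : (i : ℝ) ≤ ⌈W + n⌉ := this.2.le.trans (Int.le_ceil _)
        exact_mod_cast this
    · rintro s ⟨hs, hsC, -⟩ t ⟨ht, htC, -⟩ hst
      exact hσi s hs hsC t ht htC hst
  set V := hfin.toFinset with hV
  have memV : ∀ t, t ∈ V ↔ (((t = W ∨ t = l₁ - ζ ∨ t = l₁ ∨ t = r₂ ∨ t = r₂ + ζ ∨ t = r₂ + 2 * ζ ∨
      t = l₃ - 2 * ζ ∨ t = l₃ - ζ ∨ t = l₃ ∨ t = r₄ ∨ t = r₄ + ζ ∨ t = r₄ + 2 * ζ) ∨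
      (t = r₁ ∨ t = l₂ ∨ t = r₃ ∨ t = l₄)) ∨ (t = m₁ ∨ t = m₂ ∨ t = m₃ ∨ t = m₄)) ∨
      (t ∈ Ico W (W + n) ∧ t ∉ C ∧ ∃ i : ℤ, σ t = i) := by
    intro t
    rw [hV, Set.Finite.mem_toFinset]
    rfl
  have sp : ∀ t, (((t = W ∨ t = l₁ - ζ ∨ t = l₁ ∨ t = r₂ ∨ t = r₂ + ζ ∨ t = r₂ + 2 * ζ ∨
      t = l₃ - 2 * ζ ∨ t = l₃ - ζ ∨ t = l₃ ∨ t = r₄ ∨ t = r₄ + ζ ∨ t = r₄ + 2 * ζ) ∨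
      (t = r₁ ∨ t = l₂ ∨ t = r₃ ∨ t = l₄)) ∨ (t = m₁ ∨ t = m₂ ∨ t = m₃ ∨ t = m₄)) →
      t ∈ (V : Set ℝ) := fun t h => (memV t).2 (Or.inl h)
  have iV : ∀ t ∈ Ico W (W + n), t ∉ C → ∀ i : ℤ, σ t = i → t ∈ (V : Set ℝ) :=
    fun t ht htC i hi => (memV t).2 (Or.inr ⟨ht, htC, i, hi⟩)
  have paO : ∀ u v, W ≤ u → v ≤ W + n →
      (∀ t ∈ Icc u v, t ≤ l₁ ∨ r₂ ≤ t ∧ t ≤ l₃ ∨ r₄ ≤ t) →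
      PiecewiseAffine (V : Set ℝ) (fun t => D.param t) u v := by
    intro u v hu hv h
    refine (D.piecewiseAffine_param_comp (q := 0) (k := 1) one_ne_zero ?_).congr
      fun t _ => by rw [zero_add, one_mul]
    intro w hw i hi
    have h' := h w (Ioo_subset_Icc_self hw)
    refine iV w ⟨by linarith [hw.1], by linarith [hw.2]⟩ (nO w h') i ?_
    rw [σO w h', ← hi]
    ring
  have fstPA : ∀ {f : ℝ → Space} {u v : ℝ}, PiecewiseAffine (V : Set ℝ) f u v →
      PiecewiseAffine (V : Set ℝ) (fun t => (f t).1) u v :=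
    fun h s t hs ht hst => (h s t hs ht hst).fst
  have sndPA : ∀ {f : ℝ → Space} {u v : ℝ}, PiecewiseAffine (V : Set ℝ) f u v →
      PiecewiseAffine (V : Set ℝ) (fun t => (f t).2) u v :=
    fun h s t hs ht hst => (h s t hs ht hst).snd
  have ppO : ∀ u v, W ≤ u → v ≤ W + n →
      (∀ t ∈ Icc u v, t ≤ l₁ ∨ r₂ ≤ t ∧ t ≤ l₃ ∨ r₄ ≤ t) → PiecewiseAffine (V : Set ℝ) p u v :=
    fun u v hu hv h => (fstPA (paO u v hu hv h)).congr fun t ht => pO t (h t ht)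
  have pgate : ∀ {l m r : ℝ} {e : ℝ → Plane}, m ∈ Ioo l r → AffineOnSet e (Icc l m) →
      AffineOnSet e (Icc m r) → (∀ t ∈ Icc l r, p t = e t) → m ∈ (V : Set ℝ) →
      PiecewiseAffine (V : Set ℝ) p l r := fun hm h h' hpe hmV =>
    ((PiecewiseAffine.of_affineOnSet h).trans (PiecewiseAffine.of_affineOnSet h') hmV).congr hpe
  have ppA : PiecewiseAffine (V : Set ℝ) p r₁ l₂ := by
    refine (fstPA (D.piecewiseAffine_param_comp (q := q) hk ?_)).congr pA
    intro w hw i hi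
    have hw' := Ioo_subset_Icc_self hw
    exact iV w ⟨by linarith [hw.1], by linarith [hw.2]⟩ (nA w hw') i (by rw [σA w hw', hi])
  have hdiv : ∀ t : ℝ, -q / k + 1 / k * t = (t - q) / k := fun t => by ring
  have ppB : PiecewiseAffine (V : Set ℝ) p r₃ l₄ := by
    refine (fstPA (D.piecewiseAffine_param_comp (q := -q / k) (k := 1 / k)
      (one_div_ne_zero hk) ?_)).congr fun t ht => by rw [pB t ht, hdiv]
    intro w hw i hi
    have hw' := Ioo_subset_Icc_self hw
    exact iV w ⟨by linarith [hw.1], by linarith [hw.2]⟩ (nB w hw') i (by rw [σB w hw', ← hdiv, hi])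
  have planar : PiecewiseAffine (V : Set ℝ) p W (W + n) := by
    refine .trans (v := r₄) ?_ (ppO _ _ (by linarith) le_rfl fun t ht => Or.inr (Or.inr ht.1))
      (sp _ (by simp))
    refine .trans (v := l₄) ?_ (pgate hm4 am4 am4' p4 (sp _ (by simp))) (sp _ (by simp))
    refine .trans (v := r₃) ?_ ppB (sp _ (by simp))
    refine .trans (v := l₃) ?_ (pgate hm3 am3 am3' p3 (sp _ (by simp))) (sp _ (by simp))
    refine .trans (v := r₂) ?_ (ppO _ _ (by linarith) (by linarith) fun t ht => Or.inr (Or.inl ht))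
      (sp _ (by simp))
    refine .trans (v := l₂) ?_ (pgate hm2 am2 am2' p2 (sp _ (by simp))) (sp _ (by simp))
    refine .trans (v := r₁) ?_ ppA (sp _ (by simp))
    exact .trans (v := l₁) (ppO _ _ le_rfl (by linarith) fun t ht => Or.inl ht.2)
      (pgate hm1 am1 am1' p1 (sp _ (by simp))) (sp _ (by simp))
  have height : PiecewiseAffine (V : Set ℝ) (fun t => (γ₂ t).2) W (W + n) := by
    have a1 : PiecewiseAffine (V : Set ℝ) k₁ W (r₂ + 2 * ζ) :=
      .trans (v := r₂ + ζ) (.trans (v := l₁ - ζ) (.of_affineOnSet hA3) (.of_affineOnSet hA4)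
        (sp _ (by simp))) (.of_affineOnSet hA5) (sp _ (by simp))
    have a2 : PiecewiseAffine (V : Set ℝ) k₂ (l₃ - 2 * ζ) (r₄ + 2 * ζ) :=
      .trans (v := r₄ + ζ) (.trans (v := l₃ - ζ) (.of_affineOnSet hB3) (.of_affineOnSet hB4)
        (sp _ (by simp))) (.of_affineOnSet hB5) (sp _ (by simp))
    refine .trans (v := r₄ + 2 * ζ) ?_ ((sndPA (paO _ _ (by linarith) le_rfl fun t ht =>
      Or.inr (Or.inr (by linarith [ht.1])))).congr fun t ht => by rw [f4 t ht]) (sp _ (by simp))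
    refine .trans (v := l₃ - 2 * ζ) ?_ (a2.congr fun t ht => by rw [e₂in t ht]) (sp _ (by simp))
    exact .trans (v := r₂ + 2 * ζ) (a1.congr fun t ht => by rw [f1 t ht])
      ((sndPA (paO _ _ (by linarith) (by linarith) fun t ht =>
        Or.inr (Or.inl ⟨by linarith [ht.1], by linarith [ht.2]⟩))).congr fun t ht => by rw [f2 t ht])
      (sp _ (by simp))
  have hVm : ∀ t ∈ V, t ∈ Ico W (W + n) := by
    intro t ht
    rcases (memV t).1 ht with ((h | h) | h) | h
    · rcases h with h | h | h | h | h | h | h | h | h | h | h | h <;> constructor <;> linarith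
    · rcases h with h | h | h | h <;> constructor <;> linarith
    · rcases h with h | h | h | h <;> constructor <;>
        linarith [hm1.1, hm1.2, hm2.1, hm2.2, hm3.1, hm3.2, hm4.1, hm4.2]
    · exact h.1
  refine D.exists_c_lt (hF₁.trans hF₂) (W := W) V ((memV W).2 (by simp)) hVm ?_ C σ ?_ ?_ hσm hσi hx
    ?_ ?_
  · intro s t hs ht hst
    refine ((planar.congr fp).prodMk height s t hs ht hst).congr fun w hw => rfl
  · intro s hs hsC t ht h
    have h1 := fp s (Ico_subset_Icc_self hs)
    have h2 := fp t (Ico_subset_Icc_self ht)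
    have h3 : p s = p t := h1.symm.trans (h.trans h2)
    by_cases htC : t ∈ C
    · exact pinj s hsC t htC h3
    · rw [pN t htC] at h3
      exact (pC s hsC _ h3).elim
  · intro t ht htC
    exact (fp t (Ico_subset_Icc_self ht)).trans (pN t htC)
  -- All parameters of `D` over `x` lie inside gates, whereas `σ` takes parameters outside the gates
  -- to parameters outside the gates; so `x` is no longer covered.
  · intro t ht htC h
    have h1 := hxC _ (hσm t ht htC) h
    change σ t ∈ C at h1
    rcases hcases t htC with h' | h' | h'
    · rw [σO t h'] at h1
      exact htC h1
    · rw [σA t h'] at h1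
      exact nB _ (hθ t h') h1
    · rw [σB t h'] at h1
      exact nA _ (hθ' t h') h1
  · intro t ht htC
    rcases (memV t).1 ht with ((h | h) | h) | h
    · have : (t ≤ l₁ ∨ r₂ ≤ t ∧ t ≤ l₃ ∨ r₄ ≤ t) ∧ (t ∈ Icc (l₁ - 3 * ζ) l₁ ∨
          t ∈ Icc r₂ (r₂ + 3 * ζ) ∨ t ∈ Icc (l₃ - 3 * ζ) l₃ ∨ t ∈ Icc r₄ (r₄ + 3 * ζ)) := by
        rcases h with h | h | h | h | h | h | h | h | h | h | h | h
        · exact ⟨.inl (by linarith), .inl ⟨by linarith, by linarith⟩⟩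
        · exact ⟨.inl (by linarith), .inl ⟨by linarith, by linarith⟩⟩
        · exact ⟨.inl (by linarith), .inl ⟨by linarith, by linarith⟩⟩
        · exact ⟨.inr (.inl ⟨by linarith, by linarith⟩), .inr (.inl ⟨by linarith, by linarith⟩)⟩
        · exact ⟨.inr (.inl ⟨by linarith, by linarith⟩), .inr (.inl ⟨by linarith, by linarith⟩)⟩
        · exact ⟨.inr (.inl ⟨by linarith, by linarith⟩), .inr (.inl ⟨by linarith, by linarith⟩)⟩
        · exact ⟨.inr (.inl ⟨by linarith, by linarith⟩),
            .inr (.inr (.inl ⟨by linarith, by linarith⟩))⟩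
        · exact ⟨.inr (.inl ⟨by linarith, by linarith⟩),
            .inr (.inr (.inl ⟨by linarith, by linarith⟩))⟩
        · exact ⟨.inr (.inl ⟨by linarith, by linarith⟩),
            .inr (.inr (.inl ⟨by linarith, by linarith⟩))⟩
        · exact ⟨.inr (.inr (by linarith)), .inr (.inr (.inr ⟨by linarith, by linarith⟩))⟩
        · exact ⟨.inr (.inr (by linarith)), .inr (.inr (.inr ⟨by linarith, by linarith⟩))⟩
        · exact ⟨.inr (.inr (by linarith)), .inr (.inr (.inr ⟨by linarith, by linarith⟩))⟩
      rw [σO t this.1]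
      exact (hcol t this.2).1
    · rcases h with h | h | h | h
      · rw [σA t ⟨by linarith, by linarith⟩]; exact hend t (.inl h)
      · rw [σA t ⟨by linarith, by linarith⟩]; exact hend t (.inr h)
      · rw [σB t ⟨by linarith, by linarith⟩]; exact hend' t (.inl h)
      · rw [σB t ⟨by linarith, by linarith⟩]; exact hend' t (.inr h)
    · rcases h with rfl | rfl | rfl | rfl
      · exact (htC (.inl hm1)).elim
      · exact (htC (.inr (.inl hm2))).elim
      · exact (htC (.inr (.inr (.inl hm3)))).elim
      · exact (htC (.inr (.inr (.inr hm4)))).elim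
    · obtain ⟨-, -, i, hi⟩ := h
      rw [hi]
      exact D.proj_int_notMem i

end KnotDiagram

/-! ### Construction of gates in local coordinates -/

/-- The half plane of the points on the `κ`-side of the line through `P` in direction `v`, with
respect to the frame `v, w`. -/
def sideOf (P v w : Plane) (κ : ℝ) : Set Plane :=
  {z | ∃ x y : ℝ, z = P + x • v + y • w ∧ 0 < κ * y}

theorem disjoint_sideOf {P v w : Plane} (hind : ∀ x y : ℝ, x • v + y • w = 0 → x = 0 ∧ y = 0)
    (κ : ℝ) : Disjoint (sideOf P v w κ) (sideOf P v w (-κ)) := by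
  rw [disjoint_left]
  rintro z ⟨x, y, rfl, hy⟩ ⟨x', y', h, hy'⟩
  have h0 : (x - x') • v + (y - y') • w = 0 := by
    have : P + x • v + y • w - (P + x' • v + y' • w) = 0 := sub_eq_zero.2 h
    rw [← this]
    module
  have := (hind _ _ h0).2
  have : y = y' := by linarith
  subst this
  linarith

/-- Two intervals correspond by an increasing affine map. -/
theorem exists_affine_increasing {a b c d : ℝ} (hab : a < b) (hcd : c < d) :
    ∃ q k : ℝ, k ≠ 0 ∧ q + k * a = c ∧ q + k * b = d ∧ (c - q) / k = a ∧ (d - q) / k = b ∧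
      (∀ t ∈ Icc a b, q + k * t ∈ Icc c d) ∧ ∀ t ∈ Icc c d, (t - q) / k ∈ Icc a b := by
  have h1 : 0 < b - a := by linarith
  set k := (d - c) / (b - a) with hk
  have hk0 : 0 < k := div_pos (by linarith) h1
  have hkb : k * (b - a) = d - c := div_mul_cancel₀ _ h1.ne'
  refine ⟨c - k * a, k, hk0.ne', by ring, by linarith, ?_, ?_, fun t ht => ⟨?_, ?_⟩,
    fun t ht => ⟨?_, ?_⟩⟩
  · rw [div_eq_iff hk0.ne']; ring
  · rw [div_eq_iff hk0.ne']; linarith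
  · nlinarith [ht.1]
  · nlinarith [ht.2]
  · rw [le_div_iff₀ hk0]; linarith [ht.1]
  · rw [div_le_iff₀ hk0]; linarith [ht.2]

/-- Two intervals correspond by a decreasing affine map. -/
theorem exists_affine_decreasing {a b c d : ℝ} (hab : a < b) (hcd : c < d) :
    ∃ q k : ℝ, k ≠ 0 ∧ q + k * a = d ∧ q + k * b = c ∧ (c - q) / k = b ∧ (d - q) / k = a ∧
      (∀ t ∈ Icc a b, q + k * t ∈ Icc c d) ∧ ∀ t ∈ Icc c d, (t - q) / k ∈ Icc a b := by
  obtain ⟨q, k, hk, h1, h2, h3, h4, h5, h6⟩ := exists_affine_increasing hab (neg_lt_neg hcd)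
  have e : ∀ t, (t - -q) / -k = (-t - q) / k := fun t => by
    rw [div_neg, ← neg_div]
    ring
  refine ⟨-q, -k, neg_ne_zero.2 hk, by linarith, by linarith, ?_, ?_, fun t ht => ?_,
    fun t ht => ?_⟩
  · rw [e, h4]
  · rw [e, h3]
  · have := h5 t ht
    exact ⟨by linarith [this.2], by linarith [this.1]⟩
  · rw [e]
    exact h6 _ ⟨by linarith [ht.2], by linarith [ht.1]⟩

namespace KnotDiagram

variable {D : KnotDiagram}

/-- Injectivity of the first coordinate makes the gate simple, and the sign of the second keeps it
on one side of a line. Two gates at the same point of the plane are kept apart by opposite signs,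
gates at different points by the balls. -/
theorem isGate_of_coords {P v w : Plane} {x y : ℝ → ℝ} {l m r κ ρ : ℝ} (hm : m ∈ Ioo l r)
    (hx : AffineOnSet x (Icc l r)) (hy : AffineOnSet y (Icc l m)) (hy' : AffineOnSet y (Icc m r))
    (hind : ∀ x y : ℝ, x • v + y • w = 0 → x = 0 ∧ y = 0)
    (hinj : InjOn x (Ioo l r)) (hκ : ∀ t ∈ Ioo l r, 0 < κ * y t)
    (hρ : ∀ t ∈ Ioo l r, ‖x t • v + y t • w‖ < ρ)
    (havoid : ∀ t ∈ Ioo l r, ∀ s, P + x t • v + y t • w ≠ (D.param s).1) :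
    D.IsGate l r (P + x l • v + y l • w) (P + x r • v + y r • w)
      (sideOf P v w κ ∩ Metric.ball P ρ) (fun t => P + x t • v + y t • w) where
  lt := hm.1.trans hm.2
  left := rfl
  right := rfl
  affine := by
    have key : ∀ {S : Set ℝ}, AffineOnSet x S → AffineOnSet y S →
        AffineOnSet (fun t => P + x t • v + y t • w) S := by
      rintro S ⟨q, a, hqa⟩ ⟨q', a', hqa'⟩
      refine ⟨P + q • v + q' • w, a • v + a' • w, fun t ht => ?_⟩
      simp only [hqa t ht, hqa' t ht, smul_eq_mul]
      module
    exact ⟨m, hm, key (hx.mono (Icc_subset_Icc le_rfl hm.2.le)) hy,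
      key (hx.mono (Icc_subset_Icc hm.1.le le_rfl)) hy'⟩
  injOn := by
    intro s hs t ht hst
    refine hinj hs ht ?_
    have h0 : (x s - x t) • v + (y s - y t) • w = 0 := by
      have : P + x s • v + y s • w - (P + x t • v + y t • w) = 0 := sub_eq_zero.2 hst
      rw [← this]
      module
    linarith [(hind _ _ h0).1]
  mapsTo := by
    intro t ht
    refine ⟨⟨x t, y t, rfl, hκ t ht⟩, ?_⟩
    simp only [Metric.mem_ball]
    rw [dist_eq_norm, add_assoc, add_sub_cancel_left]
    exact hρ t ht
  avoid := havoid

/-- Near a crossing a corner of the frame can be cut. -/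
theorem exists_corner_gate {P v w : Plane} {ε ρ a b κ l r : ℝ} (hlr : l < r) (ha : |a| < ε)
    (hb : |b| < ε) (ha0 : a ≠ 0) (hκ : 0 < κ * b)
    (hind : ∀ x y : ℝ, x • v + y • w = 0 → x = 0 ∧ y = 0)
    (hρ : ∀ x y : ℝ, |x| < ε → |y| < ε → ‖x • v + y • w‖ < ρ)
    (havoid : ∀ x y : ℝ, |x| < ε → |y| < ε → x ≠ 0 → y ≠ 0 →
      ∀ s, P + x • v + y • w ≠ (D.param s).1) :
    (∃ e, D.IsGate l r (P + a • v) (P + b • w) (sideOf P v w κ ∩ Metric.ball P ρ) e) ∧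
      ∃ e, D.IsGate l r (P + b • w) (P + a • v) (sideOf P v w κ ∩ Metric.ball P ρ) e := by
  have hl : 0 < r - l := by linarith
  have hb0 : b ≠ 0 := by
    rintro rfl
    simp at hκ
  have hsub : ∀ t ∈ Ioo l r, 0 < (t - l) / (r - l) ∧ (t - l) / (r - l) < 1 ∧
      0 < (r - t) / (r - l) ∧ (r - t) / (r - l) < 1 := by
    intro t ht
    refine ⟨div_pos (by linarith [ht.1]) hl, ?_, div_pos (by linarith [ht.2]) hl, ?_⟩
    · rw [div_lt_one hl]; linarith [ht.2]
    · rw [div_lt_one hl]; linarith [ht.1]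
  have hsc : ∀ {c z : ℝ}, 0 < c → c < 1 → |z| < ε → |c * z| < ε := by
    intro c z hc0 hc1 hz
    rw [abs_mul, abs_of_pos hc0]
    nlinarith [abs_nonneg z]
  have aff : ∀ (c : ℝ) (S : Set ℝ), AffineOnSet (fun t => (t - l) / (r - l) * c) S := fun c S =>
    ⟨-l / (r - l) * c, c / (r - l), fun t _ => by simp only [smul_eq_mul]; ring⟩
  have aff' : ∀ (c : ℝ) (S : Set ℝ), AffineOnSet (fun t => (r - t) / (r - l) * c) S := fun c S =>
    ⟨r / (r - l) * c, -(c / (r - l)), fun t _ => by simp only [smul_eq_mul]; ring⟩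
  -- A corner is cut by a single segment; its midpoint serves as break point only because a gate is
  -- made of two segments.
  have hmid : (l + r) / 2 ∈ Ioo l r := ⟨by linarith, by linarith⟩
  have hκb : ∀ {c : ℝ}, 0 < c → 0 < κ * (c * b) := fun {c} hc => by
    have := mul_pos hc hκ
    linarith [mul_left_comm κ c b]
  constructor
  · have := isGate_of_coords (D := D) (P := P) (v := v) (w := w) (κ := κ) (ρ := ρ) hmid
      (aff' a _) (aff b _) (aff b _) hind
      (by
        intro s _ t _ hst
        have := mul_right_cancel₀ ha0 hst
        rw [div_left_inj' hl.ne'] at this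
        linarith)
      (fun t ht => hκb (hsub t ht).1)
      (fun t ht => hρ _ _ (hsc (hsub t ht).2.2.1 (hsub t ht).2.2.2 ha)
        (hsc (hsub t ht).1 (hsub t ht).2.1 hb))
      (fun t ht => havoid _ _ (hsc (hsub t ht).2.2.1 (hsub t ht).2.2.2 ha)
        (hsc (hsub t ht).1 (hsub t ht).2.1 hb) (mul_ne_zero (hsub t ht).2.2.1.ne' ha0)
        (mul_ne_zero (hsub t ht).1.ne' hb0))
    simp only [sub_self, zero_div, zero_mul, zero_smul, add_zero, div_self hl.ne', one_mul] at this
    exact ⟨_, this⟩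
  · have := isGate_of_coords (D := D) (P := P) (v := v) (w := w) (κ := κ) (ρ := ρ) hmid
      (aff a _) (aff' b _) (aff' b _) hind
      (by
        intro s _ t _ hst
        have := mul_right_cancel₀ ha0 hst
        rw [div_left_inj' hl.ne'] at this
        linarith)
      (fun t ht => hκb (hsub t ht).2.2.1)
      (fun t ht => hρ _ _ (hsc (hsub t ht).1 (hsub t ht).2.1 ha)
        (hsc (hsub t ht).2.2.1 (hsub t ht).2.2.2 hb))
      (fun t ht => havoid _ _ (hsc (hsub t ht).1 (hsub t ht).2.1 ha)
        (hsc (hsub t ht).2.2.1 (hsub t ht).2.2.2 hb) (mul_ne_zero (hsub t ht).1.ne' ha0)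
        (mul_ne_zero (hsub t ht).2.2.1.ne' hb0))
    simp only [sub_self, zero_div, zero_mul, zero_smul, add_zero, div_self hl.ne', one_mul] at this
    exact ⟨_, this⟩

/-- Near a point that is no crossing one can turn around beside the projection. -/
theorem exists_turning_gate {P v w : Plane} {ε ρ a b κ l r : ℝ} (hlr : l < r) (ha : |a| < ε)
    (hb : |b| < ε) (hab : a ≠ b) (hlε : r - l < ε) (hκ : |κ| = 1)
    (hind : ∀ x y : ℝ, x • v + y • w = 0 → x = 0 ∧ y = 0)
    (hρ : ∀ x y : ℝ, |x| < ε → |y| < ε → ‖x • v + y • w‖ < ρ)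
    (havoid : ∀ x y : ℝ, |x| < ε → |y| < ε → y ≠ 0 → ∀ s, P + x • v + y • w ≠ (D.param s).1) :
    ∃ e, D.IsGate l r (P + a • v) (P + b • v) (sideOf P v w κ ∩ Metric.ball P ρ) e := by
  have hl : 0 < r - l := by linarith
  have hκκ : κ * κ = 1 := by rw [← abs_mul_abs_self, hκ, one_mul]
  have hx : ∀ t ∈ Ioo l r, |a + (t - l) / (r - l) * (b - a)| < ε := by
    intro t ht
    have h1 : 0 < (t - l) / (r - l) := div_pos (by linarith [ht.1]) hl
    have h2 : (t - l) / (r - l) < 1 := by rw [div_lt_one hl]; linarith [ht.2]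
    have := abs_lt.1 ha
    have := abs_lt.1 hb
    rw [abs_lt]
    constructor <;> nlinarith
  have hmin : ∀ t ∈ Ioo l r, 0 < min (t - l) (r - t) ∧ min (t - l) (r - t) < ε := fun t ht =>
    ⟨lt_min (by linarith [ht.1]) (by linarith [ht.2]),
      (min_le_left _ _).trans_lt (by linarith [ht.2])⟩
  have hy : ∀ t ∈ Ioo l r, |κ * min (t - l) (r - t)| < ε := by
    intro t ht
    rw [abs_mul, hκ, one_mul, abs_of_pos (hmin t ht).1]
    exact (hmin t ht).2
  -- The gate is a tent beside the projection: the first coordinate runs affinely from `a` to `b`,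
  -- while the second leaves `0` on the `κ`-side with slope `κ` and returns at the same rate.
  have := isGate_of_coords (D := D) (P := P) (v := v) (w := w) (κ := κ) (ρ := ρ) (l := l)
    (m := (l + r) / 2) (r := r)
    (x := fun t => a + (t - l) / (r - l) * (b - a)) (y := fun t => κ * min (t - l) (r - t))
    ⟨by linarith, by linarith⟩
    ⟨a + -l / (r - l) * (b - a), (b - a) / (r - l), fun t _ => by simp only [smul_eq_mul]; ring⟩
    ⟨κ * -l, κ, fun t ht => by
      simp only [smul_eq_mul]
      rw [min_eq_left (by linarith [ht.2])]
      ring⟩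
    ⟨κ * r, -κ, fun t ht => by
      simp only [smul_eq_mul]
      rw [min_eq_right (by linarith [ht.1])]
      ring⟩ hind
    (by
      intro s _ t _ hst
      have := mul_right_cancel₀ (sub_ne_zero.2 hab.symm) (add_left_cancel hst)
      rw [div_left_inj' hl.ne'] at this
      linarith)
    (fun t ht => by rw [← mul_assoc, hκκ, one_mul]; exact (hmin t ht).1)
    (fun t ht => hρ _ _ (hx t ht) (hy t ht))
    (fun t ht => havoid _ _ (hx t ht) (hy t ht) (by
      intro h0
      have := (hmin t ht).1
      rcases mul_eq_zero.1 h0 with h | h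
      · rw [h] at hκ; simp at hκ
      · linarith))
  simp only [sub_self, zero_div, zero_mul, add_zero, div_self hl.ne', one_mul, add_sub_cancel,
    min_eq_left hl.le, min_eq_right hl.le, mul_zero, zero_smul] at this
  exact ⟨_, this⟩

theorem IsUnder.mem_multiplePoints {t : ℝ} (h : D.IsUnder t) :
    (D.param t).1 ∈ D.multiplePoints := by
  obtain ⟨Q, hQ, h1, h2⟩ := h
  exact ⟨D.param t, mem_range_self t, Q, hQ, fun h => by rw [← h] at h2; exact lt_irrefl _ h2,
    rfl, h1⟩

theorem IsOver.mem_multiplePoints {t : ℝ} (h : D.IsOver t) :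
    (D.param t).1 ∈ D.multiplePoints := by
  obtain ⟨Q, hQ, h1, h2⟩ := h
  exact ⟨D.param t, mem_range_self t, Q, hQ, fun h => by rw [← h] at h2; exact lt_irrefl _ h2,
    rfl, h1⟩

theorem ball_inter_disjoint {P Q : Plane} {ρ : ℝ} (h : 2 * ρ ≤ dist P Q) (S T : Set Plane) :
    Disjoint (S ∩ Metric.ball P ρ) (T ∩ Metric.ball Q ρ) :=
  (Metric.ball_disjoint_ball (by linarith)).mono inter_subset_right inter_subset_right

theorem sideOf_inter_disjoint {P v w : Plane} (ρ : ℝ)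
    (hind : ∀ x y : ℝ, x • v + y • w = 0 → x = 0 ∧ y = 0) :
    Disjoint (sideOf P v w 1 ∩ Metric.ball P ρ) (sideOf P v w (-1) ∩ Metric.ball P ρ) :=
  (disjoint_sideOf hind 1).mono inter_subset_left inter_subset_left

/-! ### Removing crossings: bigons and loops -/

/-- If an overpass and an underpass cross twice, there is a diagram of the same knot with fewer
crossings. -/
theorem exists_c_lt_of_bigon {t₁ t₂ u₁ u₂ : ℝ} (h1 : t₁ < t₂) (h2 : t₂ < u₁) (h3 : u₁ < u₂)
    (h4 : u₂ < t₁ + D.size) (hover : ∀ t ∈ Icc t₁ t₂, ¬ D.IsUnder t)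
    (hunder : ∀ t ∈ Icc u₁ u₂, ¬ D.IsOver t)
    (hcr : (D.param t₁).1 = (D.param u₁).1 ∧ (D.param t₂).1 = (D.param u₂).1 ∨
      (D.param t₁).1 = (D.param u₂).1 ∧ (D.param t₂).1 = (D.param u₁).1) :
    ∃ D' : KnotDiagram, D'.knot = D.knot ∧ D'.c < D.c := by
  have hn := D.size_pos_real
  obtain ⟨η₁, hη₁, iso₁⟩ := D.exists_isolated t₁
  obtain ⟨η₂, hη₂, iso₂⟩ := D.exists_isolated t₂
  obtain ⟨η₃, hη₃, iso₃⟩ := D.exists_isolated u₁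
  obtain ⟨η₄, hη₄, iso₄⟩ := D.exists_isolated u₂
  -- What is common to the two ways in which the arcs can pass the two crossings. A gate of half
  -- width `δ` with a collar of length `3 * δ` needs `4 * δ` on one side of a crossing parameter, so
  -- gaps larger than `8 * δ` suffice.
  have main : ∀ δ, 0 < δ → 8 * δ < η₁ → 8 * δ < η₂ → 8 * δ < η₃ → 8 * δ < η₄ → 8 * δ < t₂ - t₁ →
      8 * δ < u₁ - t₂ → 8 * δ < u₂ - u₁ → 8 * δ < t₁ + D.size - u₂ → ∀ q k : ℝ, k ≠ 0 →
      (∀ t ∈ Icc (t₁ + δ) (t₂ - δ), q + k * t ∈ Icc (u₁ + δ) (u₂ - δ)) →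
      (∀ t ∈ Icc (u₁ + δ) (u₂ - δ), (t - q) / k ∈ Icc (t₁ + δ) (t₂ - δ)) →
      (∀ t, t = t₁ + δ ∨ t = t₂ - δ → q + k * t = u₁ + δ ∨ q + k * t = u₂ - δ) →
      (∀ t, t = u₁ + δ ∨ t = u₂ - δ → (t - q) / k = t₁ + δ ∨ (t - q) / k = t₂ - δ) →
      ∀ (e₁ e₂ e₃ e₄ : ℝ → Plane) (S₁ S₂ S₃ S₄ : Set Plane),
      D.IsGate (t₁ - δ) (t₁ + δ) (D.param (t₁ - δ)).1 (D.param (q + k * (t₁ + δ))).1 S₁ e₁ →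
      D.IsGate (t₂ - δ) (t₂ + δ) (D.param (q + k * (t₂ - δ))).1 (D.param (t₂ + δ)).1 S₂ e₂ →
      D.IsGate (u₁ - δ) (u₁ + δ) (D.param (u₁ - δ)).1 (D.param ((u₁ + δ - q) / k)).1 S₃ e₃ →
      D.IsGate (u₂ - δ) (u₂ + δ) (D.param ((u₂ - δ - q) / k)).1 (D.param (u₂ + δ)).1 S₄ e₄ →
      Disjoint S₁ S₂ → Disjoint S₁ S₃ → Disjoint S₁ S₄ → Disjoint S₂ S₃ → Disjoint S₂ S₄ →
      Disjoint S₃ S₄ → ∃ D' : KnotDiagram, D'.knot = D.knot ∧ D'.c < D.c := by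
    intro δ hδ k1 k2 k3 k4 k5 k6 k7 k8 q k hk hθ hθ' hr hr' e₁ e₂ e₃ e₄ S₁ S₂ S₃ S₄ g₁ g₂ g₃ g₄
      s12 s13 s14 s23 s24 s34
    have n1 : ∀ t, t ≠ t₁ → t₁ - 8 * δ ≤ t → t ≤ t₁ + 8 * δ → _ := fun t h h' h'' =>
      iso₁ t h (abs_lt.2 ⟨by linarith, by linarith⟩)
    have n2 : ∀ t, t ≠ t₂ → t₂ - 8 * δ ≤ t → t ≤ t₂ + 8 * δ → _ := fun t h h' h'' =>
      iso₂ t h (abs_lt.2 ⟨by linarith, by linarith⟩)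
    have n3 : ∀ t, t ≠ u₁ → u₁ - 8 * δ ≤ t → t ≤ u₁ + 8 * δ → _ := fun t h h' h'' =>
      iso₃ t h (abs_lt.2 ⟨by linarith, by linarith⟩)
    have n4 : ∀ t, t ≠ u₂ → u₂ - 8 * δ ≤ t → t ≤ u₂ + 8 * δ → _ := fun t h h' h'' =>
      iso₄ t h (abs_lt.2 ⟨by linarith, by linarith⟩)
    have hm : (D.param t₁).1 ∈ D.multiplePoints := by
      rcases hcr with ⟨h, -⟩ | ⟨h, -⟩
      · exact D.mem_multiplePoints_of_proj_eq (by linarith) (by linarith) (by linarith) h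
      · exact D.mem_multiplePoints_of_proj_eq (by linarith) (by linarith) (by linarith) h
    refine D.exists_c_lt_of_gates (ζ := δ) hδ (by linarith) (by linarith) (by linarith)
      (by linarith) ?_ ?_ ?_ hk hθ hθ' ?_ ?_ g₁ g₂ g₃ g₄ s12 s13 s14 s23 s24 s34 hm ?_
    · intro t ht hu
      rcases lt_or_ge t t₁ with h | h
      · exact (n1 t h.ne (by linarith [ht.1]) (by linarith)).1 hu.mem_multiplePoints
      rcases lt_or_ge t₂ t with h' | h'
      · exact (n2 t h'.ne' (by linarith) (by linarith [ht.2])).1 hu.mem_multiplePoints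
      · exact hover t ⟨h, h'⟩ hu
    · intro t ht hu
      rcases lt_or_ge t u₁ with h | h
      · exact (n3 t h.ne (by linarith [ht.1]) (by linarith)).1 hu.mem_multiplePoints
      rcases lt_or_ge u₂ t with h' | h'
      · exact (n4 t h'.ne' (by linarith) (by linarith [ht.2])).1 hu.mem_multiplePoints
      · exact hunder t ⟨h, h'⟩ hu
    · rintro t (h | h | h | h)
      · exact n1 t (by linarith [h.2]) (by linarith [h.1]) (by linarith [h.2])
      · exact n2 t (by linarith [h.1]) (by linarith [h.1]) (by linarith [h.2])
      · exact n3 t (by linarith [h.2]) (by linarith [h.1]) (by linarith [h.2])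
      · exact n4 t (by linarith [h.1]) (by linarith [h.1]) (by linarith [h.2])
    · intro t ht
      rcases hr t ht with h | h <;> rw [h]
      · exact (n3 _ (by linarith) (by linarith) (by linarith)).1
      · exact (n4 _ (by linarith) (by linarith) (by linarith)).1
    · intro t ht
      rcases hr' t ht with h | h <;> rw [h]
      · exact (n1 _ (by linarith) (by linarith) (by linarith)).1
      · exact (n2 _ (by linarith) (by linarith) (by linarith)).1
    · intro t ht htx
      have hw : ∀ {s}, t₁ ≤ s → s ≤ u₂ →
          s ∈ Ico (t₁ - δ - 2 * δ) (t₁ - δ - 2 * δ + D.size) := fun h h' =>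
        ⟨by linarith, by linarith⟩
      rcases hcr with ⟨h, -⟩ | ⟨h, -⟩
      · rcases D.eq_or_eq_of_proj_eq (hw le_rfl (by linarith)) (hw (by linarith) h3.le) ht
          (by linarith) h (htx.trans h) with h' | h' <;> subst h'
        · exact .inl ⟨by linarith, by linarith⟩
        · exact .inr (.inr (.inl ⟨by linarith, by linarith⟩))
      · rcases D.eq_or_eq_of_proj_eq (hw le_rfl (by linarith)) (hw (by linarith) le_rfl) ht
          (by linarith) h (htx.trans h) with h' | h' <;> subst h'
        · exact .inl ⟨by linarith, by linarith⟩
        · exact .inr (.inr (.inr ⟨by linarith, by linarith⟩))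
  -- Both points lie on the overpass, so over the same place each would be at least as high as the
  -- other.
  have hne : (D.param t₁).1 ≠ (D.param t₂).1 := by
    intro h
    have a1 := le_of_not_isUnder (hover t₁ ⟨le_rfl, h1.le⟩) t₂ h.symm
    have a2 := le_of_not_isUnder (hover t₂ ⟨h1.le, le_rfl⟩) t₁ h
    have := D.isClosedCurve_param.eq_of_abs_lt (Prod.ext h (le_antisymm a2 a1)) (by linarith)
      (by linarith)
    linarith
  -- Balls of this radius about the two crossings are disjoint; the two gates at the same crossing
  -- will lie on opposite sides of the upper strand.
  set ρ := dist (D.param t₁).1 (D.param t₂).1 / 2 with hρd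
  have hρ : 0 < ρ := half_pos (dist_pos.2 hne)
  have hρ2 : 2 * ρ ≤ dist (D.param t₁).1 (D.param t₂).1 := by linarith
  have hρ2' : 2 * ρ ≤ dist (D.param t₂).1 (D.param t₁).1 := by rwa [dist_comm]
  rcases hcr with ⟨hp, hq⟩ | ⟨hp, hq⟩
  -- Arcs in the same direction, with `v` along the upper and `w` along the lower strand. At each
  -- crossing one gate leads from the incoming upper strand to the outgoing lower one, the other
  -- from the incoming lower to the outgoing upper.
  · obtain ⟨ε, hε, v, w, hind, sv, sw, hnorm, hav⟩ :=
      D.exists_crossing_chart (by linarith) (by linarith) hp hρ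
    obtain ⟨ε', hε', v', w', hind', sv', sw', hnorm', hav'⟩ :=
      D.exists_crossing_chart (by linarith) (by linarith) hq hρ
    obtain ⟨δ, hδ, hlt⟩ := exists_between (a₁ := (0 : ℝ)) (a₂ := min (min (min (min η₁ η₂)
      (min η₃ η₄)) (min (min (t₂ - t₁) (u₁ - t₂)) (min (u₂ - u₁) (t₁ + D.size - u₂))))
      (min ε ε') / 8)
      (div_pos (by simp only [lt_min_iff]; refine ⟨⟨⟨⟨?_, ?_⟩, ?_, ?_⟩, ⟨?_, ?_⟩, ?_, ?_⟩, ?_, ?_⟩ <;> linarith) (by norm_num))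
    rw [lt_div_iff₀ (by norm_num)] at hlt
    simp only [lt_min_iff] at hlt
    obtain ⟨⟨⟨⟨m1, m2⟩, m3, m4⟩, ⟨m5, m6⟩, m7, m8⟩, m9, m10⟩ := hlt
    have d1 : |δ| < ε := by rw [abs_of_pos hδ]; linarith
    have d2 : |-δ| < ε := by rwa [abs_neg]
    have d1' : |δ| < ε' := by rw [abs_of_pos hδ]; linarith
    have d2' : |-δ| < ε' := by rwa [abs_neg]
    obtain ⟨q, k, hk, b1, b2, b3, b4, b5, b6⟩ := exists_affine_increasing
      (a := t₁ + δ) (b := t₂ - δ) (c := u₁ + δ) (d := u₂ - δ) (by linarith) (by linarith)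
    obtain ⟨e₁, g₁⟩ := (exists_corner_gate (D := D) (l := t₁ - δ) (r := t₁ + δ) (κ := 1)
      (by linarith) d2 d1 (by linarith) (by linarith) hind hnorm hav).1
    obtain ⟨e₂, g₂⟩ := (exists_corner_gate (D := D) (l := t₂ - δ) (r := t₂ + δ) (κ := -1)
      (by linarith) d1' d2' (by linarith) (by linarith) hind' hnorm' hav').2
    obtain ⟨e₃, g₃⟩ := (exists_corner_gate (D := D) (l := u₁ - δ) (r := u₁ + δ) (κ := -1)
      (by linarith) d1 d2 (by linarith) (by linarith) hind hnorm hav).2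
    obtain ⟨e₄, g₄⟩ := (exists_corner_gate (D := D) (l := u₂ - δ) (r := u₂ + δ) (κ := 1)
      (by linarith) d2' d1' (by linarith) (by linarith) hind' hnorm' hav').1
    rw [← sv _ d2, ← sw _ d1, ← sub_eq_add_neg] at g₁
    rw [← sv' _ d1', ← sw' _ d2', ← sub_eq_add_neg] at g₂
    rw [← sv _ d1, ← sw _ d2, ← sub_eq_add_neg] at g₃
    rw [← sv' _ d2', ← sw' _ d1', ← sub_eq_add_neg] at g₄
    refine main δ hδ (by linarith) (by linarith) (by linarith) (by linarith) (by linarith)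
      (by linarith) (by linarith) (by linarith) q k hk b5 b6 ?_ ?_ e₁ e₂ e₃ e₄ _ _ _ _
      (by rwa [b1]) (by rwa [b2]) (by rwa [b3]) (by rwa [b4])
      (ball_inter_disjoint hρ2 _ _) (sideOf_inter_disjoint ρ hind) (ball_inter_disjoint hρ2 _ _)
      (ball_inter_disjoint hρ2' _ _) (sideOf_inter_disjoint ρ hind').symm
      (ball_inter_disjoint hρ2 _ _)
    · rintro t (rfl | rfl)
      · exact .inl b1
      · exact .inr b2
    · rintro t (rfl | rfl)
      · exact .inl b3
      · exact .inr b4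
  -- Arcs in opposite directions, so each is traversed backwards in its new place. At each crossing
  -- one gate joins the two incoming strands and the other the two outgoing ones; gates 1 and 4
  -- share a crossing, and so do 2 and 3.
  · obtain ⟨ε, hε, v, w, hind, sv, sw, hnorm, hav⟩ :=
      D.exists_crossing_chart (by linarith) (by linarith) hp hρ
    obtain ⟨ε', hε', v', w', hind', sv', sw', hnorm', hav'⟩ :=
      D.exists_crossing_chart (by linarith) (by linarith) hq hρ
    obtain ⟨δ, hδ, hlt⟩ := exists_between (a₁ := (0 : ℝ)) (a₂ := min (min (min (min η₁ η₂)
      (min η₃ η₄)) (min (min (t₂ - t₁) (u₁ - t₂)) (min (u₂ - u₁) (t₁ + D.size - u₂))))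
      (min ε ε') / 8)
      (div_pos (by simp only [lt_min_iff]; refine ⟨⟨⟨⟨?_, ?_⟩, ?_, ?_⟩, ⟨?_, ?_⟩, ?_, ?_⟩, ?_, ?_⟩ <;> linarith) (by norm_num))
    rw [lt_div_iff₀ (by norm_num)] at hlt
    simp only [lt_min_iff] at hlt
    obtain ⟨⟨⟨⟨m1, m2⟩, m3, m4⟩, ⟨m5, m6⟩, m7, m8⟩, m9, m10⟩ := hlt
    have d1 : |δ| < ε := by rw [abs_of_pos hδ]; linarith
    have d2 : |-δ| < ε := by rwa [abs_neg]
    have d1' : |δ| < ε' := by rw [abs_of_pos hδ]; linarith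
    have d2' : |-δ| < ε' := by rwa [abs_neg]
    obtain ⟨q, k, hk, b1, b2, b3, b4, b5, b6⟩ := exists_affine_decreasing
      (a := t₁ + δ) (b := t₂ - δ) (c := u₁ + δ) (d := u₂ - δ) (by linarith) (by linarith)
    obtain ⟨e₁, g₁⟩ := (exists_corner_gate (D := D) (l := t₁ - δ) (r := t₁ + δ) (κ := -1)
      (by linarith) d2 d2 (by linarith) (by linarith) hind hnorm hav).1
    obtain ⟨e₂, g₂⟩ := (exists_corner_gate (D := D) (l := t₂ - δ) (r := t₂ + δ) (κ := 1)
      (by linarith) d1' d1' (by linarith) (by linarith) hind' hnorm' hav').2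
    obtain ⟨e₃, g₃⟩ := (exists_corner_gate (D := D) (l := u₁ - δ) (r := u₁ + δ) (κ := -1)
      (by linarith) d2' d2' (by linarith) (by linarith) hind' hnorm' hav').2
    obtain ⟨e₄, g₄⟩ := (exists_corner_gate (D := D) (l := u₂ - δ) (r := u₂ + δ) (κ := 1)
      (by linarith) d1 d1 (by linarith) (by linarith) hind hnorm hav).1
    rw [← sv _ d2, ← sw _ d2, ← sub_eq_add_neg, ← sub_eq_add_neg] at g₁
    rw [← sv' _ d1', ← sw' _ d1'] at g₂
    rw [← sv' _ d2', ← sw' _ d2', ← sub_eq_add_neg, ← sub_eq_add_neg] at g₃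
    rw [← sv _ d1, ← sw _ d1] at g₄
    refine main δ hδ (by linarith) (by linarith) (by linarith) (by linarith) (by linarith)
      (by linarith) (by linarith) (by linarith) q k hk b5 b6 ?_ ?_ e₁ e₂ e₃ e₄ _ _ _ _
      (by rwa [b1]) (by rwa [b2]) (by rwa [b3]) (by rwa [b4])
      (ball_inter_disjoint hρ2 _ _) (ball_inter_disjoint hρ2 _ _)
      (sideOf_inter_disjoint ρ hind).symm (sideOf_inter_disjoint ρ hind')
      (ball_inter_disjoint hρ2' _ _) (ball_inter_disjoint hρ2' _ _)
    · rintro t (rfl | rfl)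
      · exact .inr b1
      · exact .inl b2
    · rintro t (rfl | rfl)
      · exact .inr b3
      · exact .inl b4

/-- If an overpass crosses the following underpass, there is a diagram of the same knot with fewer
crossings. -/
theorem exists_c_lt_of_loop {t f u : ℝ} (h1 : t < f) (h2 : f < u) (h3 : u < t + D.size)
    (hover : ∀ s ∈ Icc t f, ¬ D.IsUnder s) (hunder : ∀ s ∈ Icc f u, ¬ D.IsOver s)
    (hcr : (D.param t).1 = (D.param u).1) :
    ∃ D' : KnotDiagram, D'.knot = D.knot ∧ D'.c < D.c := by
  have hn := D.size_pos_real
  -- move `f` off the vertices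
  obtain ⟨f, h1, h2, hover, hunder, hfm, hfv⟩ : ∃ f', t < f' ∧ f' < u ∧
      (∀ s ∈ Icc t f', ¬ D.IsUnder s) ∧ (∀ s ∈ Icc f' u, ¬ D.IsOver s) ∧
      (D.param f').1 ∉ D.multiplePoints ∧ ∀ i : ℤ, f' ≠ i := by
    obtain ⟨η, hη, iso⟩ := D.exists_isolated f
    obtain ⟨f', hf', hlt⟩ := exists_between (a₁ := f) (a₂ := min (f + η) u)
      (lt_min (by linarith) h2)
    rw [lt_min_iff] at hlt
    have hi : ∀ s, f < s → s ≤ f' → _ := fun s hs hs' =>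
      iso s hs.ne' (abs_lt.2 ⟨by linarith, by linarith⟩)
    refine ⟨f', by linarith, hlt.2, fun s hs hus => ?_, fun s hs => ?_, hi f' hf' le_rfl⟩
    · rcases le_or_gt s f with h | h
      · exact hover s ⟨hs.1, h⟩ hus
      · exact (hi s h hs.2).1 hus.mem_multiplePoints
    · exact hunder s ⟨by linarith [hs.1], hs.2⟩
  have hm := D.mem_multiplePoints_of_proj_eq (s := t) (t := u) (by linarith) (by linarith)
    (by linarith) hcr
  have hne : (D.param t).1 ≠ (D.param f).1 := fun h => hfm (h ▸ hm)
  obtain ⟨η₁, hη₁, iso₁⟩ := D.exists_isolated t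
  obtain ⟨η₂, hη₂, iso₂⟩ := D.exists_isolated f
  obtain ⟨η₃, hη₃, iso₃⟩ := D.exists_isolated u
  set ρ := dist (D.param t).1 (D.param f).1 / 2 with hρd
  have hρ : 0 < ρ := half_pos (dist_pos.2 hne)
  have hρ2 : 2 * ρ ≤ dist (D.param t).1 (D.param f).1 := by linarith
  have hρ2' : 2 * ρ ≤ dist (D.param f).1 (D.param t).1 := by rwa [dist_comm]
  obtain ⟨ε, hε, v, w, hind, sv, sw, hnorm, hav⟩ :=
    D.exists_crossing_chart (by linarith) (by linarith) hcr hρ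
  obtain ⟨ε', hε', v', w', hind', sv', hnorm', hav'⟩ := D.exists_regular_chart hfm hfv hρ
  obtain ⟨δ, hδ, hlt⟩ := exists_between (a₁ := (0 : ℝ)) (a₂ := min (min (min η₁ η₂) η₃)
    (min (min (f - t) (u - f)) (min (t + D.size - u) (min ε ε'))) / 8)
    (div_pos (by
      simp only [lt_min_iff]
      refine ⟨⟨⟨?_, ?_⟩, ?_⟩, ⟨?_, ?_⟩, ?_, ?_, ?_⟩ <;> linarith) (by norm_num))
  rw [lt_div_iff₀ (by norm_num)] at hlt
  simp only [lt_min_iff] at hlt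
  obtain ⟨⟨⟨m1, m2⟩, m3⟩, ⟨m4, m5⟩, m6, m7, m8⟩ := hlt
  have d1 : |δ| < ε := by rw [abs_of_pos hδ]; linarith
  have d2 : |-δ| < ε := by rwa [abs_neg]
  have d5 : |5 * δ| < ε' := by rw [abs_of_pos (by linarith)]; linarith
  have d4 : |4 * δ| < ε' := by rw [abs_of_pos (by linarith)]; linarith
  have d5' : |-(5 * δ)| < ε' := by rwa [abs_neg]
  have d4' : |-(4 * δ)| < ε' := by rwa [abs_neg]
  have n1 : ∀ s, s ≠ t → t - 8 * δ ≤ s → s ≤ t + 8 * δ → _ := fun s h h' h'' =>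
    iso₁ s h (abs_lt.2 ⟨by linarith, by linarith⟩)
  have n2 : ∀ s, s ≠ f → f - 8 * δ ≤ s → s ≤ f + 8 * δ → _ := fun s h h' h'' =>
    iso₂ s h (abs_lt.2 ⟨by linarith, by linarith⟩)
  have n3 : ∀ s, s ≠ u → u - 8 * δ ≤ s → s ≤ u + 8 * δ → _ := fun s h h' h'' =>
    iso₃ s h (abs_lt.2 ⟨by linarith, by linarith⟩)
  -- The loop is run through backwards except for `[f - 4 * δ, f + 4 * δ]`, which stays. One gate
  -- turns from the position `f + 5 * δ` to `f - 4 * δ`, the other, on the opposite side, from `f +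
  -- 4 * δ` to `f - 5 * δ`. The part kept in between has room for the two collars, which end at `f -
  -- δ` and begin at `f + δ`.
  obtain ⟨q, k, hk, b1, b2, b3, b4, b5, b6⟩ := exists_affine_decreasing
    (a := t + δ) (b := f - 5 * δ) (c := f + 5 * δ) (d := u - δ) (by linarith) (by linarith)
  obtain ⟨e₁, g₁⟩ := (exists_corner_gate (D := D) (l := t - δ) (r := t + δ) (κ := -1)
    (by linarith) d2 d2 (by linarith) (by linarith) hind hnorm hav).1
  obtain ⟨e₄, g₄⟩ := (exists_corner_gate (D := D) (l := u - δ) (r := u + δ) (κ := 1)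
    (by linarith) d1 d1 (by linarith) (by linarith) hind hnorm hav).1
  obtain ⟨e₂, g₂⟩ := exists_turning_gate (D := D) (l := f - 5 * δ) (r := f - 4 * δ) (κ := 1)
    (by linarith) d5 d4' (by linarith) (by linarith) (by simp) hind' hnorm' hav'
  obtain ⟨e₃, g₃⟩ := exists_turning_gate (D := D) (l := f + 4 * δ) (r := f + 5 * δ) (κ := -1)
    (by linarith) d4 d5' (by linarith) (by linarith) (by simp) hind' hnorm' hav'
  rw [← sv _ d2, ← sw _ d2, ← sub_eq_add_neg, ← sub_eq_add_neg] at g₁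
  rw [← sv _ d1, ← sw _ d1] at g₄
  rw [← sv' _ d5, ← sv' _ d4', ← sub_eq_add_neg] at g₂
  rw [← sv' _ d4, ← sv' _ d5', ← sub_eq_add_neg] at g₃
  refine D.exists_c_lt_of_gates (l₁ := t - δ) (r₁ := t + δ) (l₂ := f - 5 * δ) (r₂ := f - 4 * δ)
    (l₃ := f + 4 * δ) (r₃ := f + 5 * δ) (l₄ := u - δ) (r₄ := u + δ) (ζ := δ) (q := q) (k := k) hδ (by linarith) (by linarith)
    (by linarith) (by linarith) ?_ ?_ ?_ hk b5 b6 ?_ ?_ (by rwa [b1]) (by rwa [b2]) (by rwa [b3])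
    (by rwa [b4]) (ball_inter_disjoint hρ2 _ _) (ball_inter_disjoint hρ2 _ _)
    (sideOf_inter_disjoint ρ hind).symm (sideOf_inter_disjoint ρ hind')
    (ball_inter_disjoint hρ2' _ _) (ball_inter_disjoint hρ2' _ _) hm ?_
  · intro s hs hus
    rcases lt_or_ge s t with h | h
    · exact (n1 s h.ne (by linarith [hs.1]) (by linarith)).1 hus.mem_multiplePoints
    · exact hover s ⟨h, by linarith [hs.2]⟩ hus
  · intro s hs hus
    rcases lt_or_ge u s with h | h
    · exact (n3 s h.ne' (by linarith) (by linarith [hs.2])).1 hus.mem_multiplePoints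
    · exact hunder s ⟨by linarith [hs.1], h⟩ hus
  · rintro s (h | h | h | h)
    · exact n1 s (by linarith [h.2]) (by linarith [h.1]) (by linarith [h.2])
    · exact n2 s (by linarith [h.2]) (by linarith [h.1]) (by linarith [h.2])
    · exact n2 s (by linarith [h.1]) (by linarith [h.1]) (by linarith [h.2])
    · exact n3 s (by linarith [h.1]) (by linarith [h.1]) (by linarith [h.2])
  · rintro s (rfl | rfl)
    · rw [b1]
      exact (n3 _ (by linarith) (by linarith) (by linarith)).1
    · rw [b2]
      exact (n2 _ (by linarith) (by linarith) (by linarith)).1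
  · rintro s (rfl | rfl)
    · rw [b3]
      exact (n2 _ (by linarith) (by linarith) (by linarith)).1
    · rw [b4]
      exact (n1 _ (by linarith) (by linarith) (by linarith)).1
  · intro s hs hsx
    rcases D.eq_or_eq_of_proj_eq (W := t - δ - 2 * δ) (s := t) (t := u)
      ⟨by linarith, by linarith⟩ ⟨by linarith, by linarith⟩ hs
      (by linarith) hcr (hsx.trans hcr) with h' | h' <;> subst h'
    · exact .inl ⟨by linarith, by linarith⟩
    · exact .inr (.inr (.inr ⟨by linarith, by linarith⟩))

end KnotDiagram

/-! ### Mirror images -/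

/-- The mirror image of a polygonal knot in the projection plane. -/
def PolygonalKnot.mirror (K : PolygonalKnot) : PolygonalKnot where
  size := K.size
  size_pos := K.size_pos
  vertex i := reflectZ (K.vertex i)
  closed i := by rw [K.closed]
  simple := by
    have h : ∀ t, polygonalPath (fun i => reflectZ (K.vertex i)) t =
        reflectZ (polygonalPath K.vertex t) := fun t => by
      refine Prod.ext rfl ?_
      change (1 - Int.fract t) * -(K.vertex ⌊t⌋).2 + Int.fract t * -(K.vertex (⌊t⌋ + 1)).2 =
        -((1 - Int.fract t) * (K.vertex ⌊t⌋).2 + Int.fract t * (K.vertex (⌊t⌋ + 1)).2)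
      ring
    intro s t hst
    rw [h, h] at hst
    exact K.simple s t (reflectZ.injective hst)

theorem PolygonalKnot.mirror_param (K : PolygonalKnot) (t : ℝ) :
    K.mirror.param t = ((K.param t).1, -(K.param t).2) := by
  refine Prod.ext rfl ?_
  change (1 - Int.fract t) * -(K.vertex ⌊t⌋).2 + Int.fract t * -(K.vertex (⌊t⌋ + 1)).2 =
    -((1 - Int.fract t) * (K.vertex ⌊t⌋).2 + Int.fract t * (K.vertex (⌊t⌋ + 1)).2)
  ring

theorem PolygonalKnot.mem_points_mirror (K : PolygonalKnot) {P : Space} :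
    P ∈ K.mirror.points ↔ reflectZ P ∈ K.points := by
  constructor
  · rintro ⟨t, rfl⟩
    exact ⟨t, by rw [mirror_param, reflectZ_apply, neg_neg]⟩
  · rintro ⟨t, ht⟩
    refine ⟨t, ?_⟩
    rw [mirror_param, ht]
    exact Prod.ext rfl (neg_neg _)

theorem PolygonalKnot.mirror_multiplePoints (K : PolygonalKnot) :
    K.mirror.multiplePoints = K.multiplePoints := by
  have key : ∀ K : PolygonalKnot, K.mirror.multiplePoints ⊆ K.multiplePoints := by
    rintro K x ⟨P, hP, Q, hQ, hPQ, h1, h2⟩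
    exact ⟨reflectZ P, K.mem_points_mirror.1 hP, reflectZ Q, K.mem_points_mirror.1 hQ,
      fun h => hPQ (reflectZ.injective h), h1, h2⟩
  refine (key K).antisymm ?_
  rintro x ⟨P, hP, Q, hQ, hPQ, h1, h2⟩
  have hr : ∀ P : Space, reflectZ (reflectZ P) = P := fun P => Prod.ext rfl (neg_neg _)
  exact ⟨reflectZ P, K.mem_points_mirror.2 (by rwa [hr]), reflectZ Q,
    K.mem_points_mirror.2 (by rwa [hr]), fun h => hPQ (reflectZ.injective h), h1, h2⟩

theorem PolygonalKnot.Isotopic.mirror_left {K L : PolygonalKnot} (h : K.Isotopic L.mirror) :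
    K.mirror.Isotopic L := by
  obtain ⟨H, hc, h0, φ, hφ⟩ := h
  obtain ⟨H', hc', h0', h1'⟩ := IsotopicToId.conj ⟨H, hc, h0, rfl⟩ reflectZ
  refine ⟨H', hc', h0', φ, fun t => ?_⟩
  rw [h1', K.mirror_param]
  simp only [Homeomorph.trans_apply, reflectZ_apply, neg_neg]
  rw [hφ, L.mirror_param, reflectZ_symm_apply, neg_neg]

namespace KnotDiagram

/-- The mirror image of a diagram. -/
def mirror (D : KnotDiagram) : KnotDiagram where
  toPolygonalKnot := D.toPolygonalKnot.mirror
  finite_multiplePoints := by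
    rw [PolygonalKnot.mirror_multiplePoints]
    exact D.finite_multiplePoints
  double P hP Q hQ R hR h1 h2 := by
    rw [PolygonalKnot.mem_points_mirror] at hP hQ hR
    rcases D.double _ hP _ hQ _ hR h1 h2 with h | h | h
    · exact Or.inl (reflectZ.injective h)
    · exact Or.inr (Or.inl (reflectZ.injective h))
    · exact Or.inr (Or.inr (reflectZ.injective h))
  vertex_notMem i := by
    rw [PolygonalKnot.mirror_multiplePoints]
    exact D.vertex_notMem i

variable {D : KnotDiagram}

theorem mirror_c : D.mirror.c = D.c := by
  rw [c, c]
  exact congrArg Set.ncard D.toPolygonalKnot.mirror_multiplePoints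

theorem mirror_param (t : ℝ) : D.mirror.param t = ((D.param t).1, -(D.param t).2) :=
  D.toPolygonalKnot.mirror_param t

theorem isUnder_iff {t : ℝ} :
    D.IsUnder t ↔ ∃ s, (D.param s).1 = (D.param t).1 ∧ (D.param t).2 < (D.param s).2 := by
  constructor
  · rintro ⟨_, ⟨s, rfl⟩, h⟩
    exact ⟨s, h⟩
  · rintro ⟨s, h⟩
    exact ⟨_, ⟨s, rfl⟩, h⟩

theorem isOver_iff {t : ℝ} :
    D.IsOver t ↔ ∃ s, (D.param s).1 = (D.param t).1 ∧ (D.param s).2 < (D.param t).2 := by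
  constructor
  · rintro ⟨_, ⟨s, rfl⟩, h⟩
    exact ⟨s, h⟩
  · rintro ⟨s, h⟩
    exact ⟨_, ⟨s, rfl⟩, h⟩

theorem mirror_isUnder {t : ℝ} : D.mirror.IsUnder t ↔ D.IsOver t := by
  simp only [isUnder_iff, isOver_iff, mirror_param, neg_lt_neg_iff]

theorem mirror_isOver {t : ℝ} : D.mirror.IsOver t ↔ D.IsUnder t := by
  simp only [isUnder_iff, isOver_iff, mirror_param, neg_lt_neg_iff]

/-- If an underpass crosses the following overpass, there is a diagram of the same knot with fewer
crossings. -/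
theorem exists_c_lt_of_loop' {t f u : ℝ} (h1 : t < f) (h2 : f < u) (h3 : u < t + D.size)
    (hunder : ∀ s ∈ Icc t f, ¬ D.IsOver s) (hover : ∀ s ∈ Icc f u, ¬ D.IsUnder s)
    (hcr : (D.param t).1 = (D.param u).1) :
    ∃ D' : KnotDiagram, D'.knot = D.knot ∧ D'.c < D.c := by
  obtain ⟨D', hk, hc⟩ := exists_c_lt_of_loop (D := D.mirror) h1 h2 h3
    (fun s hs => mirror_isUnder.not.2 (hunder s hs)) (fun s hs => mirror_isOver.not.2 (hover s hs))
    (by simpa only [mirror_param] using hcr)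
  refine ⟨D'.mirror, ?_, by rwa [mirror_c, ← mirror_c (D := D)]⟩
  have : D'.toPolygonalKnot.Isotopic D.toPolygonalKnot.mirror := Quotient.exact hk
  exact Quotient.sound this.mirror_left

/-! ### Over- and underpasses -/

theorem isOver_add_size {t : ℝ} : D.IsOver (t + D.size) ↔ D.IsOver t := by
  simp only [isOver_iff, D.isClosedCurve_param.periodic]

theorem isUnder_add_size {t : ℝ} : D.IsUnder (t + D.size) ↔ D.IsUnder t := by
  simp only [isUnder_iff, D.isClosedCurve_param.periodic]

theorem not_isOver_and_isUnder {t : ℝ} : ¬ (D.IsOver t ∧ D.IsUnder t) := by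
  rintro ⟨⟨P, hP, h1, h2⟩, Q, hQ, h3, h4⟩
  rcases D.double P hP _ (mem_range_self t) Q hQ h1 h3.symm with h | h | h
  · rw [h] at h2; exact lt_irrefl _ h2
  · rw [← h] at h4; exact lt_irrefl _ h4
  · rw [h] at h2; exact lt_asymm h2 h4

end KnotDiagram

/-! ### Existence of over-underpass sequences -/

/-- An interval whose ends are free, which begins with points of `O` and ends with points of `U`,
can be divided into intervals containing alternately only points of `O` and only points of `U`. -/
theorem exists_alternating_division {O U : ℝ → Prop} (hOU : ∀ t, ¬ (O t ∧ U t))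
    (hiso : ∀ x, ∃ ε > 0, ∀ s, s ≠ x → |s - x| < ε → ¬ O s ∧ ¬ U s)
    (hfin : ∀ a b, {t ∈ Icc a b | O t ∨ U t}.Finite) (N : ℕ) (a b : ℝ) (ha : ¬ O a ∧ ¬ U a)
    (hN : {t ∈ Icc a b | O t ∨ U t}.ncard ≤ N)
    (hx : ∃ x ∈ Icc a b, O x ∧ ∀ t ∈ Icc a b, t < x → ¬ U t)
    (hy : ∃ y ∈ Icc a b, U y ∧ ∀ t ∈ Icc a b, y < t → ¬ O t) :
    ∃ (k : ℕ) (s f : ℕ → ℝ), 0 < k ∧ s 0 = a ∧ s k = b ∧ (∀ i < k, s i < f i) ∧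
      (∀ i < k, f i < s (i + 1)) ∧ (∀ i < k, ¬ O (s i) ∧ ¬ U (s i)) ∧
      (∀ i < k, ¬ O (f i) ∧ ¬ U (f i)) ∧
      (∀ i < k, (∃ t ∈ Icc (s i) (f i), O t) ∧ ∀ t ∈ Icc (s i) (f i), ¬ U t) ∧
      ∀ i < k, (∃ t ∈ Icc (f i) (s (i + 1)), U t) ∧ ∀ t ∈ Icc (f i) (s (i + 1)), ¬ O t := by
  induction N generalizing a with
  | zero =>
    obtain ⟨x, hx, hxO, -⟩ := hx
    have h0 := (Set.ncard_eq_zero (hfin a b)).1 (Nat.le_zero.1 hN)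
    have : x ∈ {t ∈ Icc a b | O t ∨ U t} := ⟨hx, Or.inl hxO⟩
    rw [h0] at this
    exact this.elim
  | succ N ih =>
    obtain ⟨x, hx, hxO, hxU⟩ := hx
    obtain ⟨y, hy, hyU, hyO⟩ := hy
    have hmin : ∀ (P : ℝ → Prop) (c : ℝ), (∀ t, P t → O t ∨ U t) → (∃ t ∈ Icc c b, P t) →
        ∃ m ∈ Icc c b, P m ∧ ∀ t ∈ Icc c b, P t → m ≤ t := by
      rintro P c hP ⟨t, ht, htP⟩
      have hf : {t ∈ Icc c b | P t}.Finite := (hfin c b).subset fun t ht => ⟨ht.1, hP t ht.2⟩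
      obtain ⟨m, hm⟩ := hf.exists_minimal ⟨t, ht, htP⟩
      exact ⟨m, hm.1.1, hm.1.2, fun t ht htP => (le_total m t).elim id (hm.2 ⟨ht, htP⟩)⟩
    have hbefore : ∀ c z, c < z → ∃ e, c < e ∧ e < z ∧ ∀ t, e ≤ t → t < z → ¬ O t ∧ ¬ U t := by
      intro c z hcz
      obtain ⟨ε, hε, h⟩ := hiso z
      obtain ⟨e, he, hez⟩ := exists_between (a₁ := max c (z - ε)) (a₂ := z)
        (max_lt hcz (by linarith))
      rw [max_lt_iff] at he
      exact ⟨e, he.1, hez, fun t h1 h2 => h t h2.ne (abs_lt.2 ⟨by linarith, by linarith⟩)⟩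
    -- The first arc ends just before the first point `u` of `U`. If points of `O` follow `u`, the
    -- next arc ends just before the first of them and induction divides the rest, which has lost at
    -- least `x`; otherwise the next arc runs to `b`.
    obtain ⟨u, hu, huU, humin⟩ := hmin U a (fun t => Or.inr) ⟨y, hy, hyU⟩
    have hxu : x < u := by
      rcases lt_trichotomy x u with h | h | h
      · exact h
      · exact (hOU u ⟨h ▸ hxO, huU⟩).elim
      · exact (hxU u hu h huU).elim
    obtain ⟨f₀, hf1, hf2, hf3⟩ := hbefore x u hxu
    have hover : (∃ t ∈ Icc a f₀, O t) ∧ ∀ t ∈ Icc a f₀, ¬ U t :=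
      ⟨⟨x, ⟨hx.1, hf1.le⟩, hxO⟩, fun t ht htU => by
        linarith [humin t ⟨ht.1, by linarith [ht.2, hu.2]⟩ htU, ht.2]⟩
    by_cases hex : ∃ t ∈ Icc u b, O t
    · obtain ⟨x', hx', hx'O, hx'min⟩ := hmin O u (fun t => Or.inl) hex
      have hux' : u < x' := hx'.1.lt_of_ne fun h => hOU u ⟨h ▸ hx'O, huU⟩
      obtain ⟨s₁, hs1, hs2, hs3⟩ := hbefore u x' hux'
      have hyx' : x' ≤ y := by
        by_contra! h
        exact hyO x' ⟨by linarith [hu.1], hx'.2⟩ h hx'O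
      have hlt : {t ∈ Icc s₁ b | O t ∨ U t}.ncard < {t ∈ Icc a b | O t ∨ U t}.ncard := by
        refine Set.ncard_lt_ncard ⟨fun t ht => ⟨⟨?_, ht.1.2⟩, ht.2⟩, fun h => ?_⟩ (hfin a b)
        · linarith [ht.1.1, hu.1]
        · have := (h ⟨hx, Or.inl hxO⟩).1.1
          linarith
      obtain ⟨k, s, f, hk, hs0, hsk, i1, i2, i3, i4, i5, i6⟩ := ih s₁ (hs3 s₁ le_rfl hs2) (by omega)
        ⟨x', ⟨hs2.le, hx'.2⟩, hx'O, fun t ht htx => (hs3 t ht.1 htx).2⟩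
        ⟨y, ⟨by linarith, hy.2⟩, hyU, fun t ht => hyO t ⟨by linarith [ht.1, hu.1], ht.2⟩⟩
      have hcons : ∀ {Q : ℕ → Prop}, Q 0 → (∀ i < k, Q (i + 1)) → ∀ i < k + 1, Q i := by
        intro Q h0 h i hi
        cases i with
        | zero => exact h0
        | succ i => exact h i (by omega)
      refine ⟨k + 1, fun i => Nat.casesOn i a s, fun i => Nat.casesOn i f₀ f, by omega, rfl, hsk,
        hcons (show a < f₀ by linarith [hx.1]) i1, hcons ?_ i2, hcons ha i3,
        hcons (hf3 f₀ le_rfl hf2) i4, hcons hover i5, hcons ?_ i6⟩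
      · change f₀ < s 0
        rw [hs0]
        linarith
      · change (∃ t ∈ Icc f₀ (s 0), U t) ∧ ∀ t ∈ Icc f₀ (s 0), ¬ O t
        rw [hs0]
        refine ⟨⟨u, ⟨hf2.le, hs1.le⟩, huU⟩, fun t ht htO => ?_⟩
        rcases lt_or_ge t u with h | h
        · exact (hf3 t ht.1 h).1 htO
        · linarith [hx'min t ⟨h, by linarith [ht.2, hx'.2]⟩ htO, ht.2]
    · refine ⟨1, fun i => Nat.casesOn i a fun _ => b, fun _ => f₀, one_pos, rfl, rfl, ?_, ?_, ?_, ?_,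
        ?_, ?_⟩ <;> intro i hi <;> obtain rfl : i = 0 := by omega
      · change a < f₀
        linarith [hx.1]
      · change f₀ < b
        linarith [hu.2]
      · exact ha
      · exact hf3 f₀ le_rfl hf2
      · exact hover
      · refine ⟨⟨u, ⟨hf2.le, hu.2⟩, huU⟩, fun t ht htO => ?_⟩
        rcases lt_or_ge t u with h | h
        · exact (hf3 t ht.1 h).1 htO
        · exact hex ⟨t, ⟨h, ht.2⟩, htO⟩

namespace KnotDiagram

variable {D : KnotDiagram}

/-- Over each crossing there are an overcrossing and an undercrossing. -/
theorem exists_over_under {x : Plane} (hx : x ∈ D.multiplePoints) (W : ℝ) :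
    ∃ t ∈ Ico W (W + D.size), ∃ u ∈ Ico W (W + D.size), D.IsOver t ∧ D.IsUnder u ∧
      (D.param t).1 = x ∧ (D.param u).1 = x := by
  obtain ⟨P, ⟨s, hs⟩, Q, ⟨t, ht⟩, hPQ, rfl, hQ⟩ := hx
  obtain ⟨s', hs', m, rfl⟩ := D.isClosedCurve_param.exists_mem_Ico W s
  obtain ⟨t', ht', m', rfl⟩ := D.isClosedCurve_param.exists_mem_Ico W t
  rw [D.isClosedCurve_param.periodic_int] at hs ht
  subst hs ht
  rcases lt_trichotomy (D.param s').2 (D.param t').2 with h | h | h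
  · exact ⟨t', ht', s', hs', isOver_iff.2 ⟨s', hQ.symm, h⟩, isUnder_iff.2 ⟨t', hQ, h⟩, hQ, rfl⟩
  · exact (hPQ (Prod.ext hQ.symm h)).elim
  · exact ⟨s', hs', t', ht', isOver_iff.2 ⟨t', hQ, h⟩, isUnder_iff.2 ⟨s', hQ.symm, h⟩, rfl, hQ⟩

theorem exists_isOverUnderpassSequence (h : D.multiplePoints.Nonempty) :
    ∃ k s f, D.IsOverUnderpassSequence k s f := by
  have hn := D.size_pos_real
  have hiso : ∀ x, ∃ ε > 0, ∀ s, s ≠ x → |s - x| < ε → ¬ D.IsOver s ∧ ¬ D.IsUnder s := by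
    intro x
    obtain ⟨ε, hε, h⟩ := D.exists_isolated x
    exact ⟨ε, hε, fun s hs hsx => ⟨fun h' => (h s hs hsx).1 h'.mem_multiplePoints,
      fun h' => (h s hs hsx).1 h'.mem_multiplePoints⟩⟩
  have hfin : ∀ a b, {t ∈ Icc a b | D.IsOver t ∨ D.IsUnder t}.Finite := fun a b =>
    (D.finite_crossing_params a b).subset fun t ht =>
      ⟨ht.1, ht.2.elim (fun h => h.mem_multiplePoints) fun h => h.mem_multiplePoints⟩
  obtain ⟨x, hx⟩ := h
  -- The knot is cut just before the first overcrossing `m` after an undercrossing `u`. The period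
  -- from there begins with `m`, and since no overcrossing lies between `u` and `m`, none lies after
  -- `u + D.size` in it.
  obtain ⟨-, -, u, -, -, huU, -, -⟩ := exists_over_under hx 0
  obtain ⟨o, ho, -, -, hoO, -⟩ := exists_over_under hx u
  have hf : {t ∈ Icc u (u + D.size) | D.IsOver t}.Finite :=
    (hfin _ _).subset fun t ht => ⟨ht.1, Or.inl ht.2⟩
  obtain ⟨m, hm⟩ := hf.exists_minimal ⟨o, Ico_subset_Icc_self ho, hoO⟩
  have hmin : ∀ t, u ≤ t → t < m → ¬ D.IsOver t := by
    intro t h1 h2 htO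
    exact absurd (hm.2 ⟨⟨h1, h2.le.trans hm.1.1.2⟩, htO⟩ h2.le) (not_le.2 h2)
  have hum : u < m := hm.1.1.1.lt_of_ne fun h => not_isOver_and_isUnder ⟨h ▸ hm.1.2, huU⟩
  obtain ⟨ε, hε, he⟩ := hiso m
  obtain ⟨a, ha, ham⟩ := exists_between (a₁ := max u (m - ε)) (a₂ := m)
    (max_lt hum (by linarith))
  rw [max_lt_iff] at ha
  have hreg : ∀ t, a ≤ t → t < m → ¬ D.IsOver t ∧ ¬ D.IsUnder t := fun t h1 h2 =>
    he t h2.ne (abs_lt.2 ⟨by linarith, by linarith⟩)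
  have hareg := hreg a le_rfl ham
  have hum' := hm.1.1.2
  obtain ⟨k, s, f, hk, hs0, hsk, i1, i2, i3, i4, i5, i6⟩ := exists_alternating_division
    (O := D.IsOver) (U := D.IsUnder) (fun t => not_isOver_and_isUnder) hiso hfin _ a (a + D.size)
    hareg le_rfl
    ⟨m, ⟨ham.le, by linarith⟩, hm.1.2, fun t ht htm => (hreg t ht.1 htm).2⟩
    ⟨u + D.size, ⟨by linarith, by linarith⟩, isUnder_add_size.2 huU, fun t ht hut htO => by
      have : D.IsOver (t - D.size) := by rwa [← isOver_add_size, sub_add_cancel]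
      exact hmin (t - D.size) (by linarith) (by linarith [ht.2]) this⟩
  exact ⟨k, s, f, hk, i1, i2, by rw [hsk, hs0], i3, i4, i5, i6⟩

/-! ### Counting crossings by their overpass and underpass -/

namespace IsOverUnderpassSequence

variable {k : ℕ} {s f : ℕ → ℝ}

theorem start_mono (h : D.IsOverUnderpassSequence k s f) {i j : ℕ} (hij : i ≤ j) (hj : j ≤ k) :
    s i ≤ s j := by
  induction j, hij using Nat.le_induction with
  | base => exact le_rfl
  | succ j hij ih =>
    have h1 := h.lt_left j (by omega)
    have h2 := h.lt_right j (by omega)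
    linarith [ih (by omega)]

theorem exists_index (h : D.IsOverUnderpassSequence k s f) {t : ℝ}
    (ht : t ∈ Ico (s 0) (s 0 + D.size)) : ∃ i < k, s i ≤ t ∧ t < s (i + 1) := by
  have key : ∀ j, t < s j → ∃ i < j, s i ≤ t ∧ t < s (i + 1) := by
    intro j
    induction j with
    | zero => intro hj; exact absurd ht.1 (not_le.2 hj)
    | succ j ih =>
      intro hj
      rcases le_or_gt (s j) t with h' | h'
      · exact ⟨j, by omega, h', hj⟩
      · obtain ⟨i, hi, h''⟩ := ih h'
        exact ⟨i, by omega, h''⟩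
  refine key k ?_
  rw [h.around]
  exact ht.2

theorem exists_overpass (h : D.IsOverUnderpassSequence k s f) {t : ℝ}
    (ht : t ∈ Ico (s 0) (s 0 + D.size)) (hO : D.IsOver t) : ∃ i < k, t ∈ Ioo (s i) (f i) := by
  obtain ⟨i, hi, h1, h2⟩ := h.exists_index ht
  refine ⟨i, hi, h1.lt_of_ne ?_, ?_⟩
  · rintro rfl
    exact (h.start_regular i hi).1 hO
  · by_contra! h3
    exact (h.underpass i hi).2 t ⟨h3, h2.le⟩ hO

theorem exists_underpass (h : D.IsOverUnderpassSequence k s f) {t : ℝ}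
    (ht : t ∈ Ico (s 0) (s 0 + D.size)) (hU : D.IsUnder t) :
    ∃ i < k, t ∈ Ioo (f i) (s (i + 1)) := by
  obtain ⟨i, hi, h1, h2⟩ := h.exists_index ht
  refine ⟨i, hi, ?_, h2⟩
  by_contra! h3
  exact (h.overpass i hi).2 t ⟨h1, h3⟩ hU

/-- Pick an overcrossing on each overpass. If two of them lay over the same crossing, then, this
being a double point, each would be above the other. -/
theorem le_c (h : D.IsOverUnderpassSequence k s f) : k ≤ D.c := by
  choose! o ho using fun i (hi : i < k) => (h.overpass i hi).1
  have hlt : ∀ i j, i < j → j < k → (D.param (o i)).1 ≠ (D.param (o j)).1 := by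
    intro i j hij hj heq
    obtain ⟨⟨a1, a2⟩, a3⟩ := ho i (by omega)
    obtain ⟨⟨b1, b2⟩, b3⟩ := ho j hj
    have c1 := h.lt_right i (by omega)
    have c2 := h.start_mono (show i + 1 ≤ j by omega) hj.le
    have c3 := h.start_mono (Nat.zero_le i) (by omega)
    have c4 := h.lt_right j hj
    have c5 := h.start_mono (show j + 1 ≤ k by omega) le_rfl
    rw [h.around] at c5
    have hne : D.param (o i) ≠ D.param (o j) := fun e => by
      have := D.isClosedCurve_param.eq_of_abs_lt e (by linarith [D.size_pos_real]) (by linarith)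
      linarith
    obtain ⟨P, hP, p1, p2⟩ := a3
    obtain ⟨Q, hQ, q1, q2⟩ := b3
    have e1 : (D.param (o j)).2 < (D.param (o i)).2 := by
      rcases D.double P hP _ (mem_range_self (o i)) _ (mem_range_self (o j)) p1 heq with e | e | e
      · rw [e] at p2; exact (lt_irrefl _ p2).elim
      · exact (hne e).elim
      · rwa [e] at p2
    have e2 : (D.param (o i)).2 < (D.param (o j)).2 := by
      rcases D.double Q hQ _ (mem_range_self (o j)) _ (mem_range_self (o i)) q1 heq.symm
        with e | e | e
      · rw [e] at q2; exact (lt_irrefl _ q2).elim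
      · exact (hne e.symm).elim
      · rwa [e] at q2
    exact lt_asymm e1 e2
  rw [c, Set.ncard_eq_toFinset_card _ D.finite_multiplePoints, ← Finset.card_range k]
  refine Finset.card_le_card_of_injOn (fun i => (D.param (o i)).1) (fun i hi => ?_)
    fun i hi j hj hij => ?_
  · have := (ho i (by simpa using hi)).2.mem_multiplePoints
    simpa using this
  · simp only [Finset.coe_range, mem_Iio] at hi hj
    rcases lt_trichotomy i j with h' | h' | h'
    · exact (hlt i j h' hj hij).elim
    · exact h'
    · exact (hlt j i h' hi hij.symm).elim

/-- Minimality excludes bigons and loops. Hence the map from crossings to pairs (overpass,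
underpass) is injective and omits, for each overpass, the underpasses just after and just before it.
-/
theorem c_le (h : D.IsOverUnderpassSequence k s f) (h0 : D.c ≠ 0)
    (hmin : ¬ ∃ D' : KnotDiagram, D'.knot = D.knot ∧ D'.c < D.c) :
    (D.c : ℤ) ≤ k * ((k : ℤ) - 2) := by
  have hn := D.size_pos_real
  have hD := D.isClosedCurve_param
  have data : ∀ x ∈ D.multiplePoints, ∃ (t u : ℝ) (i j : ℕ), i < k ∧ j < k ∧ t ∈ Ioo (s i) (f i) ∧
      u ∈ Ioo (f j) (s (j + 1)) ∧ (D.param t).1 = x ∧ (D.param u).1 = x := by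
    intro x hx
    obtain ⟨t, ht, u, hu, hO, hU, htx, hux⟩ := exists_over_under hx (s 0)
    obtain ⟨i, hi, hti⟩ := h.exists_overpass ht hO
    obtain ⟨j, hj, huj⟩ := h.exists_underpass hu hU
    exact ⟨t, u, i, j, hi, hj, hti, huj, htx, hux⟩
  choose! t u i j hi hj ht hu htx hux using data
  have hlast : ∀ {l : ℕ}, l < k → s (l + 1) ≤ s 0 + D.size := fun hl => by
    rw [← h.around]
    exact h.start_mono (by omega) le_rfl
  have hfirst : ∀ {l : ℕ}, l < k → s 0 ≤ s l := fun hl => h.start_mono (Nat.zero_le _) hl.le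
  have hinj : ∀ x ∈ D.multiplePoints, ∀ y ∈ D.multiplePoints, i x = i y → j x = j y →
      t x < t y → False := by
    intro x hx y hy hij hjj hlt
    have tx := ht x hx
    have ty := ht y hy
    have ux := hu x hx
    have uy := hu y hy
    rw [← hij] at ty
    rw [← hjj] at uy
    have a1 := h.lt_right (i x) (hi x hx)
    have a2 := hlast (hi x hx)
    have a3 := hfirst (hi x hx)
    have b1 := h.lt_left (j x) (hj x hx)
    have b2 := hlast (hj x hx)
    have b3 := hfirst (hj x hx)
    have hov : ∀ w ∈ Icc (t x) (t y), ¬ D.IsUnder w := fun w hw =>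
      (h.overpass _ (hi x hx)).2 w ⟨by linarith [hw.1, tx.1], by linarith [hw.2, ty.2]⟩
    have hne : u x ≠ u y := fun e => by
      have hxy : x = y := by rw [← hux x hx, ← hux y hy, e]
      rw [hxy] at hlt
      exact lt_irrefl _ hlt
    have hun : ∀ w w', (w = u x ∨ w = u y) → (w' = u x ∨ w' = u y) → ∀ z ∈ Icc w w',
        ¬ D.IsOver z := by
      intro w w' hw hw' z hz
      refine (h.underpass _ (hj x hx)).2 z ⟨?_, ?_⟩
      · rcases hw with rfl | rfl <;> linarith [hz.1, ux.1, uy.1]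
      · rcases hw' with rfl | rfl <;> linarith [hz.2, ux.2, uy.2]
    -- If the underpass precedes the overpass within the period, it is shifted one period ahead, so
    -- that the upper arc comes first as the bigon lemma requires.
    have hun' : ∀ w w', (w = u x ∨ w = u y) → (w' = u x ∨ w' = u y) →
        ∀ z ∈ Icc (w + D.size) (w' + D.size), ¬ D.IsOver z := by
      intro w w' hw hw' z hz hz'
      refine hun w w' hw hw' (z - D.size) ⟨by linarith [hz.1], by linarith [hz.2]⟩ ?_
      rwa [← isOver_add_size, sub_add_cancel]
    have e1 : (D.param (t x)).1 = (D.param (u x)).1 := by rw [htx x hx, hux x hx]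
    have e2 : (D.param (t y)).1 = (D.param (u y)).1 := by rw [htx y hy, hux y hy]
    rcases le_or_gt (i x) (j x) with hle | hle
    · have c1 : f (i x) ≤ f (j x) := by
        rcases hle.lt_or_eq with h' | h'
        · linarith [h.start_mono (show i x + 1 ≤ j x by omega) (hj x hx).le]
        · rw [h']
      refine hmin ?_
      rcases hne.lt_or_gt with h' | h'
      · exact exists_c_lt_of_bigon hlt (by linarith [ty.2, ux.1]) h' (by linarith [uy.2, tx.1]) hov
          (hun _ _ (.inl rfl) (.inr rfl)) (.inl ⟨e1, e2⟩)
      · exact exists_c_lt_of_bigon hlt (by linarith [ty.2, uy.1]) h' (by linarith [ux.2, tx.1]) hov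
          (hun _ _ (.inr rfl) (.inl rfl)) (.inr ⟨e1, e2⟩)
    · have c1 := h.start_mono (show j x + 1 ≤ i x by omega) (hi x hx).le
      refine hmin ?_
      rcases hne.lt_or_gt with h' | h'
      · exact exists_c_lt_of_bigon (u₁ := u x + D.size) (u₂ := u y + D.size) hlt
          (by linarith [ty.2, ux.1]) (by linarith) (by linarith [uy.2, tx.1]) hov
          (hun' _ _ (.inl rfl) (.inr rfl)) (.inl ⟨by rw [hD.periodic, e1], by rw [hD.periodic, e2]⟩)
      · exact exists_c_lt_of_bigon (u₁ := u y + D.size) (u₂ := u x + D.size) hlt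
          (by linarith [ty.2, uy.1]) (by linarith) (by linarith [ux.2, tx.1]) hov
          (hun' _ _ (.inr rfl) (.inl rfl)) (.inr ⟨by rw [hD.periodic, e1], by rw [hD.periodic, e2]⟩)
  have hnext : ∀ x ∈ D.multiplePoints, j x ≠ i x := by
    intro x hx hij
    have tx := ht x hx
    have ux := hu x hx
    rw [hij] at ux
    have a2 := hlast (hi x hx)
    have a3 := hfirst (hi x hx)
    exact hmin (exists_c_lt_of_loop tx.2 ux.1 (by linarith [ux.2, tx.1])
      (fun w hw => (h.overpass _ (hi x hx)).2 w ⟨by linarith [hw.1, tx.1], hw.2⟩)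
      (fun w hw => (h.underpass _ (hi x hx)).2 w ⟨hw.1, by linarith [hw.2, ux.2]⟩)
      (by rw [htx x hx, hux x hx]))
  have hprev : ∀ x ∈ D.multiplePoints, i x = j x + 1 → False := by
    intro x hx hij
    have tx := ht x hx
    have ux := hu x hx
    have hix := hi x hx
    have hlt' := h.lt_right (i x) hix
    rw [← hij] at ux
    have a2 := hlast (hi x hx)
    have a3 := hfirst (hj x hx)
    have a4 := h.lt_left (j x) (hj x hx)
    refine hmin (exists_c_lt_of_loop' ux.2 tx.1 (by linarith [ux.1, tx.2])
      (fun w hw => (h.underpass _ (hj x hx)).2 w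
        ⟨by linarith [hw.1, ux.1], by rw [← hij]; exact hw.2⟩)
      (fun w hw => (h.overpass _ hix).2 w ⟨hw.1, by linarith [hw.2, tx.2]⟩)
      (by rw [htx x hx, hux x hx]))
  -- The cyclic case of the preceding claim: overpass `0` is preceded by underpass `k - 1`, so the
  -- overpass is shifted by one period.
  have hprev' : ∀ x ∈ D.multiplePoints, i x = 0 → j x + 1 = k → False := by
    intro x hx hix hjx
    have tx := ht x hx
    have ux := hu x hx
    rw [hix] at tx
    rw [hjx, h.around] at ux
    have a3 := hfirst (hj x hx)
    have a4 := h.lt_left (j x) (hj x hx)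
    have hf0 : f 0 ≤ f (j x) := by
      rcases Nat.eq_zero_or_pos (j x) with h' | h'
      · rw [h']
      · have := h.start_mono (show 0 + 1 ≤ j x by omega) (hj x hx).le
        linarith [h.lt_right 0 h.pos]
    refine hmin (exists_c_lt_of_loop' (t := u x) (f := s 0 + D.size) (u := t x + D.size) ux.2
      (by linarith [tx.1]) (by linarith [tx.2, ux.1])
      (fun w hw => (h.underpass _ (hj x hx)).2 w
        ⟨by linarith [hw.1, ux.1], by rw [hjx, h.around]; exact hw.2⟩)
      (fun w hw hw' => (h.overpass 0 h.pos).2 (w - D.size)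
        ⟨by linarith [hw.1], by linarith [hw.2, tx.2]⟩ ?_)
      (by rw [hD.periodic, htx x hx, hux x hx]))
    rwa [← isUnder_add_size, sub_add_cancel]
  obtain ⟨x₀, hx₀⟩ : D.multiplePoints.Nonempty := by
    rw [Set.nonempty_iff_ne_empty]
    intro he
    exact h0 (by rw [c, he, Set.ncard_empty])
  -- For `k ≥ 2` the cyclic predecessor of `l` differs from `l`, so two distinct underpasses are
  -- really erased, and the natural number `k - 2` is not truncated.
  have hk2 : 2 ≤ k := by
    have := hi x₀ hx₀
    have := hj x₀ hx₀
    have := hnext x₀ hx₀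
    omega
  set p : ℕ → ℕ := fun l => if l = 0 then k - 1 else l - 1 with hp
  have hcard : D.c ≤ ((Finset.range k).sigma fun l => ((Finset.range k).erase l).erase (p l)).card := by
    rw [c, Set.ncard_eq_toFinset_card _ D.finite_multiplePoints]
    refine Finset.card_le_card_of_injOn (fun x => ⟨i x, j x⟩) (fun x hx => ?_)
      fun x hx y hy hxy => ?_
    · have hx : x ∈ D.multiplePoints := by simpa using hx
      refine Finset.mem_coe.2 (Finset.mem_sigma.2 ⟨Finset.mem_range.2 (hi x hx),
        Finset.mem_erase.2 ⟨fun e => ?_, Finset.mem_erase.2 ⟨hnext x hx,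
          Finset.mem_range.2 (hj x hx)⟩⟩⟩)
      simp only [hp] at e
      split_ifs at e with h'
      · exact hprev' x hx h' (by have := hj x hx; omega)
      · exact hprev x hx (by omega)
    · have hx : x ∈ D.multiplePoints := by simpa using hx
      have hy : y ∈ D.multiplePoints := by simpa using hy
      simp only [Sigma.mk.injEq, heq_eq_eq] at hxy
      rcases lt_trichotomy (t x) (t y) with h' | h' | h'
      · exact (hinj x hx y hy hxy.1 hxy.2 h').elim
      · rw [← htx x hx, ← htx y hy, h']
      · exact (hinj y hy x hx hxy.1.symm hxy.2.symm h').elim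
  rw [Finset.card_sigma] at hcard
  have hsum : ∑ l ∈ Finset.range k, (((Finset.range k).erase l).erase (p l)).card = k * (k - 2) := by
    rw [Finset.sum_congr rfl (g := fun _ => k - 2), Finset.sum_const, Finset.card_range, smul_eq_mul]
    intro l hl
    have hl' := Finset.mem_range.1 hl
    rw [Finset.card_erase_of_mem, Finset.card_erase_of_mem hl, Finset.card_range]
    · omega
    · simp only [hp, Finset.mem_erase, Finset.mem_range]
      split_ifs <;> omega
  rw [hsum] at hcard
  have : ((k - 2 : ℕ) : ℤ) = (k : ℤ) - 2 := by omega
  rw [← this]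
  exact_mod_cast hcard

end IsOverUnderpassSequence

end KnotDiagram

end

/-! ### The theorem -/

theorem theorem2p9 (K : Knot) (D : KnotDiagram) (hD : D.knot = K)
    (hmin : D.c = K.crossingNumber) :
    D.b ≤ D.c ∧ (D.c : ℤ) ≤ (D.b : ℤ) * ((D.b : ℤ) - 2) := by
  by_cases h0 : D.c = 0
  · simp [KnotDiagram.b, h0]
  · have hne : {k : ℕ | ∃ s f : ℕ → ℝ, D.IsOverUnderpassSequence k s f}.Nonempty := by
      refine KnotDiagram.exists_isOverUnderpassSequence (Set.nonempty_iff_ne_empty.2 fun he => h0 ?_)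
      rw [KnotDiagram.c, he, Set.ncard_empty]
    have hb : D.b = sInf {k : ℕ | ∃ s f : ℕ → ℝ, D.IsOverUnderpassSequence k s f} := if_neg h0
    -- The infimum is attained, so `D.b` is the length of an actual sequence; independence of the
    -- length from the sequence is not needed.
    obtain ⟨s, f, h⟩ := Nat.sInf_mem hne
    rw [← hb] at h
    refine ⟨h.le_c, h.c_le h0 ?_⟩
    rintro ⟨D', hk, hc⟩
    have : K.crossingNumber ≤ D'.c := Nat.sInf_le ⟨D', hk.trans hD, rfl⟩
    omega
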